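/- Let $N\cong\mathbb{Z}^n$ with $n\ge 2$, let $M$ be the dual lattice, and let $\Sigma$ be a smooth fan in $N_{\mathbb{R}}$ whose support is convex, of dimension $n$, and contains no line through $0$ (so every cone is a face of an $n$-dimensional one). Let $v_0,\dots,v_{m-1}$ be the primitive generators of its rays. Assume that the toric manifold $X=X_\Sigma$ is Calabi–Yau: there is $\underline{\nu}\in M$ with $\langle\underline{\nu},v_i\rangle=1$ for all $i$; let $w:X\to\mathbb{C}$ be the holomorphic function given by the character $\underline{\nu}$. Let $\omega$ be a toric Kähler form on $X$ with moment map $\mu_0:X\to M_{\mathbb{R}}$ whose image is the polyhedral set $P=\{\xi:\langle v_j,\xi\rangle\ge c_j\ \text{for all } j\}$ for some constants $c_j\in\mathbb{R}$. Fix $K_2>0$ and let $$\mu:X\to B=(M_{\mathbb{R}}/\mathbb{R}\langle\underline{\nu}\rangle)\times\mathbb{R}_{\ge -K_2^2},\qquad \mu(x)=\bigl([\mu_0(x)],\ |w(x)-K_2|^2-K_2^2\bigr)$$ be the Gross fibration. Let $\Gamma\subset B$ be the set of critical values of $\mu$, $B_0=B\setminus\Gamma$, and $F_r=\mu^{-1}(r)$.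 A stable disk bounded by $F_r$ is a stable holomorphic map $u:(\Sigma',\partial\Sigma')\to(X,F_r)$ from a nodal Riemann surface of genus zero with non-empty connected boundary, possibly with boundary marked points; its components are disks and spheres, and each contracted component contains at least three marked or nodal points. Its Maslov index is the sum of the Maslov indices of its disk components and twice the Chern numbers (of the pullback of $TX$) of its sphere components. The minimal Maslov index of $F_r$ is the minimum of the Maslov indices of the non-constant stable disks without marked points bounded by $F_r$. The wall $H$ is the set of $r\in B_0$ for which $F_r$ has minimal Maslov index less than two. Then: 1. For $r=(q_1,q_2)\in B_0$, the fiber $F_r$ bounds a non-constant stable disk of Maslov index zero in $X$ if and only if $q_2=0$. 2. The wall is $H=B_0\cap\bigl((M_{\mathbb{R}}/\mathbb{R}\langle\underline{\nu}\rangle)\times\{0\}\bigr)$. 3. For every $r\in B_0\setminus H$, the fiber $F_r$ has minimal Maslov index two. -/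

import Mathlib

open scoped Manifold ContDiff

/-! ### Fans and toric manifolds -/

/-- The cone in `N_ℝ = ℝⁿ` generated by the lattice vectors `v i`, `i ∈ σ`. -/
def latticeCone {n m : ℕ} (v : Fin m → Fin n → ℤ) (σ : Finset (Fin m)) : Set (Fin n → ℝ) :=
  {a | ∃ t : Fin m → ℝ, (∀ i, 0 ≤ t i) ∧ (∀ i, i ∉ σ → t i = 0) ∧
    a = ∑ i, t i • (fun k => (v i k : ℝ))}

/-- A smooth fan in `N = ℤⁿ` with `m` rays, whose support is convex, full-dimensional and strongly
convex.  The rays are given by their primitive generators, and a cone is recorded by the set of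
indices of its generators. -/
structure SmoothFan (n m : ℕ) where
  /-- the primitive generators of the rays -/
  ray : Fin m → Fin n → ℤ
  /-- the cones, each given by the set of its rays -/
  cones : Set (Finset (Fin m))
  empty_mem : ∅ ∈ cones
  singleton_mem : ∀ i, {i} ∈ cones
  face_mem : ∀ σ ∈ cones, ∀ τ, τ ⊆ σ → τ ∈ cones
  /-- two cones meet in their common face -/
  inter_eq : ∀ σ ∈ cones, ∀ τ ∈ cones,
    latticeCone ray σ ∩ latticeCone ray τ = latticeCone ray (σ ∩ τ)
  /-- every cone is a face of an `n`-dimensional one -/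
  pure : ∀ σ ∈ cones, ∃ τ ∈ cones, σ ⊆ τ ∧ τ.card = n
  /-- the generators of an `n`-dimensional cone form a `ℤ`-basis of `N` -/
  unimodular : ∀ σ ∈ cones, ∀ h : σ.card = n,
    IsUnit (Matrix.of fun j : Fin n => ray (σ.orderEmbOfFin h j)).det
  /-- the support is convex -/
  convex_support : Convex ℝ (⋃ σ ∈ cones, latticeCone ray σ)
  /-- the support contains no line through the origin -/
  pointed : ∀ a ∈ ⋃ σ ∈ cones, latticeCone ray σ, -a ∈ ⋃ σ ∈ cones, latticeCone ray σ → a = 0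

namespace SmoothFan

variable {n m : ℕ}

/-- Homogeneous coordinates: the points of `ℂᵐ` whose vanishing coordinates lie in one cone. -/
def HomCoord (F : SmoothFan n m) : Type :=
  {z : Fin m → ℂ // ∃ σ ∈ F.cones, ∀ i, z i = 0 → i ∈ σ}

instance (F : SmoothFan n m) : TopologicalSpace F.HomCoord :=
  inferInstanceAs (TopologicalSpace {z : Fin m → ℂ // ∃ σ ∈ F.cones, ∀ i, z i = 0 → i ∈ σ})

/-- The pairing `⟨u, v i⟩` of `u ∈ M = ℤⁿ` with the generator of the `i`-th ray. -/
def pairing (F : SmoothFan n m) (u : Fin n → ℤ) (i : Fin m) : ℤ := ∑ k, u k * F.ray i k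

/-- The group `G = ker((ℂˣ)ᵐ → N ⊗ ℂˣ)`. -/
def coxGroup (F : SmoothFan n m) : Subgroup (Fin m → ℂˣ) where
  carrier := {t | ∀ u : Fin n → ℤ, ∏ i, (t i) ^ (F.pairing u i) = 1}
  mul_mem' := by
    intro a b ha hb u
    simp only [Pi.mul_apply, mul_zpow, Finset.prod_mul_distrib, ha u, hb u, mul_one]
  one_mem' := by intro u; simp
  inv_mem' := by
    intro a ha u
    simp only [Pi.inv_apply, inv_zpow, Finset.prod_inv_distrib, ha u, inv_one]

/-- Two homogeneous coordinate vectors are equivalent if they differ by an element of `G`. -/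
instance coxSetoid (F : SmoothFan n m) : Setoid F.HomCoord where
  r z z' := ∃ t ∈ F.coxGroup, ∀ i, z'.1 i = (t i : ℂ) * z.1 i
  iseqv :=
    { refl := fun z => ⟨1, F.coxGroup.one_mem, by simp⟩
      symm := by
        rintro z z' ⟨t, ht, h⟩
        exact ⟨t⁻¹, F.coxGroup.inv_mem ht, fun i => by simp [h i]⟩
      trans := by
        rintro z z' z'' ⟨t, ht, h⟩ ⟨s, hs, h'⟩
        exact ⟨s * t, F.coxGroup.mul_mem hs ht, fun i => by simp [h i, h' i, mul_assoc]⟩ }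

/-- The toric manifold `X_Σ`, as the quotient of the space of homogeneous coordinates by `G`. -/
def ToricManifold (F : SmoothFan n m) : Type := Quotient F.coxSetoid

instance (F : SmoothFan n m) : TopologicalSpace F.ToricManifold :=
  inferInstanceAs (TopologicalSpace (Quotient F.coxSetoid))

/-- The point with given homogeneous coordinates. -/
def pt (F : SmoothFan n m) (z : F.HomCoord) : F.ToricManifold := Quotient.mk F.coxSetoid z

/-- The character `χᵘ`, `u ∈ M`, as a (meromorphic) function on `X_Σ`; at its poles the
value is irrelevant. -/
noncomputable def character (F : SmoothFan n m) (u : Fin n → ℤ) : F.ToricManifold → ℂ :=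
  Quotient.lift (fun z : F.HomCoord => ∏ i, z.1 i ^ F.pairing u i) (by
    rintro z z' ⟨t, ht, h⟩
    have h1 : ((∏ i, (t i) ^ (F.pairing u i) : ℂˣ) : ℂ) = 1 := by rw [ht u]; rfl
    push_cast at h1
    simp only [h, mul_zpow, Finset.prod_mul_distrib, h1, one_mul])

/-- The `n`-dimensional cones. -/
def MaxCone (F : SmoothFan n m) : Type := {σ : Finset (Fin m) // σ ∈ F.cones ∧ σ.card = n}

/-- The enumeration of the rays of an `n`-dimensional cone. -/
def idx (F : SmoothFan n m) (σ : F.MaxCone) : Fin n ↪o Fin m := σ.1.orderEmbOfFin σ.2.2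

/-- The basis `(ν_j)` of `M` dual to the basis of `N` given by the generators of an
`n`-dimensional cone. -/
noncomputable def dualBasis (F : SmoothFan n m) (σ : F.MaxCone) (j : Fin n) : Fin n → ℤ :=
  fun k => (Matrix.of fun l : Fin n => F.ray (F.idx σ l))⁻¹ k j

lemma pairing_dualBasis (F : SmoothFan n m) (σ : F.MaxCone) (j l : Fin n) :
    F.pairing (F.dualBasis σ j) (F.idx σ l) = if l = j then 1 else 0 := by
  have h := Matrix.mul_nonsing_inv _ (F.unimodular σ.1 σ.2.1 σ.2.2)
  have h2 := congrFun (congrFun h l) j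
  rw [Matrix.mul_apply, Matrix.one_apply] at h2
  rw [← h2]
  simp only [pairing, dualBasis, idx, Matrix.of_apply]
  exact Finset.sum_congr rfl fun k _ => mul_comm _ _

lemma dualBasis_expand (F : SmoothFan n m) (σ : F.MaxCone) (u : Fin n → ℤ) (i : Fin m) :
    F.pairing u i = ∑ j, F.pairing (F.dualBasis σ j) i * F.pairing u (F.idx σ j) := by
  have h := Matrix.nonsing_inv_mul _ (F.unimodular σ.1 σ.2.1 σ.2.2)
  have key : ∀ a b : Fin n, ∑ j, F.dualBasis σ j a * F.ray (F.idx σ j) b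
      = if a = b then 1 else 0 := by
    intro a b
    have h2 := congrFun (congrFun h a) b
    rw [Matrix.mul_apply, Matrix.one_apply] at h2
    rw [← h2]; rfl
  have : ∀ j, F.pairing (F.dualBasis σ j) i * F.pairing u (F.idx σ j)
      = ∑ a, ∑ b, F.ray i a * u b * (F.dualBasis σ j a * F.ray (F.idx σ j) b) := by
    intro j
    simp only [pairing, Finset.sum_mul_sum]
    exact Finset.sum_congr rfl fun a _ => Finset.sum_congr rfl fun b _ => by ring
  simp only [this]
  rw [Finset.sum_comm]
  simp only [pairing]
  refine Finset.sum_congr rfl fun a _ => ?_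
  rw [Finset.sum_comm]
  simp only [← Finset.mul_sum, key]
  simp [mul_comm]

lemma idx_mem (F : SmoothFan n m) (σ : F.MaxCone) (j : Fin n) : F.idx σ j ∈ σ.1 :=
  Finset.orderEmbOfFin_mem _ _ _

lemma exists_idx (F : SmoothFan n m) (σ : F.MaxCone) {i : Fin m} (hi : i ∈ σ.1) :
    ∃ j, F.idx σ j = i := by
  have := Finset.range_orderEmbOfFin σ.1 σ.2.2
  have h : i ∈ Set.range (σ.1.orderEmbOfFin σ.2.2) := by rw [this]; exact hi
  exact h

open Classical in
/-- The coordinate vector with entries `y j` at the rays of the cone and `1` elsewhere. -/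
noncomputable def sectionFun (F : SmoothFan n m) (σ : F.MaxCone) (y : Fin n → ℂ) (i : Fin m) : ℂ :=
  if h : ∃ j, F.idx σ j = i then y h.choose else 1

lemma zpow_finset_sum {ι : Type} [Fintype ι] (a : ℂˣ) (f : ι → ℤ) :
    a ^ (∑ j, f j) = ∏ j, a ^ f j := by
  classical
  induction (Finset.univ : Finset ι) using Finset.induction_on with
  | empty => simp
  | insert j s hj ih => rw [Finset.sum_insert hj, Finset.prod_insert hj, zpow_add, ih]

lemma sectionFun_idx (F : SmoothFan n m) (σ : F.MaxCone) (y : Fin n → ℂ) (j : Fin n) :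
    F.sectionFun σ y (F.idx σ j) = y j := by
  have h : ∃ l, F.idx σ l = F.idx σ j := ⟨j, rfl⟩
  rw [sectionFun, dif_pos h]
  exact congrArg y ((F.idx σ).injective h.choose_spec)

lemma sectionFun_of_notMem (F : SmoothFan n m) (σ : F.MaxCone) (y : Fin n → ℂ) {i : Fin m}
    (hi : i ∉ σ.1) : F.sectionFun σ y i = 1 := by
  rw [sectionFun, dif_neg]
  rintro ⟨j, rfl⟩
  exact hi (F.idx_mem σ j)

/-- The point of `X_Σ` with affine coordinates `y` in the chart of an `n`-dimensional cone. -/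
noncomputable def sectionHom (F : SmoothFan n m) (σ : F.MaxCone) (y : Fin n → ℂ) : F.HomCoord :=
  ⟨F.sectionFun σ y, σ.1, σ.2.1, fun i hi => by
    by_contra h
    rw [F.sectionFun_of_notMem σ y h] at hi
    exact one_ne_zero hi⟩

/-- The affine piece `U_σ`. -/
def chartSource (F : SmoothFan n m) (σ : F.MaxCone) : Set F.ToricManifold :=
  {x | ∃ z : F.HomCoord, F.pt z = x ∧ ∀ i, i ∉ σ.1 → z.1 i ≠ 0}

lemma pt_mem_chartSource (F : SmoothFan n m) (σ : F.MaxCone) (z : F.HomCoord) :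
    F.pt z ∈ F.chartSource σ ↔ ∀ i, i ∉ σ.1 → z.1 i ≠ 0 := by
  constructor
  · rintro ⟨z', hz, h⟩ i hi
    obtain ⟨t, -, ht⟩ := Quotient.exact hz
    rw [ht i]
    exact mul_ne_zero (t i).ne_zero (h i hi)
  · exact fun h => ⟨z, rfl, h⟩

lemma character_pt (F : SmoothFan n m) (u : Fin n → ℤ) (z : F.HomCoord) :
    F.character u (F.pt z) = ∏ i, z.1 i ^ F.pairing u i := rfl

lemma continuous_sectionFun (F : SmoothFan n m) (σ : F.MaxCone) (i : Fin m) :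
    Continuous fun y => F.sectionFun σ y i := by
  unfold sectionFun
  split_ifs with h
  · exact continuous_apply _
  · exact continuous_const

/-- A factor of a coordinate function is nonzero or occurs with a nonnegative exponent. -/
lemma chart_factor (F : SmoothFan n m) (σ : F.MaxCone) (j : Fin n) (i : Fin m) :
    i ∉ σ.1 ∨ 0 ≤ F.pairing (F.dualBasis σ j) i := by
  by_cases hi : i ∈ σ.1
  · right
    obtain ⟨l, rfl⟩ := F.exists_idx σ hi
    rw [F.pairing_dualBasis]
    split_ifs <;> norm_num
  · exact Or.inl hi

lemma isQuotientMap_pt (F : SmoothFan n m) : Topology.IsQuotientMap F.pt :=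
  isQuotientMap_quotient_mk'

lemma isOpen_chartSource (F : SmoothFan n m) (σ : F.MaxCone) : IsOpen (F.chartSource σ) := by
  rw [← F.isQuotientMap_pt.isOpen_preimage]
  have : F.pt ⁻¹' F.chartSource σ = ⋂ i, {z : F.HomCoord | i ∉ σ.1 → z.1 i ≠ 0} := by
    ext z
    simp [F.pt_mem_chartSource]
  rw [this]
  refine isOpen_iInter_of_finite fun i => ?_
  by_cases hi : i ∈ σ.1
  · simp [hi]
  · simp only [hi, not_false_eq_true, true_imp_iff]
    exact isOpen_ne.preimage ((continuous_apply i).comp continuous_subtype_val)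

lemma chart_left_inv (F : SmoothFan n m) (σ : F.MaxCone) (x : F.ToricManifold)
    (hx : x ∈ F.chartSource σ) :
    F.pt (F.sectionHom σ fun j => F.character (F.dualBasis σ j) x) = x := by
  obtain ⟨z, rfl, hz⟩ := hx
  apply Quotient.sound
  set y : Fin n → ℂ := fun j => F.character (F.dualBasis σ j) (F.pt z) with hy
  classical
  -- the product of the coordinates outside the cone
  let q : Fin m → ℂˣ := fun i => if h : i ∈ σ.1 then 1 else Units.mk0 (z.1 i) (hz i h)
  have hq : ∀ i, i ∈ σ.1 → q i = 1 := fun i hi => by simp [q, hi]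
  have hq' : ∀ i, i ∉ σ.1 → (q i : ℂ) = z.1 i := fun i hi => by simp [q, hi]
  let p : Fin n → ℂˣ := fun j => ∏ i, q i ^ F.pairing (F.dualBasis σ j) i
  have hyp : ∀ j, y j = (p j : ℂ) * z.1 (F.idx σ j) := by
    intro j
    have e1 : ∀ i, z.1 i ^ F.pairing (F.dualBasis σ j) i
        = ((q i ^ F.pairing (F.dualBasis σ j) i : ℂˣ) : ℂ)
          * (if i = F.idx σ j then z.1 i else 1) := by
      intro i
      by_cases hi : i ∈ σ.1
      · obtain ⟨l, rfl⟩ := F.exists_idx σ hi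
        rw [hq _ hi, F.pairing_dualBasis]
        by_cases hl : l = j
        · simp [hl]
        · simp [hl]
      · have : i ≠ F.idx σ j := fun h => hi (h ▸ F.idx_mem σ j)
        push_cast
        rw [hq' i hi]
        simp [this]
    simp only [hy, F.character_pt]
    rw [Finset.prod_congr rfl fun i _ => e1 i, Finset.prod_mul_distrib,
      Finset.prod_ite_eq' Finset.univ (F.idx σ j)]
    simp [p]
  let t : Fin m → ℂˣ := fun i => if h : ∃ j, F.idx σ j = i then (p h.choose)⁻¹ else q i
  have ht1 : ∀ j, t (F.idx σ j) = (p j)⁻¹ := by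
    intro j
    have h : ∃ l, F.idx σ l = F.idx σ j := ⟨j, rfl⟩
    have h3 : h.choose = j := (F.idx σ).injective h.choose_spec
    simp only [t]
    rw [dif_pos h, h3]
  have ht2 : ∀ i, i ∉ σ.1 → t i = q i := by
    intro i hi
    have : ¬ ∃ j, F.idx σ j = i := by
      rintro ⟨j, rfl⟩; exact hi (F.idx_mem σ j)
    simp only [t]
    rw [dif_neg this]
  have htq : ∀ i, t i = q i * (if h : ∃ j, F.idx σ j = i then (p h.choose)⁻¹ else 1) := by
    intro i
    by_cases h : ∃ j, F.idx σ j = i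
    · have hi : i ∈ σ.1 := by obtain ⟨j, rfl⟩ := h; exact F.idx_mem σ j
      simp only [t]
      rw [dif_pos h, dif_pos h, hq i hi, one_mul]
    · simp only [t]
      rw [dif_neg h, dif_neg h, mul_one]
  refine ⟨t, ?_, ?_⟩
  · intro u
    have e2 : ∏ i, (if h : ∃ j, F.idx σ j = i then (p h.choose)⁻¹ else 1) ^ F.pairing u i
        = ∏ j, (p j)⁻¹ ^ F.pairing u (F.idx σ j) := by
      symm
      apply Finset.prod_of_injOn (F.idx σ) (F.idx σ).injective.injOn (by simp)
      · intro i _ hi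
        have : ¬ ∃ j, F.idx σ j = i := by simpa using hi
        rw [dif_neg this, one_zpow]
      · intro j _
        have h : ∃ l, F.idx σ l = F.idx σ j := ⟨j, rfl⟩
        have h3 : h.choose = j := (F.idx σ).injective h.choose_spec
        rw [dif_pos h, h3]
    have e3 : ∀ i, q i ^ F.pairing u i
        = ∏ j, (q i ^ F.pairing (F.dualBasis σ j) i) ^ F.pairing u (F.idx σ j) := by
      intro i
      rw [F.dualBasis_expand σ u i]
      simp only [← zpow_mul]
      exact zpow_finset_sum _ _
    simp only [htq, mul_zpow, Finset.prod_mul_distrib]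
    rw [e2, Finset.prod_congr rfl fun i _ => e3 i, Finset.prod_comm]
    simp only [Finset.prod_zpow, ← Finset.prod_mul_distrib]
    simp [p]
  · intro i
    by_cases hi : i ∈ σ.1
    · obtain ⟨j, rfl⟩ := F.exists_idx σ hi
      change z.1 (F.idx σ j) = t (F.idx σ j) * F.sectionFun σ y (F.idx σ j)
      rw [F.sectionFun_idx, ht1, hyp]
      simp
    · change z.1 i = t i * F.sectionFun σ y i
      rw [F.sectionFun_of_notMem σ y hi, ht2 i hi, hq' i hi, mul_one]

lemma chart_right_inv (F : SmoothFan n m) (σ : F.MaxCone) (y : Fin n → ℂ) (j : Fin n) :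
    F.character (F.dualBasis σ j) (F.pt (F.sectionHom σ y)) = y j := by
  rw [F.character_pt, Finset.prod_eq_single (F.idx σ j)]
  · change F.sectionFun σ y (F.idx σ j) ^ _ = _
    rw [F.sectionFun_idx, F.pairing_dualBasis]
    simp
  · intro i _ hij
    change F.sectionFun σ y i ^ _ = _
    by_cases hi : i ∈ σ.1
    · obtain ⟨l, rfl⟩ := F.exists_idx σ hi
      have : l ≠ j := fun h => hij (by rw [h])
      rw [F.pairing_dualBasis, if_neg this, zpow_zero]
    · rw [F.sectionFun_of_notMem σ y hi, one_zpow]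
  · simp

/-- The affine chart `U_σ ≅ ℂⁿ` given by the characters of the dual basis. -/
noncomputable def chart (F : SmoothFan n m) (σ : F.MaxCone) :
    OpenPartialHomeomorph F.ToricManifold (Fin n → ℂ) where
  toFun x j := F.character (F.dualBasis σ j) x
  invFun y := F.pt (F.sectionHom σ y)
  source := F.chartSource σ
  target := Set.univ
  map_source' _ _ := Set.mem_univ _
  map_target' y _ := (F.pt_mem_chartSource σ _).2 fun i hi => by
    change F.sectionFun σ y i ≠ 0
    rw [F.sectionFun_of_notMem σ y hi]
    exact one_ne_zero
  left_inv' x hx := F.chart_left_inv σ x hx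
  right_inv' y _ := funext fun j => F.chart_right_inv σ y j
  open_source := F.isOpen_chartSource σ
  open_target := isOpen_univ
  continuousOn_toFun := by
    rw [F.isQuotientMap_pt.continuousOn_isOpen_iff (F.isOpen_chartSource σ)]
    refine continuousOn_pi.2 fun j => ?_
    change ContinuousOn (fun z : F.HomCoord => ∏ i, z.1 i ^ F.pairing (F.dualBasis σ j) i) _
    refine continuousOn_finsetProd _ fun i _ => ?_
    refine ContinuousOn.zpow₀ ((continuous_apply i).comp continuous_subtype_val).continuousOn _ ?_
    intro z hz
    rcases F.chart_factor σ j i with h | h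
    · exact Or.inl ((F.pt_mem_chartSource σ z).1 hz i h)
    · exact Or.inr h
  continuousOn_invFun := by
    refine Continuous.continuousOn ?_
    refine F.isQuotientMap_pt.continuous.comp ?_
    exact Continuous.subtype_mk (continuous_pi fun i => F.continuous_sectionFun σ i) _

lemma exists_mem_chartSource (F : SmoothFan n m) (x : F.ToricManifold) :
    ∃ σ : F.MaxCone, x ∈ F.chartSource σ := by
  obtain ⟨z, rfl⟩ := F.isQuotientMap_pt.surjective x
  obtain ⟨σ, hσ, hz⟩ := z.2
  obtain ⟨τ, hτ, hστ, hc⟩ := F.pure σ hσ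
  exact ⟨⟨τ, hτ, hc⟩, (F.pt_mem_chartSource _ z).2 fun i hi h => hi (hστ (hz i h))⟩

noncomputable instance (F : SmoothFan n m) : ChartedSpace (Fin n → ℂ) F.ToricManifold where
  atlas := Set.range F.chart
  chartAt x := F.chart (F.exists_mem_chartSource x).choose
  mem_chart_source x := (F.exists_mem_chartSource x).choose_spec
  chart_mem_atlas _ := ⟨_, rfl⟩

lemma contDiffOn_transition (F : SmoothFan n m) (𝕜 : Type) [NontriviallyNormedField 𝕜]
    [NormedAlgebra 𝕜 ℂ] (r : ℕ∞ω) (σ τ : F.MaxCone) :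
    ContDiffOn 𝕜 r (F.chart τ ∘ (F.chart σ).symm)
      ((F.chart σ).symm ⁻¹' F.chartSource τ) := by
  intro y hy
  have hy' : ∀ i, i ∉ τ.1 → F.sectionFun σ y i ≠ 0 :=
    (F.pt_mem_chartSource τ (F.sectionHom σ y)).1 hy
  apply ContDiffAt.contDiffWithinAt
  refine contDiffAt_pi.2 fun j => ?_
  change ContDiffAt 𝕜 r (fun y => ∏ i, F.sectionFun σ y i ^ F.pairing (F.dualBasis τ j) i) y
  refine contDiffAt_prod fun i _ => ?_
  have hs : ContDiffAt 𝕜 r (fun y => F.sectionFun σ y i) y := by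
    unfold sectionFun
    split_ifs with h
    · exact contDiffAt_pi.1 contDiffAt_id h.choose
    · exact contDiffAt_const
  rcases F.chart_factor τ j i with h | h
  · cases hk : F.pairing (F.dualBasis τ j) i with
    | ofNat k => simpa using hs.pow k
    | negSucc k =>
      simp only [zpow_negSucc]
      exact (hs.pow _).inv (pow_ne_zero _ (hy' i h))
  · obtain ⟨k, hk⟩ := Int.eq_ofNat_of_zero_le h
    rw [hk]
    simpa using hs.pow k

instance (F : SmoothFan n m) (r : ℕ∞ω) :
    IsManifold 𝓘(ℂ, Fin n → ℂ) r F.ToricManifold := by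
  apply isManifold_of_contDiffOn
  rintro _ _ ⟨σ, rfl⟩ ⟨τ, rfl⟩
  refine (F.contDiffOn_transition ℂ r σ τ).mono ?_
  rintro y ⟨hy, -⟩
  exact hy.2

instance (F : SmoothFan n m) (r : ℕ∞ω) :
    IsManifold 𝓘(ℝ, Fin n → ℂ) r F.ToricManifold := by
  apply isManifold_of_contDiffOn
  rintro _ _ ⟨σ, rfl⟩ ⟨τ, rfl⟩
  refine (F.contDiffOn_transition ℝ r σ τ).mono ?_
  rintro y ⟨hy, -⟩
  exact hy.2

/-! ### The torus action, toric Kähler forms and moment maps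

As always in Mathlib, the tangent space of `X_Σ` at `x` is the model space `ℂⁿ`, identified by means
of the preferred holomorphic chart at `x`; in particular the complex structure is multiplication
by `Complex.I`. -/

/-- The action of `exp(𝐢 c) ∈ (S¹)ᵐ` on `X_Σ` by multiplication of the homogeneous coordinates.
The torus `T_N = N_ℝ/N` acts through this action, by means of the surjection `(S¹)ᵐ → T_N` induced by
`ℝᵐ → N_ℝ`, `c ↦ ∑ i, c i • v i`. -/
noncomputable def torusAct (F : SmoothFan n m) (c : Fin m → ℝ) : F.ToricManifold → F.ToricManifold :=
  Quotient.map
    (fun z : F.HomCoord => (⟨fun i => Complex.exp (c i * Complex.I) * z.1 i, by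
      obtain ⟨σ, hσ, h⟩ := z.2
      exact ⟨σ, hσ, fun i hi => h i (by simpa [Complex.exp_ne_zero] using hi)⟩⟩ : F.HomCoord))
    (by
      rintro z z' ⟨t, ht, h⟩
      exact ⟨t, ht, fun i => by simp only [h i]; ring⟩)

/-- The vector field generating the circle action `t ↦ torusAct (t • c)`. -/
noncomputable def torusField (F : SmoothFan n m) (c : Fin m → ℝ) (x : F.ToricManifold) :
    Fin n → ℂ :=
  mfderiv 𝓘(ℝ, ℝ) 𝓘(ℝ, Fin n → ℂ) (fun t : ℝ => F.torusAct (t • c) x) 0 (1 : ℝ)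

/-- The expression of a two-form on `X_Σ` in a chart. -/
noncomputable def formInChart (F : SmoothFan n m)
    (κ : F.ToricManifold → (Fin n → ℂ) [⋀^Fin 2]→L[ℝ] ℝ)
    (e : OpenPartialHomeomorph F.ToricManifold (Fin n → ℂ)) (y : Fin n → ℂ) :
    (Fin n → ℂ) [⋀^Fin 2]→L[ℝ] ℝ :=
  (κ (e.symm y)).compContinuousLinearMap
    (mfderiv 𝓘(ℝ, Fin n → ℂ) 𝓘(ℝ, Fin n → ℂ) e.symm y)

/-- Toric Kähler forms: closed, positive, real forms of type `(1,1)`, invariant under `T_N`. -/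
structure IsToricKahlerForm (F : SmoothFan n m)
    (κ : F.ToricManifold → (Fin n → ℂ) [⋀^Fin 2]→L[ℝ] ℝ) : Prop where
  smooth : ∀ e ∈ atlas (Fin n → ℂ) F.ToricManifold, ContDiffOn ℝ ∞ (F.formInChart κ e) e.target
  closed : ∀ e ∈ atlas (Fin n → ℂ) F.ToricManifold, ∀ y ∈ e.target,
    extDeriv (F.formInChart κ e) y = 0
  type_one_one : ∀ x (v v' : Fin n → ℂ), κ x ![Complex.I • v, Complex.I • v'] = κ x ![v, v']
  positive : ∀ x (v : Fin n → ℂ), v ≠ 0 → 0 < κ x ![v, Complex.I • v]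
  invariant : ∀ (c : Fin m → ℝ) x,
    (κ (F.torusAct c x)).compContinuousLinearMap
      (mfderiv 𝓘(ℝ, Fin n → ℂ) 𝓘(ℝ, Fin n → ℂ) (F.torusAct c) x) = κ x

/-- Moment maps `μ₀ : X_Σ → M_ℝ` of the action of `T_N`, with the sign for which the images of the
toric divisors are facets with inward normals `v i`: `d⟨a, μ₀⟩ = κ(·, ξ_a)` for `a ∈ N_ℝ`. -/
structure IsMomentMap (F : SmoothFan n m)
    (κ : F.ToricManifold → (Fin n → ℂ) [⋀^Fin 2]→L[ℝ] ℝ)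
    (μ₀ : F.ToricManifold → Fin n → ℝ) : Prop where
  smooth : ContMDiff 𝓘(ℝ, Fin n → ℂ) 𝓘(ℝ, Fin n → ℝ) ∞ μ₀
  invariant : ∀ (c : Fin m → ℝ) x, μ₀ (F.torusAct c x) = μ₀ x
  deriv_eq : ∀ (c : Fin m → ℝ) x (v : Fin n → ℂ),
    ∑ i, c i * ∑ k, (F.ray i k : ℝ) *
      (show Fin n → ℝ from mfderiv 𝓘(ℝ, Fin n → ℂ) 𝓘(ℝ, Fin n → ℝ) μ₀ x v) k
      = κ x ![v, F.torusField c x]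

/-- The polyhedral set `P = {ξ ∈ M_ℝ : ⟨v j, ξ⟩ ≥ c j for all j}`. -/
def polyhedron (F : SmoothFan n m) (c : Fin m → ℝ) : Set (Fin n → ℝ) :=
  {ξ | ∀ j, c j ≤ ∑ k, (F.ray j k : ℝ) * ξ k}

end SmoothFan

/-! ### Holomorphic disks and spheres, Maslov indices and Chern numbers -/

section Disks

variable {n : ℕ} {X : Type} [TopologicalSpace X] [ChartedSpace (Fin n → ℂ) X]

/-- Holomorphic disks bounded by `L`: maps from the closed unit disk that are smooth up to the
boundary and holomorphic, and map the unit circle to `L`. -/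
structure IsHolomorphicDisk (n : ℕ) {X : Type} [TopologicalSpace X] [ChartedSpace (Fin n → ℂ) X]
    (L : Set X) (f : ℂ → X) : Prop where
  smooth : ContMDiffOn 𝓘(ℝ, ℂ) 𝓘(ℝ, Fin n → ℂ) ∞ f (Metric.closedBall 0 1)
  holomorphic : MDifferentiableOn 𝓘(ℂ, ℂ) 𝓘(ℂ, Fin n → ℂ) f (Metric.ball 0 1)
  boundary : ∀ z ∈ Metric.sphere (0 : ℂ) 1, f z ∈ L

open Classical in
/-- A map from the Riemann sphere in the coordinate `1/z` around `∞`. -/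
noncomputable def atInfinity (f : OnePoint ℂ → X) (z : ℂ) : X :=
  if z = 0 then f OnePoint.infty else f ((z⁻¹ : ℂ) : OnePoint ℂ)

/-- Holomorphic maps from the Riemann sphere. -/
structure IsHolomorphicSphere (n : ℕ) {X : Type} [TopologicalSpace X]
    [ChartedSpace (Fin n → ℂ) X] (f : OnePoint ℂ → X) : Prop where
  finite : MDifferentiable 𝓘(ℂ, ℂ) 𝓘(ℂ, Fin n → ℂ) (fun z : ℂ => f z)
  infinite : MDifferentiable 𝓘(ℂ, ℂ) 𝓘(ℂ, Fin n → ℂ) (atInfinity f)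

/-- The curve `g : [0, 2π] → ℂ ∖ {0}`, whose argument is a loop, has winding number `k`. -/
def HasWinding (g : ℝ → ℂ) (k : ℤ) : Prop :=
  ∃ φ : ℝ → ℝ, Continuous φ ∧
    (∀ θ, g θ ≠ 0 ∧ g θ = ‖g θ‖ * Complex.exp (φ θ * Complex.I)) ∧
    φ (2 * Real.pi) = φ 0 + 2 * Real.pi * k

variable [IsManifold 𝓘(ℂ, Fin n → ℂ) 1 X]

/-- A continuous complex trivialization of `f^*TX` over the closed unit disk, given by a frame. -/
structure IsFrame (f : ℂ → X) (e : Fin n → ℂ → (Fin n → ℂ)) : Prop where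
  continuousOn : ∀ j, ContinuousOn
    (fun z => (⟨f z, e j z⟩ : TangentBundle 𝓘(ℂ, Fin n → ℂ) X)) (Metric.closedBall 0 1)
  linearIndependent : ∀ z ∈ Metric.closedBall (0 : ℂ) 1, LinearIndependent ℂ fun j => e j z

/-- `f` is a disk with boundary on a Lagrangian submanifold with tangent spaces `TL`, and its Maslov
index is `k`.  In a complex trivialization (which is homotopic to a unitary one, so that
`GL(n,ℂ)/GL(n,ℝ)` takes the place of `U(n)/O(n)`) of `f^*TX`, the Lagrangian subspace `TL (f e^{iθ})` of `ℂⁿ`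
is spanned over `ℝ` by the columns of a matrix `A θ`, and the Gauss map
`θ ↦ (det (A θ))² / |det (A θ)|²`, which does not depend on the choice of the `ℝ`-basis, has
degree `k`. -/
def HasDiskMaslovIndex (TL : X → Submodule ℝ (Fin n → ℂ)) (f : ℂ → X) (k : ℤ) : Prop :=
  ∃ e : Fin n → ℂ → (Fin n → ℂ), IsFrame f e ∧
    ∃ A : ℝ → Matrix (Fin n) (Fin n) ℂ,
      (∀ θ : ℝ, ∃ b : Module.Basis (Fin n) ℝ (TL (f (Complex.exp (θ * Complex.I)))),
        ∀ l, (b l : Fin n → ℂ) = ∑ j, A θ j l • e j (Complex.exp (θ * Complex.I))) ∧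
      HasWinding (fun θ => (A θ).det ^ 2) k

/-- The Chern number of `f^*TX` is `k`, for a sphere `f`: frames over the two hemispheres
differ along the equator by a matrix whose determinant has winding number `k`. -/
def HasChernNumber (f : OnePoint ℂ → X) (k : ℤ) : Prop :=
  ∃ e e' : Fin n → ℂ → (Fin n → ℂ), IsFrame (fun z : ℂ => f z) e ∧ IsFrame (atInfinity f) e' ∧
    ∃ A : ℝ → Matrix (Fin n) (Fin n) ℂ,
      (∀ (θ : ℝ) (l : Fin n), e' l (Complex.exp (-(θ * Complex.I)))
        = ∑ j, A θ j l • e j (Complex.exp (θ * Complex.I))) ∧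
      HasWinding (fun θ => (A θ).det) k

end Disks

/-! ### Stable disks -/

section StableDisks

variable {n : ℕ} {X : Type} [TopologicalSpace X] [ChartedSpace (Fin n → ℂ) X]

/-- The domain of a component, as a subset of the Riemann sphere: the closed unit disk, or the
whole sphere. -/
def componentDomain (isDisk : Prop) : Set (OnePoint ℂ) :=
  {p | isDisk → ∃ z : ℂ, ‖z‖ ≤ 1 ∧ p = z}

/-- Stable disks with boundary on `L` and `k` boundary marked points.  The domain is a tree of closed
disks and Riemann spheres; the disks form a nonempty subtree and are joined to each other at boundary
points, so that the boundary is nonempty and connected, and spheres are attached at interior points.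
(The cyclic order of the marked points is not recorded: it can be arranged by relabelling.) -/
structure StableDisk (n : ℕ) {X : Type} [TopologicalSpace X] [ChartedSpace (Fin n → ℂ) X]
    (L : Set X) (k : ℕ) where
  /-- number of components -/
  size : ℕ
  /-- which components share a node -/
  graph : SimpleGraph (Fin size)
  isTree : graph.IsTree
  /-- the disk components; the others are spheres -/
  disks : Set (Fin size)
  disks_connected : (graph.induce disks).Connected
  /-- the map on each component; on a disk only its values on the closed unit disk matter -/
  map : Fin size → OnePoint ℂ → X
  disk_holomorphic : ∀ a ∈ disks, IsHolomorphicDisk n L fun z : ℂ => map a z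
  sphere_holomorphic : ∀ a, a ∉ disks → IsHolomorphicSphere n (map a)
  /-- the position on `a` of the node that joins `a` to `b` -/
  node : Fin size → Fin size → OnePoint ℂ
  node_boundary : ∀ a b, graph.Adj a b → a ∈ disks → b ∈ disks → ∃ z : ℂ, ‖z‖ = 1 ∧ node a b = z
  node_interior : ∀ a b, graph.Adj a b → a ∈ disks → b ∉ disks → ∃ z : ℂ, ‖z‖ < 1 ∧ node a b = z
  node_injective : ∀ a b b', graph.Adj a b → graph.Adj a b' → node a b = node a b' → b = b'
  node_map : ∀ a b, graph.Adj a b → map a (node a b) = map b (node b a)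
  /-- the component that carries a marked point -/
  markComponent : Fin k → Fin size
  markComponent_mem : ∀ i, markComponent i ∈ disks
  /-- the position of a marked point -/
  mark : Fin k → ℂ
  mark_boundary : ∀ i, ‖mark i‖ = 1
  mark_injective : ∀ i i', markComponent i = markComponent i' → mark i = mark i' → i = i'
  mark_ne_node : ∀ i b, graph.Adj (markComponent i) b → node (markComponent i) b ≠ mark i
  /-- a contracted component contains at least three marked or singular points -/
  stable : ∀ a, (∃ x, ∀ p ∈ componentDomain (a ∈ disks), map a p = x) →
    3 ≤ (graph.neighborSet a).ncard + {i | markComponent i = a}.ncard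

/-- The stable disk is not constant. -/
def StableDisk.Nonconstant {L : Set X} {k : ℕ} (u : StableDisk n L k) : Prop :=
  ¬ ∃ x, ∀ a, ∀ p ∈ componentDomain (a ∈ u.disks), u.map a p = x

variable [IsManifold 𝓘(ℂ, Fin n → ℂ) 1 X]

open Classical in
/-- The Maslov index of a stable disk is `d`: it is the sum of the Maslov indices of the disk
components and of twice the Chern numbers of the sphere components. -/
def StableDisk.HasMaslovIndex {L : Set X} {k : ℕ} (u : StableDisk n L k)
    (TL : X → Submodule ℝ (Fin n → ℂ)) (d : ℤ) : Prop :=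
  ∃ ind : Fin u.size → ℤ,
    (∀ a ∈ u.disks, HasDiskMaslovIndex TL (fun z : ℂ => u.map a z) (ind a)) ∧
    (∀ a, a ∉ u.disks → HasChernNumber (n := n) (u.map a) (ind a)) ∧
    d = ∑ a, if a ∈ u.disks then ind a else 2 * ind a

/-- The minimal Maslov index of `L` exists and is `d`. -/
def IsMinimalMaslovIndex (L : Set X) (TL : X → Submodule ℝ (Fin n → ℂ)) (d : ℤ) : Prop :=
  IsLeast {d' | ∃ u : StableDisk n L 0, u.Nonconstant ∧ u.HasMaslovIndex TL d'} d

end StableDisks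

/-! ### Gross fibrations -/

namespace SmoothFan

variable {n m : ℕ}

/-- The line `ℝ⟨ν⟩ ⊂ M_ℝ`. -/
abbrev realLine (ν : Fin n → ℤ) : Submodule ℝ (Fin n → ℝ) :=
  Submodule.span ℝ {fun k => (ν k : ℝ)}

instance (ν : Fin n → ℤ) : IsClosed (realLine ν : Set (Fin n → ℝ)) :=
  Submodule.closed_of_finiteDimensional _

/-- The space `M_ℝ/ℝ⟨ν⟩ × ℝ` that contains the base. -/
abbrev GrossTarget (ν : Fin n → ℤ) : Type := ((Fin n → ℝ) ⧸ realLine ν) × ℝ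

/-- The Gross fibration `x ↦ ([μ₀ x], |w x - K₂|² - K₂²)`, where `w = χ^ν`. -/
noncomputable def grossMap (F : SmoothFan n m) (ν : Fin n → ℤ) (μ₀ : F.ToricManifold → Fin n → ℝ)
    (K₂ : ℝ) (x : F.ToricManifold) : GrossTarget ν :=
  ((realLine ν).mkQ (μ₀ x), ‖F.character ν x - K₂‖ ^ 2 - K₂ ^ 2)

/-- The base `B = M_ℝ/ℝ⟨ν⟩ × ℝ_{≥ -K₂²}`. -/
def grossBase (ν : Fin n → ℤ) (K₂ : ℝ) : Set (GrossTarget ν) := {r | -K₂ ^ 2 ≤ r.2}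

/-- The differential of the Gross fibration. -/
noncomputable def grossDeriv (F : SmoothFan n m) (ν : Fin n → ℤ)
    (μ₀ : F.ToricManifold → Fin n → ℝ) (K₂ : ℝ) (x : F.ToricManifold) :
    (Fin n → ℂ) →L[ℝ] GrossTarget ν :=
  mfderiv 𝓘(ℝ, Fin n → ℂ) 𝓘(ℝ, GrossTarget ν) (F.grossMap ν μ₀ K₂) x

/-- The Gross fiber `F_r`. -/
def grossFiber (F : SmoothFan n m) (ν : Fin n → ℤ) (μ₀ : F.ToricManifold → Fin n → ℝ)
    (K₂ : ℝ) (r : GrossTarget ν) : Set F.ToricManifold := {x | F.grossMap ν μ₀ K₂ x = r}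

/-- The tangent spaces of the regular fibers. -/
noncomputable def grossTangent (F : SmoothFan n m) (ν : Fin n → ℤ)
    (μ₀ : F.ToricManifold → Fin n → ℝ) (K₂ : ℝ) (x : F.ToricManifold) :
    Submodule ℝ (Fin n → ℂ) :=
  LinearMap.ker (F.grossDeriv ν μ₀ K₂ x : (Fin n → ℂ) →ₗ[ℝ] GrossTarget ν)

/-- The discriminant locus: the critical values of the Gross fibration. -/
def discriminant (F : SmoothFan n m) (ν : Fin n → ℤ) (μ₀ : F.ToricManifold → Fin n → ℝ)
    (K₂ : ℝ) : Set (GrossTarget ν) :=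
  {r | ∃ x ∈ F.grossFiber ν μ₀ K₂ r, ¬ Function.Surjective (F.grossDeriv ν μ₀ K₂ x)}

/-- `B₀`, the complement of the discriminant locus in `B`. -/
def grossRegular (F : SmoothFan n m) (ν : Fin n → ℤ) (μ₀ : F.ToricManifold → Fin n → ℝ)
    (K₂ : ℝ) : Set (GrossTarget ν) := grossBase ν K₂ \ F.discriminant ν μ₀ K₂

/-- The wall: the `r ∈ B₀` for which `F_r` has minimal Maslov index less than two. -/
def wall (F : SmoothFan n m) (ν : Fin n → ℤ) (μ₀ : F.ToricManifold → Fin n → ℝ)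
    (K₂ : ℝ) : Set (GrossTarget ν) :=
  {r ∈ F.grossRegular ν μ₀ K₂ | ∃ d : ℤ, d < 2 ∧
    IsMinimalMaslovIndex (F.grossFiber ν μ₀ K₂ r) (F.grossTangent ν μ₀ K₂) d}

end SmoothFan

/-! Since ν pairs to 1 with every ray, w is the product of the affine coordinates in every toric
chart, and the chart changes have Jacobian determinant ±1 (`det_fderiv_transition`). Hence the
square of the holomorphic volume form dy₁∧…∧dyₙ is globally defined and nowhere zero. On the tangent
space of a regular fibre this square equals (-1)ⁿ(w - K₂)² up to a positive factor
(`exists_det_sq_grossTangent`): the tangent space is isotropic, it contains the torus directions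
that preserve w, and its remaining direction moves w by a real multiple of i(w - K₂). So the Maslov
index of a disk is twice the winding number of w - K₂ along its boundary, and spheres have Chern
number zero.

On a regular fibre |w - K₂| is a positive constant, so for a holomorphic disk this winding number is
nonnegative, and it vanishes only if w is constant on the disk (`exists_hasWinding_of_norm_eq`).
Adding up the components, a stable disk has index 2N with N ≥ 0, and N = 0 makes w constant on the
whole tree (`exists_stable_index_eq`). If the constant is nonzero, the disk lies in the open orbit.
There [μ₀] and |w| determine the moduli of all coordinates, because in logarithmic coordinates μ₀ is
the gradient of a strictly convex function (`isConvexGradient_moment`). The coordinates then have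
constant modulus on the boundary and no zeros, so they are constant
(`not_nonconstant_of_character_eq`). A nonconstant disk of index zero therefore has w = 0, and its
boundary forces q₂ = 0.

Conversely, over q₂ = 0 the fibre meets a toric divisor at a point where exactly one coordinate
vanishes, and rotating another coordinate fills a disk inside the divisor. Over q₂ ≠ 0 one
prescribes w = K₂ + ρz with ρ² = q₂ + K₂². The fibre then dictates the moduli of the coordinates
along the circle as smooth functions, and solving the Dirichlet problem for their logarithms
(`exists_holomorphic_re_eq`) gives a disk of index two. Evenness of the index does the rest. -/

namespace HasWinding

/-! ### Winding numbers -/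

lemma of_exp {r : ℝ → ℝ} {φ : ℝ → ℝ} {k : ℤ} (hr : ∀ θ, 0 < r θ) (hφ : Continuous φ)
    (hk : φ (2 * Real.pi) = φ 0 + 2 * Real.pi * k) :
    HasWinding (fun θ => r θ * Complex.exp (φ θ * Complex.I)) k := by
  refine ⟨φ, hφ, fun θ => ⟨mul_ne_zero (by exact_mod_cast (hr θ).ne') (Complex.exp_ne_zero _), ?_⟩, hk⟩
  rw [norm_mul, Complex.norm_exp_ofReal_mul_I, mul_one, Complex.norm_real,
    Real.norm_of_nonneg (hr θ).le]

lemma const {a : ℂ} (ha : a ≠ 0) : HasWinding (fun _ => a) 0 := by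
  refine ⟨fun _ => a.arg, continuous_const, fun θ => ⟨ha, ?_⟩, by simp⟩
  exact (Complex.norm_mul_exp_arg_mul_I a).symm

lemma mul {g g' : ℝ → ℂ} {k k' : ℤ} (h : HasWinding g k) (h' : HasWinding g' k') :
    HasWinding (fun θ => g θ * g' θ) (k + k') := by
  obtain ⟨φ, hc, h, hk⟩ := h
  obtain ⟨φ', hc', h', hk'⟩ := h'
  refine ⟨fun θ => φ θ + φ' θ, hc.add hc', fun θ => ⟨mul_ne_zero (h θ).1 (h' θ).1, ?_⟩, ?_⟩
  · change g θ * g' θ = _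
    rw [norm_mul]
    conv_lhs => rw [(h θ).2, (h' θ).2]
    push_cast
    rw [add_mul, Complex.exp_add]
    ring
  · simp only [hk, hk']
    push_cast
    ring

lemma inv {g : ℝ → ℂ} {k : ℤ} (h : HasWinding g k) : HasWinding (fun θ => (g θ)⁻¹) (-k) := by
  obtain ⟨φ, hc, h, hk⟩ := h
  refine ⟨fun θ => -φ θ, hc.neg, fun θ => ⟨inv_ne_zero (h θ).1, ?_⟩, ?_⟩
  · change (g θ)⁻¹ = _
    rw [norm_inv]
    conv_lhs => rw [(h θ).2]
    rw [mul_inv, ← Complex.exp_neg]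
    push_cast
    rw [neg_mul]
  · simp only [hk]
    push_cast
    ring

lemma sq {g : ℝ → ℂ} {k : ℤ} (h : HasWinding g k) : HasWinding (fun θ => g θ ^ 2) (2 * k) := by
  simpa only [pow_two, two_mul] using h.mul h

lemma pos_mul {g : ℝ → ℂ} {k : ℤ} (h : HasWinding g k) {r : ℝ → ℝ} (hr : ∀ θ, 0 < r θ) :
    HasWinding (fun θ => r θ * g θ) k := by
  have h1 : HasWinding (fun θ => (r θ : ℂ)) 0 := by
    simpa using of_exp (φ := fun _ => 0) (k := 0) hr continuous_const (by simp)
  simpa using h1.mul h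

/-- Two continuous arguments of the same curve differ by 2π times a continuous integer-valued
function, which is constant on ℝ. -/
lemma unique {g : ℝ → ℂ} {k k' : ℤ} (h : HasWinding g k) (h' : HasWinding g k') : k = k' := by
  obtain ⟨φ, hc, h, hk⟩ := h
  obtain ⟨φ', hc', h', hk'⟩ := h'
  have h1 : ∀ θ, ∃ j : ℤ, φ θ = φ' θ + j * (2 * Real.pi) := by
    intro θ
    have e := (h θ).2.symm.trans (h' θ).2
    have e2 := mul_left_cancel₀ (by simpa using (h θ).1) e
    obtain ⟨j, hj⟩ := Complex.exp_eq_exp_iff_exists_int.1 e2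
    refine ⟨j, ?_⟩
    have : ((φ θ : ℂ) - (φ' θ + j * (2 * Real.pi))) * Complex.I = 0 := by
      rw [sub_mul, hj]; ring
    have := (mul_eq_zero.1 this).resolve_right Complex.I_ne_zero
    exact_mod_cast sub_eq_zero.1 this
  choose j hj using h1
  have hjc : Continuous j := by
    rw [Int.isClosedEmbedding_coe_real.isInducing.continuous_iff]
    have : ((↑) : ℤ → ℝ) ∘ j = fun θ => (φ θ - φ' θ) / (2 * Real.pi) := by
      funext θ
      rw [hj θ]
      field_simp
      simp
    rw [this]
    fun_prop
  have h3 := PreconnectedSpace.constant inferInstance hjc (x := 0) (y := 2 * Real.pi)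
  have h4 := hj (2 * Real.pi)
  rw [hk, hk', hj 0, h3] at h4
  have h5 : 2 * Real.pi * ((k : ℝ) - k') = 0 := by linarith
  have h6 := (mul_eq_zero.1 h5).resolve_left (by positivity)
  exact_mod_cast sub_eq_zero.1 h6

/-- A loop that bounds a disk in `ℂ ∖ {0}` has winding number zero. -/
lemma of_continuousOn_closedBall {D : ℂ → ℂ} (hD : ContinuousOn D (Metric.closedBall 0 1))
    (h0 : ∀ z ∈ Metric.closedBall (0 : ℂ) 1, D z ≠ 0) :
    HasWinding (fun θ => D (Complex.exp (θ * Complex.I))) 0 := by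
  -- The radial retraction onto the closed disk extends `D` to a nowhere vanishing continuous
  -- function on the plane, which has a continuous logarithm because the plane is simply connected.
  let p : ℂ → ℂ := fun z => ((max 1 ‖z‖)⁻¹ : ℝ) * z
  have hpc : Continuous p := by
    refine (Complex.continuous_ofReal.comp (Continuous.inv₀ (by fun_prop) fun z => ?_)).mul
      continuous_id
    exact (lt_of_lt_of_le one_pos (le_max_left _ _)).ne'
  have hp : ∀ z, p z ∈ Metric.closedBall (0 : ℂ) 1 := by
    intro z
    have h1 : (0 : ℝ) < max 1 ‖z‖ := lt_of_lt_of_le one_pos (le_max_left _ _)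
    rw [mem_closedBall_zero_iff, norm_mul, Complex.norm_real, norm_inv,
      Real.norm_of_nonneg h1.le, inv_mul_le_iff₀ h1, mul_one]
    exact le_max_right _ _
  have hDp : Continuous (D ∘ p) := hD.comp_continuous hpc hp
  obtain ⟨f, hf, he⟩ := Complex.exists_continuousOn_eqOn_exp_comp (U := Set.univ) (g := D ∘ p)
    (by
      have := (convex_univ (𝕜 := ℝ) (E := ℂ)).contractibleSpace ⟨0, trivial⟩
      exact SimplyConnectedSpace.ofContractible _) isOpen_univ
    hDp.continuousOn (by rintro ⟨z, -, hz⟩; exact h0 _ (hp z) hz)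
  have hp1 : ∀ θ : ℝ, p (Complex.exp (θ * Complex.I)) = Complex.exp (θ * Complex.I) := by
    intro θ
    simp [p, Complex.norm_exp_ofReal_mul_I]
  have key : ∀ θ : ℝ, D (Complex.exp (θ * Complex.I))
      = (Real.exp (f (Complex.exp (θ * Complex.I))).re : ℝ)
        * Complex.exp ((f (Complex.exp (θ * Complex.I))).im * Complex.I) := by
    intro θ
    have h2 := he (Set.mem_univ (Complex.exp (θ * Complex.I)))
    simp only [Function.comp, hp1] at h2
    rw [← h2, Complex.ofReal_exp, ← Complex.exp_add, Complex.re_add_im]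
  have hfc : Continuous f := continuousOn_univ.1 hf
  simp only [key]
  refine of_exp (fun _ => Real.exp_pos _) ?_ ?_
  · exact Complex.continuous_im.comp (hfc.comp (by fun_prop))
  · simp [Complex.exp_two_pi_mul_I]

end HasWinding

/-! ### Holomorphic functions of constant modulus on the circle -/

/-- The argument of a holomorphic function of constant modulus on the unit circle increases. -/
lemma exists_hasWinding_of_norm_eq {h : ℂ → ℂ} {ρ : ℝ} (hρ : 0 < ρ)
    (hs : ContDiffOn ℝ ∞ h (Metric.closedBall 0 1)) (hh : DifferentiableOn ℂ h (Metric.ball 0 1))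
    (hb : ∀ z ∈ Metric.sphere (0 : ℂ) 1, ‖h z‖ = ρ) :
    ∃ k : ℕ, HasWinding (fun θ => h (Complex.exp (θ * Complex.I))) k ∧
      (k = 0 → ∀ z ∈ Metric.closedBall (0 : ℂ) 1, h z = h 1) := by
  have hcl : closure (Metric.ball (0 : ℂ) 1) = Metric.closedBall 0 1 := closure_ball 0 one_ne_zero
  have hu : UniqueDiffOn ℝ (Metric.closedBall (0 : ℂ) 1) :=
    uniqueDiffOn_convex (convex_closedBall 0 1) ⟨0, by
      rw [interior_closedBall _ one_ne_zero]; simp⟩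
  set D := fderivWithin ℝ h (Metric.closedBall 0 1) with hDdef
  have hDc : ContinuousOn D (Metric.closedBall 0 1) :=
    hs.continuousOn_fderivWithin hu (by simp)
  have hD : ∀ z ∈ Metric.closedBall (0 : ℂ) 1, HasFDerivWithinAt h (D z) (Metric.closedBall 0 1) z :=
    fun z hz => ((hs.differentiableOn (by simp)) z hz).hasFDerivWithinAt
  have hDI : ∀ z ∈ Metric.closedBall (0 : ℂ) 1, D z Complex.I = Complex.I * D z 1 := by
    -- The Cauchy–Riemann equation holds inside the disk and passes to the circle because `D` is
    -- continuous up to the boundary.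
    have e : Set.EqOn (fun z => D z Complex.I) (fun z => Complex.I * D z 1) (Metric.ball 0 1) := by
      intro z hz
      have h1 := (hh.differentiableAt (Metric.isOpen_ball.mem_nhds hz)).hasFDerivAt
      have h2 : D z = (fderiv ℂ h z).restrictScalars ℝ :=
        (h1.restrictScalars ℝ).hasFDerivWithinAt.fderivWithin
          (hu z (Metric.ball_subset_closedBall hz))
      simp only [h2, ContinuousLinearMap.coe_restrictScalars']
      rw [← smul_eq_mul, ← map_smul, smul_eq_mul, mul_one]
    exact e.of_subset_closure (hDc.clm_apply continuousOn_const)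
      (continuousOn_const.mul (hDc.clm_apply continuousOn_const)) Metric.ball_subset_closedBall
      hcl.ge
  have hDv : ∀ z ∈ Metric.closedBall (0 : ℂ) 1, ∀ v, D z v = v * D z 1 := by
    intro z hz v
    have : v = v.re • (1 : ℂ) + v.im • Complex.I := by simp [Complex.re_add_im]
    conv_lhs => rw [this]
    rw [map_add, map_smul, map_smul, hDI z hz]
    conv_rhs => rw [← Complex.re_add_im v]
    simp only [Complex.real_smul]
    ring
  set S : ℝ → ℂ := fun θ => Complex.exp (θ * Complex.I) with hS
  have hSn : ∀ θ, ‖S θ‖ = 1 := fun θ => Complex.norm_exp_ofReal_mul_I θ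
  have hSb : ∀ θ, S θ ∈ Metric.closedBall (0 : ℂ) 1 := fun θ => by simp [hSn]
  have hSc : Continuous S := by fun_prop
  have hSd : ∀ θ, HasDerivAt S (Complex.I * S θ) θ := by
    intro θ
    have h1 : HasDerivAt (fun θ : ℝ => (θ : ℂ) * Complex.I) (1 * Complex.I) θ :=
      (Complex.ofRealCLM.hasDerivAt (x := θ)).mul_const _
    exact h1.cexp.congr_deriv (by rw [hS]; ring)
  set H : ℝ → ℂ := fun θ => h (S θ) with hH
  have hHn : ∀ θ, ‖H θ‖ = ρ := fun θ => hb _ (by simp [hSn])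
  have hH0 : ∀ θ, H θ ≠ 0 := fun θ => norm_ne_zero_iff.1 (by rw [hHn]; exact hρ.ne')
  have hHd : ∀ θ, HasDerivAt H (Complex.I * S θ * D (S θ) 1) θ := by
    intro θ
    have := (hD _ (hSb θ)).comp_hasDerivWithinAt θ (hSd θ).hasDerivWithinAt
      (s := Set.univ) (fun _ _ => hSb _)
    rw [hasDerivWithinAt_univ, hDv _ (hSb θ)] at this
    exact this
  have hle : ∀ z ∈ Metric.closedBall (0 : ℂ) 1, ‖h z‖ ≤ ρ := by
    intro z hz
    refine Complex.norm_le_of_forall_mem_frontier_norm_le Metric.isBounded_ball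
      ⟨hh, hcl ▸ hs.continuousOn⟩ (fun w hw => ?_) (hcl ▸ hz)
    rw [frontier_ball _ one_ne_zero] at hw
    exact (hb w hw).le
  -- This is z h'(z)/h(z) on the circle, so that H' = i a H. Its real part is the angular speed of
  -- `H`, and its imaginary part vanishes because |H| is constant.
  set a : ℝ → ℂ := fun θ => S θ * D (S θ) 1 / H θ with ha
  have hac : Continuous a := by
    refine Continuous.div (hSc.mul ?_) (hs.continuousOn.comp_continuous hSc hSb) hH0
    exact (hDc.comp_continuous hSc hSb).clm_apply continuous_const
  have hre : ∀ θ, 0 ≤ (a θ).re := by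
    intro θ
    have hm : IsLocalMaxOn (fun z => ‖h z‖ ^ 2) (Metric.closedBall 0 1) (S θ) := by
      refine Filter.eventually_of_mem self_mem_nhdsWithin fun z hz => ?_
      have := hle z hz
      have h2 := hHn θ
      simp only [hH] at h2
      simp only [h2]
      gcongr
    -- By the maximum principle |h|² is maximal at each boundary point, so its derivative in the
    -- inward direction -S θ is nonpositive.
    have h3 := hm.hasFDerivWithinAt_nonpos ((hD _ (hSb θ)).norm_sq) (y := 0 - S θ)
      (sub_mem_posTangentConeAt_of_segment_subset
        ((convex_closedBall 0 1).segment_subset (hSb θ) (by simp)))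
    have h4 : a θ = (ρ ^ 2 : ℝ)⁻¹ • (starRingEnd ℂ (H θ) * (S θ * D (S θ) 1)) := by
      have : (ρ ^ 2 : ℝ) = H θ * starRingEnd ℂ (H θ) := by
        rw [Complex.mul_conj, Complex.normSq_eq_norm_sq, hHn]
      have h5 : starRingEnd ℂ (H θ) ≠ 0 := by simpa using hH0 θ
      rw [Complex.real_smul, Complex.ofReal_inv, this, ha]
      have := hH0 θ
      field_simp
    rw [h4, Complex.smul_re]
    refine mul_nonneg (by positivity) ?_
    simp only [smul_apply, ContinuousLinearMap.comp_apply,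
      hDv _ (hSb θ) (0 - S θ), innerSL_apply_apply, Complex.inner] at h3
    have h6 : (starRingEnd ℂ (H θ) * (S θ * D (S θ) 1)).re
        = -((0 - S θ) * D (S θ) 1 * starRingEnd ℂ (h (S θ))).re := by
      rw [← Complex.neg_re]
      congr 1
      simp only [hH]
      ring
    rw [h6]
    simp only [nsmul_eq_mul] at h3
    push_cast at h3
    linarith
  have him : ∀ θ, (a θ).im = 0 := by
    intro θ
    have h1 : HasDerivAt (fun θ => ‖H θ‖ ^ 2) 0 θ := by
      simp only [hHn]
      exact hasDerivAt_const _ _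
    have h2 := (hHd θ).norm_sq.unique h1
    have h4 : a θ = (ρ ^ 2 : ℝ)⁻¹ • (starRingEnd ℂ (H θ) * (S θ * D (S θ) 1)) := by
      have : (ρ ^ 2 : ℝ) = H θ * starRingEnd ℂ (H θ) := by
        rw [Complex.mul_conj, Complex.normSq_eq_norm_sq, hHn]
      have h5 : starRingEnd ℂ (H θ) ≠ 0 := by simpa using hH0 θ
      rw [Complex.real_smul, Complex.ofReal_inv, this, ha]
      have := hH0 θ
      field_simp
    rw [h4, Complex.smul_im]
    rw [Complex.inner] at h2
    have h6 : (Complex.I * S θ * D (S θ) 1 * starRingEnd ℂ (H θ)).re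
        = -(starRingEnd ℂ (H θ) * (S θ * D (S θ) 1)).im := by
      rw [show Complex.I * S θ * D (S θ) 1 * starRingEnd ℂ (H θ)
        = Complex.I * (starRingEnd ℂ (H θ) * (S θ * D (S θ) 1)) by ring, Complex.I_mul_re]
    rw [h6] at h2
    have : (starRingEnd ℂ (H θ) * (S θ * D (S θ) 1)).im = 0 := by linarith
    rw [this, smul_zero]
  set α : ℝ → ℝ := fun θ => (a θ).re with hα
  have hαc : Continuous α := Complex.continuous_re.comp hac
  -- The total change of argument of `H` since time 0; it is monotone because `a` has nonnegative
  -- real part.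
  set ψ : ℝ → ℝ := fun θ => ∫ t in (0 : ℝ)..θ, α t with hψ
  have hψd : ∀ θ, HasDerivAt ψ (α θ) θ := fun θ =>
    intervalIntegral.integral_hasDerivAt_right (hαc.intervalIntegrable _ _)
      (hαc.stronglyMeasurableAtFilter _ _) hαc.continuousAt
  have hψ0 : ψ 0 = 0 := by simp [hψ]
  have hψm : Monotone ψ := monotone_of_deriv_nonneg (fun θ => (hψd θ).differentiableAt)
    (fun θ => by rw [(hψd θ).deriv]; exact hre θ)
  have hHψ : ∀ θ, H θ = H 0 * Complex.exp (ψ θ * Complex.I) := by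
    have hd : ∀ θ, HasDerivAt (fun θ => H θ * Complex.exp (-(ψ θ * Complex.I))) 0 θ := by
      intro θ
      have h1 := (((hψd θ).ofReal_comp.mul_const Complex.I).fun_neg).cexp
      refine ((hHd θ).mul h1).congr_deriv ?_
      have h2 : S θ * D (S θ) 1 = α θ * H θ := by
        have : a θ = α θ := Complex.ext rfl (by simp [him])
        rw [← this, ha]
        exact (div_mul_cancel₀ _ (hH0 θ)).symm
      linear_combination Complex.I * Complex.exp (-(ψ θ * Complex.I)) * h2
    have hc := is_const_of_deriv_eq_zero (fun θ => (hd θ).differentiableAt)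
      (fun θ => (hd θ).deriv)
    intro θ
    have h1 := hc θ 0
    simp only [hψ0, Complex.ofReal_zero, zero_mul, neg_zero, Complex.exp_zero, mul_one] at h1
    rw [← h1, mul_assoc, ← Complex.exp_add]
    simp
  have hper : H (2 * Real.pi) = H 0 := by
    simp [hH, hS, Complex.exp_two_pi_mul_I]
  have h1 : Complex.exp (ψ (2 * Real.pi) * Complex.I) = 1 := by
    have := hHψ (2 * Real.pi)
    rw [hper] at this
    exact (mul_left_cancel₀ (hH0 0) (by rw [mul_one]; exact this)).symm
  obtain ⟨k, hk⟩ := Complex.exp_eq_one_iff.1 h1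
  have hk' : ψ (2 * Real.pi) = 2 * Real.pi * k := by
    have : ((ψ (2 * Real.pi) : ℂ) - (2 * Real.pi * k : ℝ)) * Complex.I = 0 := by
      rw [sub_mul, hk]; push_cast; ring
    have := (mul_eq_zero.1 this).resolve_right Complex.I_ne_zero
    exact_mod_cast sub_eq_zero.1 this
  have hk0 : 0 ≤ k := by
    have h2 : ψ 0 ≤ ψ (2 * Real.pi) := hψm (by positivity)
    rw [hψ0, hk'] at h2
    exact_mod_cast nonneg_of_mul_nonneg_right h2 (by positivity)
  obtain ⟨k, rfl⟩ := Int.eq_ofNat_of_zero_le hk0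
  refine ⟨k, ?_, ?_⟩
  · have h2 := HasWinding.of_exp (r := fun _ => 1) (k := k) (fun _ => one_pos)
      (continuous_iff_continuousAt.2 fun θ => (hψd θ).continuousAt) (by rw [hk', hψ0]; simp)
    have h3 := (HasWinding.const (hH0 0)).mul h2
    simp only [zero_add, Complex.ofReal_one, one_mul, ← hHψ] at h3
    exact h3
  -- A monotone argument with no net increase is constant on [0, 2π]. So `h` is constant on the
  -- circle, hence on the disk by the maximum principle.
  · rintro rfl z hz
    have hψz : ∀ θ, 0 ≤ θ → θ ≤ 2 * Real.pi → ψ θ = 0 := by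
      intro θ h2 h3
      have h4 := hψm h2
      have h5 := hψm h3
      rw [hk'] at h5
      rw [hψ0] at h4
      simp at h5
      linarith
    have hHc : ∀ θ, 0 ≤ θ → θ ≤ 2 * Real.pi → H θ = h 1 := by
      intro θ h2 h3
      rw [hHψ, hψz θ h2 h3]
      simp [hH, hS]
    refine Complex.eqOn_closure_of_eqOn_frontier Metric.isBounded_ball
      (⟨hh, hcl ▸ hs.continuousOn⟩ : DiffContOnCl ℂ h (Metric.ball 0 1))
      (diffContOnCl_const (c := h 1)) ?_ (hcl ▸ hz)
    intro w hw
    rw [frontier_ball _ one_ne_zero, mem_sphere_zero_iff_norm] at hw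
    have h2 : w = S w.arg := by
      have := Complex.norm_mul_exp_arg_mul_I w
      rw [hw] at this
      simpa using this.symm
    rcases le_or_gt 0 w.arg with h3 | h3
    · conv_lhs => rw [h2]
      exact hHc _ h3 (by linarith [Complex.arg_le_pi w, Real.pi_pos])
    · have h4 : w = S (w.arg + 2 * Real.pi) := by
        conv_lhs => rw [h2]
        simp [hS, add_mul, Complex.exp_add, Complex.exp_two_pi_mul_I]
      conv_lhs => rw [h4]
      exact hHc _ (by linarith [Complex.neg_pi_lt_arg w]) (by linarith)

/-! ### Power series and Fourier series smooth up to the circle -/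

lemma norm_pow_sub_pow_sub_le {z w : ℂ} (hz : ‖z‖ ≤ 1) (hw : ‖w‖ ≤ 1) (j : ℕ) :
    ‖z ^ j - w ^ j - j * w ^ (j - 1) * (z - w)‖ ≤ j ^ 2 * ‖z - w‖ ^ 2 := by
  induction j with
  | zero => simp
  | succ j ih =>
    -- The first-order Taylor remainder of the power j + 1 is z times that of the power j, plus an
    -- explicit quadratic term.
    have e : z ^ (j + 1) - w ^ (j + 1) - (j + 1 : ℕ) * w ^ (j + 1 - 1) * (z - w)
        = z * (z ^ j - w ^ j - j * w ^ (j - 1) * (z - w)) + j * w ^ (j - 1) * (z - w) ^ 2 := by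
      rcases j with _ | j
      · simp
      · simp only [Nat.add_sub_cancel]
        push_cast
        ring
    rw [e]
    have h1 : ‖w‖ ^ (j - 1) ≤ 1 := pow_le_one₀ (norm_nonneg _) hw
    calc _ ≤ ‖z‖ * ‖z ^ j - w ^ j - j * w ^ (j - 1) * (z - w)‖
          + j * ‖w‖ ^ (j - 1) * ‖z - w‖ ^ 2 := by
          refine (norm_add_le _ _).trans_eq ?_
          simp
      _ ≤ 1 * (j ^ 2 * ‖z - w‖ ^ 2) + j * 1 * ‖z - w‖ ^ 2 := by gcongr
      _ ≤ ((j + 1 : ℕ) : ℝ) ^ 2 * ‖z - w‖ ^ 2 := by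
          push_cast
          nlinarith [mul_nonneg (j.cast_nonneg (α := ℝ)) (sq_nonneg ‖z - w‖), sq_nonneg ‖z - w‖]

/-- Rapidly decreasing sequences. -/
def IsRapid (a : ℕ → ℂ) : Prop := ∀ p : ℕ, Summable fun k : ℕ => (k : ℝ) ^ p * ‖a k‖

lemma IsRapid.mul_sub {a : ℕ → ℂ} (ha : IsRapid a) (s : ℕ) :
    IsRapid fun k : ℕ => a k * ((k - s : ℕ) : ℂ) := by
  intro p
  refine (ha (p + 1)).of_nonneg_of_le (fun k => by positivity) fun k => ?_
  rw [norm_mul, Complex.norm_natCast, pow_succ, mul_assoc, mul_comm ‖a k‖]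
  have : ((k - s : ℕ) : ℝ) ≤ k := by exact_mod_cast Nat.sub_le k s
  gcongr

lemma IsRapid.summable {a : ℕ → ℂ} (ha : IsRapid a) {z : ℂ} (hz : ‖z‖ ≤ 1) (s : ℕ) :
    Summable fun k => a k * z ^ (k - s) := by
  refine Summable.of_norm_bounded (ha 0) fun k => ?_
  rw [norm_mul, norm_pow, pow_zero, one_mul]
  exact mul_le_of_le_one_right (norm_nonneg _) (pow_le_one₀ (norm_nonneg _) hz)

/-- The quadratic Taylor bound for powers holds uniformly on the closed disk, so the series may be
differentiated term by term even at boundary points. The truncated exponents k - s keep the shape of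
the series under repeated differentiation: terms with k ≤ s are constant, and the factor k - s
removes them. -/
lemma IsRapid.hasDerivWithinAt {a : ℕ → ℂ} (ha : IsRapid a) (s : ℕ) {w : ℂ}
    (hw : w ∈ Metric.closedBall (0 : ℂ) 1) :
    HasDerivWithinAt (fun z => ∑' k, a k * z ^ (k - s))
      (∑' k, (a k * ((k - s : ℕ) : ℂ)) * w ^ (k - (s + 1))) (Metric.closedBall 0 1) w := by
  rw [hasDerivWithinAt_iff_isLittleO]
  have hw' : ‖w‖ ≤ 1 := by simpa using hw
  have hb : ∀ z ∈ Metric.closedBall (0 : ℂ) 1,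
      ‖(∑' k, a k * z ^ (k - s)) - (∑' k, a k * w ^ (k - s))
        - (z - w) • ∑' k, (a k * ((k - s : ℕ) : ℂ)) * w ^ (k - (s + 1))‖
      ≤ (∑' k : ℕ, (k : ℝ) ^ 2 * ‖a k‖) * ‖z - w‖ ^ 2 := by
    intro z hz
    have hz' : ‖z‖ ≤ 1 := by simpa using hz
    have h1 := ha.summable hz' s
    have h2 := ha.summable hw' s
    have h3 := (ha.mul_sub s).summable hw' (s + 1)
    rw [smul_eq_mul, ← tsum_mul_left, ← h1.tsum_sub h2, ← (h1.sub h2).tsum_sub (h3.mul_left _),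
      ← tsum_mul_right]
    refine tsum_of_norm_bounded ((ha 2).mul_right _).hasSum fun k => ?_
    have e : a k * z ^ (k - s) - a k * w ^ (k - s)
        - (z - w) * (a k * ((k - s : ℕ) : ℂ) * w ^ (k - (s + 1)))
        = a k * (z ^ (k - s) - w ^ (k - s)
          - ((k - s : ℕ) : ℂ) * w ^ (k - s - 1) * (z - w)) := by
      rw [Nat.sub_sub]; ring
    rw [e, norm_mul]
    have h4 := norm_pow_sub_pow_sub_le hz' hw' (k - s)
    have : ((k - s : ℕ) : ℝ) ≤ k := by exact_mod_cast Nat.sub_le k s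
    calc _ ≤ ‖a k‖ * ((k - s : ℕ) ^ 2 * ‖z - w‖ ^ 2) := by gcongr
      _ ≤ ‖a k‖ * (k ^ 2 * ‖z - w‖ ^ 2) := by gcongr
      _ = _ := by ring
  refine Asymptotics.IsBigO.trans_isLittleO (g := fun z => ‖z - w‖ ^ 2) ?_ ?_
  · refine Asymptotics.IsBigO.of_bound (∑' k : ℕ, (k : ℝ) ^ 2 * ‖a k‖) ?_
    refine Filter.eventually_of_mem self_mem_nhdsWithin fun z hz => ?_
    simpa using hb z hz
  · refine Asymptotics.IsLittleO.mono ?_ nhdsWithin_le_nhds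
    have h1 : (fun z : ℂ => (z - w) ^ 2) =o[nhds w] fun z => z - w := by
      have h2 : (fun z : ℂ => z - w) =o[nhds w] fun _ => (1 : ℂ) := by
        rw [Asymptotics.isLittleO_one_iff]
        have : Filter.Tendsto (fun z : ℂ => z - w) (nhds w) (nhds (w - w)) :=
          (continuous_id.sub continuous_const).tendsto w
        simpa using this
      simpa [pow_two] using h2.mul_isBigO (Asymptotics.isBigO_refl (fun z : ℂ => z - w) (nhds w))
    simpa using h1.norm_left

lemma IsRapid.contDiffOn {a : ℕ → ℂ} (ha : IsRapid a) :
    ContDiffOn ℂ ∞ (fun z => ∑' k, a k * z ^ k) (Metric.closedBall 0 1) := by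
  have hu : UniqueDiffOn ℂ (Metric.closedBall (0 : ℂ) 1) := by
    have : UniqueDiffOn ℝ (Metric.closedBall (0 : ℂ) 1) :=
      uniqueDiffOn_convex (convex_closedBall 0 1) ⟨0, by
        rw [interior_closedBall _ one_ne_zero]; simp⟩
    exact fun x hx => (this x hx).mono_field
  -- The induction must range over all rapidly decreasing coefficients and all shifts, since
  -- differentiating changes both.
  have : ∀ (j : ℕ) (a : ℕ → ℂ) (s : ℕ), IsRapid a →
      ContDiffOn ℂ j (fun z => ∑' k, a k * z ^ (k - s)) (Metric.closedBall 0 1) := by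
    intro j
    induction j with
    | zero =>
      intro a s ha
      exact contDiffOn_zero.2 fun w hw => (ha.hasDerivWithinAt s hw).continuousWithinAt
    | succ j ih =>
      intro a s ha
      push_cast
      rw [contDiffOn_succ_iff_derivWithin hu]
      refine ⟨fun w hw => (ha.hasDerivWithinAt s hw).differentiableWithinAt, by simp, ?_⟩
      exact (ih _ (s + 1) (ha.mul_sub s)).congr fun w hw =>
        (ha.hasDerivWithinAt s hw).derivWithin (hu w hw)
  rw [contDiffOn_infty]
  exact fun j => by simpa using this j a 0 ha

/-- Each integration by parts gains a factor 1/j, and periodicity kills the boundary term. -/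
lemma exists_fourierCoeffOn_bound (p : ℕ) (f : ℝ → ℂ) (hf : ContDiff ℝ ∞ f)
    (hper : Function.Periodic f (2 * Real.pi)) :
    ∃ C, ∀ j : ℤ, j ≠ 0 → |(j : ℝ)| ^ p
      * ‖fourierCoeffOn (lt_add_of_pos_right (0 : ℝ) Real.two_pi_pos) f j‖ ≤ C := by
  have hpi := Real.two_pi_pos
  induction p generalizing f with
  | zero =>
    obtain ⟨C, hC⟩ := (isCompact_Icc (a := (0 : ℝ)) (b := 0 + 2 * Real.pi)).exists_bound_of_continuousOn
      hf.continuous.continuousOn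
    refine ⟨‖(1 / (0 + 2 * Real.pi - 0) : ℝ)‖ * (C * |0 + 2 * Real.pi - 0|), fun j _ => ?_⟩
    rw [pow_zero, one_mul, fourierCoeffOn_eq_integral, norm_smul]
    gcongr
    refine intervalIntegral.norm_integral_le_of_norm_le_const fun x hx => ?_
    rw [Set.uIoc_of_le (by linarith)] at hx
    rw [norm_smul, fourier_apply, Circle.norm_coe, one_mul]
    exact hC x ⟨hx.1.le, hx.2⟩
  | succ p ih =>
    have hd : ContDiff ℝ ∞ (deriv f) := by
      rw [contDiff_infty_iff_deriv] at hf
      exact hf.2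
    have hp : Function.Periodic (deriv f) (2 * Real.pi) := by
      intro x
      rw [← deriv_comp_add_const]
      congr 1
      exact funext hper
    obtain ⟨C, hC⟩ := ih (deriv f) hd hp
    refine ⟨C, fun j hj => ?_⟩
    rw [fourierCoeffOn_of_hasDerivAt _ hj
      (fun x _ => (hf.differentiable (by simp) x).hasDerivAt)
      (hd.continuous.intervalIntegrable _ _), hper 0, sub_self, mul_zero, zero_sub]
    have hj' : |(j : ℝ)| ≠ 0 := by simpa using hj
    have e : ∀ q : ℂ, ‖1 / (-2 * (Real.pi : ℂ) * Complex.I * j)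
        * -((((0 + 2 * Real.pi : ℝ) : ℂ) - (0 : ℝ)) * q)‖ = ‖q‖ / |(j : ℝ)| := by
      intro q
      have : 1 / (-2 * (Real.pi : ℂ) * Complex.I * j)
          * -((((0 + 2 * Real.pi : ℝ) : ℂ) - (0 : ℝ)) * q) = q / (Complex.I * j) := by
        have h2 : (j : ℂ) ≠ 0 := by exact_mod_cast hj
        have h3 : (Real.pi : ℂ) ≠ 0 := by exact_mod_cast Real.pi_ne_zero
        push_cast
        field_simp
        ring
      rw [this, norm_div, norm_mul, Complex.norm_I, one_mul, Complex.norm_intCast]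
    rw [e, pow_succ]
    calc _ = |(j : ℝ)| ^ p * ‖fourierCoeffOn (lt_add_of_pos_right (0 : ℝ) Real.two_pi_pos)
          (deriv f) j‖ := by field_simp
      _ ≤ C := hC j hj

/-- A smooth function on the circle is the real part of the boundary values of a holomorphic
function that is smooth up to the boundary. -/
lemma exists_holomorphic_re_eq (g : ℝ → ℝ) (hg : ContDiff ℝ ∞ g)
    (hper : Function.Periodic g (2 * Real.pi)) :
    ∃ G : ℂ → ℂ, ContDiffOn ℂ ∞ G (Metric.closedBall 0 1) ∧
      ∀ θ : ℝ, (G (Complex.exp (θ * Complex.I))).re = g θ := by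
  have hpi := Real.two_pi_pos
  have : Fact (0 < 2 * Real.pi) := ⟨hpi⟩
  set f : ℝ → ℂ := fun x => g x with hfdef
  have hf : ContDiff ℝ ∞ f := Complex.ofRealCLM.contDiff.comp hg
  have hfp : Function.Periodic f (2 * Real.pi) := fun x => by simp [f, hper x]
  let F : C(AddCircle (2 * Real.pi), ℂ) := ⟨hfp.lift, continuous_coinduced_dom.2 hf.continuous⟩
  have hF : ∀ x : ℝ, F (x : AddCircle (2 * Real.pi)) = g x := fun x => hfp.lift_coe x
  set c : ℤ → ℂ := fourierCoeff F with hc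
  have hcf : ∀ j, c j = fourierCoeffOn (lt_add_of_pos_right (0 : ℝ) Real.two_pi_pos) f j := by
    intro j
    rw [hc, fourierCoeff_eq_intervalIntegral F j 0, fourierCoeffOn_eq_integral, add_sub_cancel_left]
    rfl
  have hconj : ∀ j, c (-j) = starRingEnd ℂ (c j) := by
    intro j
    simp only [hc, fourierCoeff]
    rw [← integral_conj]
    congr 1
    funext t
    induction t using QuotientAddGroup.induction_on with
    | H x =>
      simp only [smul_eq_mul, map_mul, neg_neg]
      rw [fourier_neg, Complex.conj_conj]
      have := hF x
      rw [this, Complex.conj_ofReal]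
  set a : ℕ → ℂ := fun k => 2 * c k with ha
  have hrap : IsRapid a := by
    intro p
    -- The two extra powers leave the summable majorant 1/k².
    obtain ⟨C, hC⟩ := exists_fourierCoeffOn_bound (p + 2) f hf hfp
    have h1 : Summable fun k : ℕ => (2 * C) * (1 / (k : ℝ) ^ 2) :=
      (Real.summable_one_div_nat_pow.2 one_lt_two).mul_left _
    have h2 : Summable fun k : ℕ => ((k + 1 : ℕ) : ℝ) ^ p * ‖a (k + 1)‖ := by
      refine ((summable_nat_add_iff 1).2 h1).of_nonneg_of_le (fun k => by positivity) fun k => ?_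
      have h3 := hC (k + 1 : ℕ) (by positivity)
      rw [← hcf] at h3
      have h4 : (0 : ℝ) < (k + 1 : ℕ) := by positivity
      rw [Int.cast_natCast, abs_of_pos h4] at h3
      rw [ha, norm_mul, mul_one_div, le_div_iff₀ (by positivity)]
      simp only [Complex.norm_ofNat]
      calc _ = 2 * (((k + 1 : ℕ) : ℝ) ^ (p + 2) * ‖c (k + 1 : ℕ)‖) := by ring
        _ ≤ _ := by linarith
    exact (summable_nat_add_iff 1).1 h2
  have hsn : Summable fun k : ℕ => ‖c k‖ := by
    refine (hrap 0).of_nonneg_of_le (fun k => norm_nonneg _) fun k => ?_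
    simp only [ha, norm_mul, pow_zero, one_mul, Complex.norm_ofNat]
    linarith [norm_nonneg (c k)]
  have hsum : Summable c := by
    refine Summable.of_nat_of_neg hsn.of_norm (Summable.of_norm ?_)
    simpa only [hconj, RCLike.norm_conj] using hsn
  -- Since `g` is real, the terms of index k and -k are conjugate, so doubling the nonnegative part
  -- recovers `g` as a real part. The constant term gets counted twice, whence the subtraction.
  refine ⟨fun z => (∑' k, a k * z ^ k) - c 0, hrap.contDiffOn.sub contDiffOn_const, fun θ => ?_⟩
  have h1 := (has_pointwise_sum_fourier_series_of_summable hsum (θ : AddCircle (2 * Real.pi))).nat_add_neg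
  rw [hF] at h1
  have he : ∀ j : ℕ, (fourier (j : ℤ) (θ : AddCircle (2 * Real.pi)) : ℂ)
      = Complex.exp (θ * Complex.I) ^ j := by
    intro j
    rw [fourier_coe_apply, ← Complex.exp_nat_mul]
    congr 1
    have h3 : (Real.pi : ℂ) ≠ 0 := by exact_mod_cast Real.pi_ne_zero
    push_cast
    field_simp
  have h2 : ∀ j : ℕ, fourierCoeff F j • (fourier (j : ℤ) (θ : AddCircle (2 * Real.pi)) : ℂ)
      + fourierCoeff F (-(j : ℤ)) • (fourier (-(j : ℤ)) (θ : AddCircle (2 * Real.pi)) : ℂ)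
      = ((a j * Complex.exp (θ * Complex.I) ^ j).re : ℝ) := by
    intro j
    have := hconj j
    simp only [hc] at this
    rw [fourier_neg, this, he, smul_eq_mul, smul_eq_mul, ← map_mul, Complex.add_conj, ha, hc]
    rw [mul_assoc]
    simp [Complex.mul_re]
  simp only [h2] at h1
  have h3 := Complex.hasSum_re h1
  simp only [Complex.ofReal_re, fourier_zero, smul_eq_mul, mul_one, Complex.add_re] at h3
  have h4 := Complex.hasSum_re (hrap.summable (z := Complex.exp (θ * Complex.I))
    (Complex.norm_exp_ofReal_mul_I θ).le 0).hasSum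
  simp only [Nat.sub_zero] at h4
  rw [Complex.sub_re, h4.unique h3]
  simp [hc]

/-! ### Gradients of strictly convex functions -/

/-- Smooth maps `ℝⁿ → ℝⁿ` with symmetric and positive definite differential, the gradients of
strictly convex functions. -/
structure IsConvexGradient {n : ℕ} (Φ : (Fin n → ℝ) → Fin n → ℝ) : Prop where
  smooth : ContDiff ℝ ∞ Φ
  symm : ∀ t v w, ∑ j, w j * fderiv ℝ Φ t v j = ∑ j, v j * fderiv ℝ Φ t w j
  pos : ∀ t v, v ≠ 0 → 0 < ∑ j, v j * fderiv ℝ Φ t v j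

namespace IsConvexGradient

variable {n : ℕ} {Φ : (Fin n → ℝ) → Fin n → ℝ}

lemma hasDerivAt_line (hΦ : IsConvexGradient Φ) (t v w : Fin n → ℝ) (s : ℝ) :
    HasDerivAt (fun s : ℝ => ∑ j, w j * Φ (t + s • v) j)
      (∑ j, w j * fderiv ℝ Φ (t + s • v) v j) s := by
  have h1 : HasDerivAt (fun s : ℝ => t + s • v) v s := by
    simpa using ((hasDerivAt_id s).smul_const v).const_add t
  have h2 := ((hΦ.smooth.differentiable (by simp) (t + s • v)).hasFDerivAt).comp_hasDerivAt s h1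
  exact HasDerivAt.fun_sum fun j _ => (hasDerivAt_pi.1 h2 j).const_mul (w j)

lemma strictMono_line (hΦ : IsConvexGradient Φ) (t : Fin n → ℝ) {v : Fin n → ℝ} (hv : v ≠ 0) :
    StrictMono fun s : ℝ => ∑ j, v j * Φ (t + s • v) j :=
  strictMono_of_deriv_pos fun s => by
    rw [(hΦ.hasDerivAt_line t v v s).deriv]
    exact hΦ.pos _ v hv

/-- Two points with equal coordinate sums whose images differ by a multiple of `(1, …, 1)`
coincide. -/
lemma eq_of_sub_const (hΦ : IsConvexGradient Φ) {t t' : Fin n → ℝ} {c : ℝ}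
    (h : ∀ j, Φ t j = Φ t' j + c) (hs : ∑ j, t j = ∑ j, t' j) : t = t' := by
  by_contra hne
  -- Along the segment from t' to t the pairing of `Φ` with t - t' increases strictly, but its total
  -- change is c times the sum of the entries of t - t', which is zero.
  have h1 := hΦ.strictMono_line t' (sub_ne_zero.2 hne) one_pos
  simp only [zero_smul, add_zero, one_smul, add_sub_cancel, h, mul_add, Finset.sum_add_distrib,
    ← Finset.sum_mul, Pi.sub_apply, Finset.sum_sub_distrib, hs, sub_self, zero_mul] at h1
  exact h1.ne rfl

/-- Symmetry of the differential says that the one-form with coefficients `Φ` is closed, so the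
Poincaré lemma applies on ℝⁿ. -/
lemma exists_potential (hΦ : IsConvexGradient Φ) :
    ∃ φ : (Fin n → ℝ) → ℝ, Continuous φ ∧ ∀ t v s, HasDerivAt (fun s : ℝ => φ (t + s • v))
      (∑ j, v j * Φ (t + s • v) j) s := by
  let P : Fin n → (Fin n → ℝ) →L[ℝ] ℝ := fun j => ContinuousLinearMap.proj j
  let η : (Fin n → ℝ) → (Fin n → ℝ) →L[ℝ] ℝ := fun t => ∑ j, Φ t j • P j
  have hη : ∀ t, HasFDerivAt η (∑ j, ((P j).comp (fderiv ℝ Φ t)).smulRight (P j)) t := by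
    intro t
    refine HasFDerivAt.fun_sum fun j _ => ?_
    refine HasFDerivAt.smul_const ?_ (P j)
    exact (P j).hasFDerivAt.comp t (hΦ.smooth.differentiable (by simp) t).hasFDerivAt
  obtain ⟨φ, hφ⟩ := convex_univ.exists_forall_hasFDerivAt_of_fderiv_symmetric isOpen_univ
    (show DifferentiableOn ℝ η Set.univ from
      fun t _ => (hη t).differentiableAt.differentiableWithinAt) (by
      intro t _ v w
      rw [(hη t).fderiv]
      simpa [P, mul_comm] using hΦ.symm t v w)
  refine ⟨φ, continuous_iff_continuousAt.2 fun t => (hφ t trivial).continuousAt, fun t v s => ?_⟩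
  have h1 : HasDerivAt (fun s : ℝ => t + s • v) v s := by
    simpa using ((hasDerivAt_id s).smul_const v).const_add t
  refine ((hφ _ trivial).comp_hasDerivAt s h1).congr_deriv ?_
  simp [η, P, mul_comm]

/-- If the image meets the line `p + ℝ (1, …, 1)`, then every hyperplane `∑ t j = ℓ` contains a
point that is mapped into this line. -/
lemma exists_of_sum_eq [NeZero n] (hΦ : IsConvexGradient Φ) {t₀ p : Fin n → ℝ} {c₀ : ℝ}
    (h₀ : ∀ j, Φ t₀ j = p j + c₀) (ℓ : ℝ) :
    ∃ t c, (∀ j, Φ t j = p j + c) ∧ ∑ j, t j = ℓ := by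
  obtain ⟨φ, hφc, hφ⟩ := hΦ.exists_potential
  -- Subtracting the linear part at `t₀` makes `t₀` a critical point of a strictly convex function,
  -- which is therefore proper. Its minimum on the hyperplane is the point sought, by Lagrange
  -- multipliers.
  set ψ : (Fin n → ℝ) → ℝ := fun t => φ t - ∑ j, Φ t₀ j * t j with hψ
  have hψc : Continuous ψ := by fun_prop
  have hψd : ∀ t v s, HasDerivAt (fun s : ℝ => ψ (t + s • v))
      (∑ j, v j * (Φ (t + s • v) j - Φ t₀ j)) s := by
    intro t v s
    have h1 : HasDerivAt (fun s : ℝ => ∑ j, Φ t₀ j * (t + s • v) j) (∑ j, Φ t₀ j * v j) s := by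
      refine HasDerivAt.fun_sum fun j _ => ?_
      simpa using (((hasDerivAt_id s).mul_const (v j)).const_add (t j)).const_mul (Φ t₀ j)
    refine ((hφ t v s).sub h1).congr_deriv ?_
    rw [← Finset.sum_sub_distrib]
    exact Finset.sum_congr rfl fun j _ => by ring
  have hS : IsCompact (Metric.sphere (0 : Fin n → ℝ) 1) := isCompact_sphere _ _
  -- The least radial slope at distance one from `t₀`; by convexity it bounds the slope along every
  -- ray from there on.
  obtain ⟨u₀, hu₀, hmin⟩ := hS.exists_isMinOn (NormedSpace.sphere_nonempty.2 zero_le_one)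
    (f := fun u => ∑ j, u j * (Φ (t₀ + u) j - Φ t₀ j)) (by
      have := hΦ.smooth.continuous
      fun_prop)
  have hslope : ∀ u : Fin n → ℝ, u ≠ 0 →
      StrictMono fun s : ℝ => ∑ j, u j * (Φ (t₀ + s • u) j - Φ t₀ j) := by
    intro u hu
    simp only [mul_sub, Finset.sum_sub_distrib]
    exact (hΦ.strictMono_line t₀ hu).add_const _
  set μ := ∑ j, u₀ j * (Φ (t₀ + u₀) j - Φ t₀ j) with hμ
  have hμ0 : 0 < μ := by
    have h1 := hslope u₀ (ne_zero_of_mem_unit_sphere ⟨u₀, hu₀⟩) one_pos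
    simpa using h1
  have hgrow : ∀ t, ψ t₀ + μ * (‖t - t₀‖ - 1) ≤ ψ t := by
    intro t
    rcases eq_or_ne t t₀ with rfl | hne
    · simp [hμ0.le]
    have hr : 0 < ‖t - t₀‖ := norm_pos_iff.2 (sub_ne_zero.2 hne)
    set r := ‖t - t₀‖ with hrdef
    set u : Fin n → ℝ := r⁻¹ • (t - t₀) with hu
    have hun : ‖u‖ = 1 := by
      rw [hu, norm_smul, norm_inv, Real.norm_of_nonneg hr.le, ← hrdef, inv_mul_cancel₀ hr.ne']
    have hu0 : u ≠ 0 := norm_ne_zero_iff.1 (by rw [hun]; exact one_ne_zero)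
    have htu : t = t₀ + r • u := by
      rw [hu, smul_smul, mul_inv_cancel₀ hr.ne', one_smul, add_sub_cancel]
    have hmu : μ ≤ ∑ j, u j * (Φ (t₀ + (1 : ℝ) • u) j - Φ t₀ j) := by
      simpa using hmin (show u ∈ Metric.sphere 0 1 by simpa using hun)
    set g : ℝ → ℝ := fun s => ψ (t₀ + s • u) with hg
    have hgd : ∀ s, HasDerivAt g _ s := fun s => hψd t₀ u s
    have hg0 : ∀ s, 0 < s → 0 ≤ deriv g s := by
      intro s hs
      rw [(hgd s).deriv]
      have h1 := hslope u hu0 hs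
      simp only [zero_smul, add_zero, sub_self, mul_zero, Finset.sum_const_zero] at h1
      exact h1.le
    have hgm : MonotoneOn g (Set.Ici 0) := by
      refine monotoneOn_of_deriv_nonneg (convex_Ici 0)
        (fun s _ => (hgd s).continuousAt.continuousWithinAt)
        (fun s _ => (hgd s).differentiableAt.differentiableWithinAt) ?_
      rw [interior_Ici]
      exact fun s hs => hg0 s hs
    have e0 : g 0 = ψ t₀ := by simp [hg]
    have er : g r = ψ t := by rw [hg, htu]
    rw [← e0, ← er]
    rcases le_or_gt r 1 with h1 | h1
    · have := hgm (Set.mem_Ici.2 le_rfl) (Set.mem_Ici.2 hr.le) hr.le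
      nlinarith
    · have h2 := hgm (Set.mem_Ici.2 le_rfl) (Set.mem_Ici.2 zero_le_one) zero_le_one
      have h3 := (convex_Ici (1 : ℝ)).mul_sub_le_image_sub_of_le_deriv (C := μ)
        (fun s _ => (hgd s).continuousAt.continuousWithinAt)
        (fun s _ => (hgd s).differentiableAt.differentiableWithinAt) (by
          rw [interior_Ici]
          intro s hs
          rw [(hgd s).deriv]
          exact hmu.trans ((hslope u hu0).monotone (le_of_lt hs)))
        1 (Set.mem_Ici.2 le_rfl) r (Set.mem_Ici.2 h1.le) h1.le
      linarith
  have hx0 : ∑ _j : Fin n, ℓ / n = ℓ := by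
    have : (n : ℝ) ≠ 0 := by exact_mod_cast NeZero.ne n
    simp
    field_simp
  obtain ⟨q, hq, hqm⟩ := hψc.continuousOn.exists_isMinOn' (s := {t : Fin n → ℝ | ∑ j, t j = ℓ})
    (isClosed_eq (by fun_prop) continuous_const) hx0 (by
      have h1 : Filter.Tendsto (fun t : Fin n → ℝ => ‖t - t₀‖) (Filter.cocompact _) Filter.atTop := by
        have := tendsto_norm_cocompact_atTop (E := Fin n → ℝ)
        refine Filter.tendsto_atTop_mono (fun t => ?_)
          (Filter.tendsto_atTop_add_const_right _ (-‖t₀‖) this)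
        have := norm_sub_norm_le t t₀
        linarith
      have h2 := h1.eventually_ge_atTop ((ψ (fun _ => ℓ / n) - ψ t₀) / μ + 1)
      refine Filter.Eventually.filter_mono inf_le_left (h2.mono fun t ht => ?_)
      refine le_trans ?_ (hgrow t)
      have := (div_le_iff₀ hμ0).1 (le_sub_iff_add_le.2 ht)
      linarith)
  -- At the constrained minimum the gradient annihilates the directions tangent to the hyperplane,
  -- so all its entries coincide.
  have hcrit : ∀ v : Fin n → ℝ, ∑ j, v j = 0 → ∑ j, v j * (Φ q j - Φ t₀ j) = 0 := by
    intro v hv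
    have h1 := hψd q v 0
    simp only [zero_smul, add_zero] at h1
    refine IsLocalMin.hasDerivAt_eq_zero (Filter.Eventually.of_forall fun s => ?_) h1
    have hm : q + s • v ∈ {t : Fin n → ℝ | ∑ j, t j = ℓ} := by
      have : ∑ j, q j = ℓ := hq
      simp [Finset.sum_add_distrib, ← Finset.mul_sum, hv, this]
    simpa using hqm hm
  refine ⟨q, Φ q 0 - Φ t₀ 0 + c₀, fun j => ?_, hq⟩
  have h1 := hcrit (Pi.single j 1 - Pi.single 0 1) (by simp [Finset.sum_sub_distrib])
  simp only [Pi.sub_apply, sub_mul, Finset.sum_sub_distrib, Pi.single_apply, ite_mul, one_mul,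
    zero_mul, Finset.sum_ite_eq', Finset.mem_univ, if_true] at h1
  have := h₀ j
  linarith

/-- The point of `exists_of_sum_eq` depends smoothly on `ℓ`. -/
lemma exists_smooth_curve [NeZero n] (hΦ : IsConvexGradient Φ) {t₀ p : Fin n → ℝ} {c₀ : ℝ}
    (h₀ : ∀ j, Φ t₀ j = p j + c₀) :
    ∃ T : ℝ → Fin n → ℝ, ContDiff ℝ ∞ T ∧ (∀ ℓ, ∑ j, T ℓ j = ℓ) ∧
      ∀ ℓ, ∃ c, ∀ j, Φ (T ℓ) j = p j + c := by
  choose T c hT hℓ using fun ℓ => hΦ.exists_of_sum_eq h₀ ℓ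
  refine ⟨T, contDiff_iff_contDiffAt.2 fun ℓ => ?_, hℓ, fun ℓ => ⟨c ℓ, hT ℓ⟩⟩
  -- The pair (T ℓ, c ℓ) solves `E` = (p, ℓ), so smoothness follows from the inverse function
  -- theorem.
  let E : (Fin n → ℝ) × ℝ → (Fin n → ℝ) × ℝ := fun x => (fun j => Φ x.1 j - x.2, ∑ j, x.1 j)
  have hΦ1 := hΦ.smooth
  have hE : ContDiff ℝ ∞ E := by
    refine ContDiff.prodMk (contDiff_pi.2 fun j => ?_) (ContDiff.sum fun j _ => ?_)
    · exact ((contDiff_pi.1 (hΦ1.comp contDiff_fst)) j).sub contDiff_snd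
    · exact (contDiff_pi.1 contDiff_fst) j
  set x : (Fin n → ℝ) × ℝ := (T ℓ, c ℓ) with hx
  let D : ((Fin n → ℝ) × ℝ) →L[ℝ] (Fin n → ℝ) × ℝ :=
    (ContinuousLinearMap.pi fun j => ((ContinuousLinearMap.proj j).comp (fderiv ℝ Φ (T ℓ))).comp
      (ContinuousLinearMap.fst ℝ _ _) - ContinuousLinearMap.snd ℝ _ _).prod
      (∑ j, (ContinuousLinearMap.proj j).comp (ContinuousLinearMap.fst ℝ (Fin n → ℝ) ℝ))
  have hD : HasFDerivAt E D x := by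
    have h1 : HasFDerivAt (fun x : (Fin n → ℝ) × ℝ => Φ x.1)
        ((fderiv ℝ Φ (T ℓ)).comp (ContinuousLinearMap.fst ℝ _ _)) x :=
      (hΦ1.differentiable (by simp) (T ℓ)).hasFDerivAt.comp x hasFDerivAt_fst
    refine HasFDerivAt.prodMk (hasFDerivAt_pi.2 fun j => ?_) (HasFDerivAt.fun_sum fun j _ => ?_)
    · exact (hasFDerivAt_pi'.1 h1 j).sub hasFDerivAt_snd
    · exact (ContinuousLinearMap.proj (R := ℝ) (φ := fun _ : Fin n => ℝ) j).hasFDerivAt.comp x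
        hasFDerivAt_fst
  -- A kernel vector v has zero sum and is mapped by the differential of `Φ` to a multiple of (1, …,
  -- 1), so it pairs to zero with its image, against positive definiteness.
  have hinj : Function.Injective D := by
    rw [injective_iff_map_eq_zero]
    rintro ⟨v, a⟩ h
    have h1 : ∀ j, fderiv ℝ Φ (T ℓ) v j = a := fun j => by
      have := congrFun (congrArg Prod.fst h) j
      simpa [D, sub_eq_zero] using this
    have h2 : ∑ j, v j = 0 := by simpa [D] using congrArg Prod.snd h
    have hv : v = 0 := by
      by_contra hv
      have := hΦ.pos (T ℓ) v hv
      simp only [h1, ← Finset.sum_mul, h2, zero_mul, lt_irrefl] at this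
    subst hv
    have := h1 0
    simp at this
    simp [← this]
  let e : ((Fin n → ℝ) × ℝ) ≃L[ℝ] (Fin n → ℝ) × ℝ :=
    (LinearEquiv.ofInjectiveEndo (D : _ →ₗ[ℝ] _) hinj).toContinuousLinearEquiv
  have he : HasFDerivAt E (e : ((Fin n → ℝ) × ℝ) →L[ℝ] (Fin n → ℝ) × ℝ) x := by
    have : (e : ((Fin n → ℝ) × ℝ) →L[ℝ] (Fin n → ℝ) × ℝ) = D := ContinuousLinearMap.ext fun _ => rfl
    rw [this]
    exact hD
  have hEx : E x = (p, ℓ) := by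
    simp only [E, hx, hT, hℓ]
    simp
  have hL := hE.contDiffAt.to_localInverse he (by simp)
  have hs := hE.contDiffAt.hasStrictFDerivAt' he (by simp : (∞ : ℕ∞ω) ≠ 0)
  have hr := hs.eventually_right_inverse
  rw [hEx] at hL hr
  have hc : ContDiffAt ℝ ∞ (fun ℓ : ℝ => ((p, ℓ) : (Fin n → ℝ) × ℝ)) ℓ := by fun_prop
  refine ((contDiff_fst.contDiffAt.comp ℓ (hL.comp ℓ hc))).congr_of_eventuallyEq ?_
  -- The curve was obtained by choice; the uniqueness statement identifies it with the smooth local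
  -- inverse.
  filter_upwards [hc.continuousAt.eventually hr] with ℓ' hr'
  set y := hs.localInverse E e x (p, ℓ') with hy
  have h1 : ∀ j, Φ y.1 j - y.2 = p j := fun j => congrFun (congrArg Prod.fst hr') j
  have h2 : ∑ j, y.1 j = ℓ' := congrArg Prod.snd hr'
  change T ℓ' = y.1
  refine hΦ.eq_of_sub_const (c := c ℓ' - y.2) (fun j => ?_) ((hℓ ℓ').trans h2.symm)
  rw [hT ℓ' j]
  linarith [h1 j]

end IsConvexGradient

/-! ### The complexified torus action in charts -/

namespace SmoothFan

variable {n m : ℕ}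

/-- The action of `exp c ∈ (ℂˣ)ᵐ` by multiplication of the homogeneous coordinates. -/
noncomputable def cAct (F : SmoothFan n m) (c : Fin m → ℂ) : F.ToricManifold → F.ToricManifold :=
  Quotient.map
    (fun z : F.HomCoord => (⟨fun i => Complex.exp (c i) * z.1 i, by
      obtain ⟨σ, hσ, h⟩ := z.2
      exact ⟨σ, hσ, fun i hi => h i (by simpa [Complex.exp_ne_zero] using hi)⟩⟩ : F.HomCoord))
    (by
      rintro z z' ⟨t, ht, h⟩
      exact ⟨t, ht, fun i => by simp only [h i]; ring⟩)

lemma torusAct_eq_cAct (F : SmoothFan n m) (c : Fin m → ℝ) :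
    F.torusAct c = F.cAct fun i => c i * Complex.I := rfl

lemma cAct_zero (F : SmoothFan n m) (x : F.ToricManifold) : F.cAct 0 x = x := by
  obtain ⟨z, rfl⟩ := F.isQuotientMap_pt.surjective x
  refine congrArg F.pt (Subtype.ext (funext fun i => ?_))
  change Complex.exp 0 * z.1 i = z.1 i
  simp

lemma continuous_cAct (F : SmoothFan n m) (x : F.ToricManifold) :
    Continuous fun c => F.cAct c x := by
  obtain ⟨z, rfl⟩ := F.isQuotientMap_pt.surjective x
  refine F.isQuotientMap_pt.continuous.comp (Continuous.subtype_mk ?_ _)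
  fun_prop

lemma cAct_mem_chartSource (F : SmoothFan n m) (σ : F.MaxCone) (c : Fin m → ℂ)
    (x : F.ToricManifold) : F.cAct c x ∈ F.chartSource σ ↔ x ∈ F.chartSource σ := by
  obtain ⟨z, rfl⟩ := F.isQuotientMap_pt.surjective x
  refine (F.pt_mem_chartSource σ _).trans (Iff.trans ?_ (F.pt_mem_chartSource σ z).symm)
  simp [Complex.exp_ne_zero]

lemma character_cAct (F : SmoothFan n m) (u : Fin n → ℤ) (c : Fin m → ℂ) (x : F.ToricManifold) :
    F.character u (F.cAct c x) = Complex.exp (∑ i, F.pairing u i * c i) * F.character u x := by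
  obtain ⟨z, rfl⟩ := F.isQuotientMap_pt.surjective x
  change ∏ i, (Complex.exp (c i) * z.1 i) ^ F.pairing u i = _ * ∏ i, z.1 i ^ F.pairing u i
  simp only [mul_zpow, Finset.prod_mul_distrib, Complex.exp_sum, Complex.exp_int_mul]

lemma mem_chart_target (F : SmoothFan n m) (σ : F.MaxCone) (y : Fin n → ℂ) :
    y ∈ (F.chart σ).target := Set.mem_univ y

lemma chart_symm_mem (F : SmoothFan n m) (σ : F.MaxCone) (y : Fin n → ℂ) :
    (F.chart σ).symm y ∈ F.chartSource σ := (F.chart σ).map_target (F.mem_chart_target σ y)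

lemma chart_symm_apply (F : SmoothFan n m) (σ : F.MaxCone) {x : F.ToricManifold}
    (hx : x ∈ F.chartSource σ) : (F.chart σ).symm (F.chart σ x) = x := (F.chart σ).left_inv hx

lemma chart_apply_symm (F : SmoothFan n m) (σ : F.MaxCone) (y : Fin n → ℂ) :
    F.chart σ ((F.chart σ).symm y) = y := (F.chart σ).right_inv (F.mem_chart_target σ y)

/-- The cone of the preferred chart at a point. -/
noncomputable def coneAt (F : SmoothFan n m) (x : F.ToricManifold) : F.MaxCone :=
  (F.exists_mem_chartSource x).choose

lemma mem_coneAt (F : SmoothFan n m) (x : F.ToricManifold) : x ∈ F.chartSource (F.coneAt x) :=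
  (F.exists_mem_chartSource x).choose_spec

/-- The vector of `N` with coordinates `a` with respect to the generators of a cone, in terms of
the generators of all rays. -/
noncomputable def extend (F : SmoothFan n m) (σ : F.MaxCone) {R : Type} [AddCommMonoid R] (a : Fin n → R)
    (i : Fin m) : R := ∑ j, if F.idx σ j = i then a j else 0

lemma sum_extend (F : SmoothFan n m) (σ : F.MaxCone) {R : Type} [CommSemiring R] (a : Fin n → R)
    (f : Fin m → R) : ∑ i, f i * F.extend σ a i = ∑ j, f (F.idx σ j) * a j := by
  simp only [extend, Finset.mul_sum, mul_ite, mul_zero]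
  rw [Finset.sum_comm]
  simp

lemma chart_cAct (F : SmoothFan n m) (σ : F.MaxCone) (c : Fin m → ℂ) (x : F.ToricManifold)
    (j : Fin n) : F.chart σ (F.cAct c x) j
      = Complex.exp (∑ i, F.pairing (F.dualBasis σ j) i * c i) * F.chart σ x j :=
  F.character_cAct _ _ _

lemma chart_cAct_extend (F : SmoothFan n m) (σ : F.MaxCone) (a : Fin n → ℂ) (x : F.ToricManifold)
    (j : Fin n) : F.chart σ (F.cAct (F.extend σ a) x) j = Complex.exp (a j) * F.chart σ x j := by
  rw [chart_cAct, sum_extend]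
  simp [F.pairing_dualBasis]

/-- The infinitesimal action of `c ∈ ℂᵐ` in the preferred chart. -/
noncomputable def field (F : SmoothFan n m) (x : F.ToricManifold) (c : Fin m → ℂ) : Fin n → ℂ :=
  fun j => F.chart (F.coneAt x) x j * ∑ i, F.pairing (F.dualBasis (F.coneAt x) j) i * c i

lemma field_extend (F : SmoothFan n m) (x : F.ToricManifold) (a : Fin n → ℂ) (j : Fin n) :
    F.field x (F.extend (F.coneAt x) a) j = F.chart (F.coneAt x) x j * a j := by
  rw [field, sum_extend]
  simp [F.pairing_dualBasis]

lemma field_smul (F : SmoothFan n m) (x : F.ToricManifold) (b : ℂ) (c : Fin m → ℂ) :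
    F.field x (b • c) = b • F.field x c := by
  funext j
  simp only [field, Pi.smul_apply, smul_eq_mul, Finset.mul_sum]
  exact Finset.sum_congr rfl fun i _ => by ring

section Deriv

variable {E : Type} [NormedAddCommGroup E] [NormedSpace ℝ E]

lemma hasMFDerivAt_of_chart (F : SmoothFan n m) {g : E → F.ToricManifold} {e : E}
    (hg : ContinuousAt g e) {L : E →L[ℝ] Fin n → ℂ}
    (hL : HasFDerivAt (fun e' => F.chart (F.coneAt (g e)) (g e')) L e) :
    HasMFDerivAt 𝓘(ℝ, E) 𝓘(ℝ, Fin n → ℂ) g e L := by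
  refine ⟨hg, ?_⟩
  simp only [mfld_simps]
  exact hL.hasFDerivWithinAt

lemma hasMFDerivAt_of_chart_symm (F : SmoothFan n m) {g : F.ToricManifold → E}
    {x : F.ToricManifold} (hg : ContinuousAt g x) {L : (Fin n → ℂ) →L[ℝ] E}
    (hL : HasFDerivAt (fun y => g ((F.chart (F.coneAt x)).symm y)) L (F.chart (F.coneAt x) x)) :
    HasMFDerivAt 𝓘(ℝ, Fin n → ℂ) 𝓘(ℝ, E) g x L := by
  refine ⟨hg, ?_⟩
  simp only [mfld_simps]
  exact hL.hasFDerivWithinAt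

/-- In a chart the action multiplies each coordinate by the exponential of a linear form in the
parameters. Arbitrary real-linear families `L` cover circle orbits, real flows and the whole
positive real torus at once. -/
lemma exists_hasMFDerivAt_cAct (F : SmoothFan n m) (x : F.ToricManifold) (L : E →L[ℝ] Fin m → ℂ)
    (e : E) : ∃ D : E →L[ℝ] Fin n → ℂ,
      HasMFDerivAt 𝓘(ℝ, E) 𝓘(ℝ, Fin n → ℂ) (fun e => F.cAct (L e) x) e D ∧
      ∀ v, D v = F.field (F.cAct (L e) x) (L v) := by
  set σ := F.coneAt (F.cAct (L e) x) with hσ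
  let D : E →L[ℝ] Fin n → ℂ := ContinuousLinearMap.pi fun j =>
    F.chart σ (F.cAct (L e) x) j • ∑ i, (F.pairing (F.dualBasis σ j) i : ℂ) •
      (ContinuousLinearMap.proj i).comp L
  refine ⟨D, F.hasMFDerivAt_of_chart ((F.continuous_cAct x).comp L.continuous).continuousAt ?_, ?_⟩
  · refine hasFDerivAt_pi.2 fun j => ?_
    change HasFDerivAt (fun e' => F.chart σ (F.cAct (L e') x) j) _ e
    simp only [chart_cAct]
    have h1 : HasFDerivAt (fun e' => ∑ i, (F.pairing (F.dualBasis σ j) i : ℂ) * L e' i)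
        (∑ i, (F.pairing (F.dualBasis σ j) i : ℂ) • (ContinuousLinearMap.proj i).comp L) e := by
      refine HasFDerivAt.fun_sum fun i _ => HasFDerivAt.const_mul ?_ _
      exact ((ContinuousLinearMap.proj (R := ℝ) (φ := fun _ : Fin m => ℂ) i).comp L).hasFDerivAt
    refine (h1.cexp.mul_const (F.chart σ x j)).congr_fderiv ?_
    rw [smul_smul, mul_comm]
  · intro v
    funext j
    simp [D, field, ← hσ]

lemma hasMFDerivAt_torusAct (F : SmoothFan n m) (c : Fin m → ℝ) (x : F.ToricManifold) :
    ∃ D : ℝ →L[ℝ] Fin n → ℂ,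
      HasMFDerivAt 𝓘(ℝ, ℝ) 𝓘(ℝ, Fin n → ℂ) (fun t : ℝ => F.torusAct (t • c) x) 0 D ∧
      D 1 = F.field x fun i => c i * Complex.I := by
  obtain ⟨D, hD, hD'⟩ := F.exists_hasMFDerivAt_cAct x
    (ContinuousLinearMap.toSpanSingleton ℝ fun i => (c i : ℂ) * Complex.I) 0
  have e : (fun t : ℝ => F.cAct (ContinuousLinearMap.toSpanSingleton ℝ
      (fun i => (c i : ℂ) * Complex.I) t) x) = fun t : ℝ => F.torusAct (t • c) x := by
    funext t
    rw [torusAct_eq_cAct]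
    congr 1
    funext i
    simp [mul_assoc]
  rw [e] at hD
  refine ⟨D, hD, ?_⟩
  rw [hD', map_zero, cAct_zero]
  simp

lemma torusField_eq (F : SmoothFan n m) (c : Fin m → ℝ) (x : F.ToricManifold) :
    F.torusField c x = F.field x fun i => c i * Complex.I := by
  obtain ⟨D, hD, hD'⟩ := F.hasMFDerivAt_torusAct c x
  rw [torusField, hD.mfderiv]
  exact hD'

end Deriv

/-! ### The holomorphic function `w` -/

lemma prod_sectionFun (F : SmoothFan n m) (σ : F.MaxCone) (y : Fin n → ℂ) :
    ∏ i, F.sectionFun σ y i = ∏ j, y j := by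
  symm
  refine Finset.prod_of_injOn (F.idx σ) (F.idx σ).injective.injOn (by simp) ?_ ?_
  · intro i _ hi
    refine F.sectionFun_of_notMem σ y fun h => hi ?_
    obtain ⟨j, rfl⟩ := F.exists_idx σ h
    simp
  · intro j _
    rw [F.sectionFun_idx]

section Nu

variable (F : SmoothFan n m) {ν : Fin n → ℤ} (hν : ∀ i, F.pairing ν i = 1)
include hν

/-- The Calabi–Yau condition makes every exponent equal to one. Consequently w vanishes exactly on
the union of the toric divisors. -/
lemma character_nu_chart_symm (σ : F.MaxCone) (y : Fin n → ℂ) :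
    F.character ν ((F.chart σ).symm y) = ∏ j, y j := by
  rw [← F.prod_sectionFun σ y]
  change F.character ν (F.pt (F.sectionHom σ y)) = _
  rw [F.character_pt]
  simp only [hν, zpow_one]
  rfl

lemma character_nu_eq_prod (σ : F.MaxCone) {x : F.ToricManifold} (hx : x ∈ F.chartSource σ) :
    F.character ν x = ∏ j, F.chart σ x j := by
  conv_lhs => rw [← F.chart_symm_apply σ hx]
  rw [F.character_nu_chart_symm hν]

lemma character_nu_pt (z : F.HomCoord) : F.character ν (F.pt z) = ∏ i, z.1 i := by
  rw [F.character_pt]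
  simp [hν]

/-- Where w is nonzero all homogeneous coordinates are nonzero, and this open orbit lies in every
affine piece. -/
lemma mem_chartSource_of_character_ne_zero {x : F.ToricManifold} (hx : F.character ν x ≠ 0)
    (σ : F.MaxCone) : x ∈ F.chartSource σ := by
  obtain ⟨z, rfl⟩ := F.isQuotientMap_pt.surjective x
  rw [F.character_nu_pt hν] at hx
  rw [pt_mem_chartSource]
  exact fun i _ => Finset.prod_ne_zero_iff.1 hx i (Finset.mem_univ i)

lemma contMDiff_character_nu (𝕜 : Type) [NontriviallyNormedField 𝕜] [NormedAlgebra 𝕜 ℂ]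
    [IsManifold 𝓘(𝕜, Fin n → ℂ) ∞ F.ToricManifold] :
    ContMDiff 𝓘(𝕜, Fin n → ℂ) 𝓘(𝕜, ℂ) ∞ (F.character ν) := by
  intro x
  have h1 : ContMDiffAt 𝓘(𝕜, Fin n → ℂ) 𝓘(𝕜, Fin n → ℂ) ∞ (F.chart (F.coneAt x)) x :=
    contMDiffAt_of_mem_maximalAtlas
      (IsManifold.subset_maximalAtlas ⟨F.coneAt x, rfl⟩) (F.mem_coneAt x)
  have h2 : ContMDiff 𝓘(𝕜, Fin n → ℂ) 𝓘(𝕜, ℂ) ∞ fun y : Fin n → ℂ => ∏ j, y j := by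
    refine ContDiff.contMDiff (contDiff_prod fun j _ => ?_)
    exact contDiff_apply 𝕜 ℂ j
  refine (h2.contMDiffAt.comp x h1).congr_of_eventuallyEq ?_
  filter_upwards [(F.isOpen_chartSource _).mem_nhds (F.mem_coneAt x)] with x' hx'
  exact F.character_nu_eq_prod hν _ hx'

lemma exists_hasMFDerivAt_character_nu (x : F.ToricManifold) : ∃ D : (Fin n → ℂ) →L[ℝ] ℂ,
    HasMFDerivAt 𝓘(ℝ, Fin n → ℂ) 𝓘(ℝ, ℂ) (F.character ν) x D ∧
    ∀ v, D v = ∑ j, (∏ k ∈ Finset.univ.erase j, F.chart (F.coneAt x) x k) * v j := by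
  refine ⟨∑ j, (∏ k ∈ Finset.univ.erase j, F.chart (F.coneAt x) x k) •
    ContinuousLinearMap.proj j, F.hasMFDerivAt_of_chart_symm
      (F.contMDiff_character_nu hν ℝ).continuous.continuousAt ?_, fun v => by simp⟩
  simp only [F.character_nu_chart_symm hν]
  exact HasFDerivAt.finsetProd fun j _ =>
    (ContinuousLinearMap.proj (R := ℝ) (φ := fun _ : Fin n => ℂ) j).hasFDerivAt

end Nu

end SmoothFan

/-! ### The squared holomorphic volume form -/

lemma det_of_map {n : ℕ} (J : (Fin n → ℂ) →ₗ[ℂ] Fin n → ℂ) (e : Fin n → Fin n → ℂ) :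
    (Matrix.of fun j => J (e j)).det = LinearMap.det J * (Matrix.of e).det := by
  have h : (Matrix.of fun j => J (e j)) = Matrix.of e * (LinearMap.toMatrix' J).transpose := by
    ext j k
    rw [Matrix.mul_apply, Matrix.of_apply, ← LinearMap.toMatrix'_mulVec J]
    simp [Matrix.mulVec, dotProduct, mul_comm]
  rw [h, Matrix.det_mul, Matrix.det_transpose, LinearMap.det_toMatrix', mul_comm]

lemma ne_zero_of_linearIndependent {n : ℕ} {e : Fin n → Fin n → ℂ} (he : LinearIndependent ℂ e) :
    (Matrix.of e).det ≠ 0 := by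
  rw [← isUnit_iff_ne_zero, ← Matrix.isUnit_iff_isUnit_det, ← Matrix.linearIndependent_rows_iff_isUnit]
  exact he

namespace SmoothFan

variable {n m : ℕ}

/-- The matrix that compares the bases of `M` dual to two cones. -/
noncomputable def transitionMatrix (F : SmoothFan n m) (σ τ : F.MaxCone) : Matrix (Fin n) (Fin n) ℤ :=
  Matrix.of fun j l => F.pairing (F.dualBasis τ j) (F.idx σ l)

/-- The matrices for the two orders of the cones are inverse integer matrices, so their determinants
are units of ℤ. -/
lemma det_transitionMatrix_sq (F : SmoothFan n m) (σ τ : F.MaxCone) :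
    (F.transitionMatrix σ τ).det ^ 2 = 1 := by
  have h : F.transitionMatrix σ τ * F.transitionMatrix τ σ = 1 := by
    ext j k
    rw [Matrix.mul_apply, Matrix.one_apply]
    have := F.dualBasis_expand σ (F.dualBasis τ j) (F.idx τ k)
    rw [F.pairing_dualBasis] at this
    simp only [transitionMatrix, Matrix.of_apply]
    rw [Finset.sum_congr rfl fun l _ => mul_comm _ _, ← this]
    simp [eq_comm]
  have hu : IsUnit (F.transitionMatrix σ τ).det :=
    IsUnit.of_mul_eq_one _ (by rw [← Matrix.det_mul, h, Matrix.det_one])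
  exact Int.isUnit_sq hu

lemma isOpen_overlap (F : SmoothFan n m) (σ τ : F.MaxCone) :
    IsOpen ((F.chart σ).symm ⁻¹' F.chartSource τ) := by
  have h := (F.chart σ).continuousOn_symm
  have e : (F.chart σ).target = Set.univ := rfl
  rw [e, continuousOn_univ] at h
  exact (F.isOpen_chartSource τ).preimage h

section Nu

variable (F : SmoothFan n m) {ν : Fin n → ℤ} (hν : ∀ i, F.pairing ν i = 1)
include hν

/-- In logarithmic coordinates the chart change on the open orbit is linear, given by an integer
matrix of determinant ±1. Returning to affine coordinates introduces the products of the old and of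
the new coordinates, and both are w. -/
lemma det_fderiv_transition_of_ne_zero (σ τ : F.MaxCone) {y : Fin n → ℂ} (hy : ∀ l, y l ≠ 0) :
    (fderiv ℂ (F.chart τ ∘ (F.chart σ).symm) y).det ^ 2 = 1 := by
  set x := (F.chart σ).symm y with hx
  have hxs : x ∈ F.chartSource σ := F.chart_symm_mem σ y
  have hw : F.character ν x ≠ 0 := by
    rw [F.character_nu_chart_symm hν]
    exact Finset.prod_ne_zero_iff.2 fun l _ => hy l
  have hxt : x ∈ F.chartSource τ := F.mem_chartSource_of_character_ne_zero hν hw τ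
  set J := fderiv ℂ (F.chart τ ∘ (F.chart σ).symm) y with hJ
  have hd : HasFDerivAt (F.chart τ ∘ (F.chart σ).symm) J y :=
    ((F.contDiffOn_transition ℂ ∞ σ τ).differentiableOn (by simp)
      |>.differentiableAt ((F.isOpen_overlap σ τ).mem_nhds hxt)).hasFDerivAt
  have hyx : F.chart σ x = y := F.chart_apply_symm σ y
  -- Column l of the Jacobian is found by differentiating the orbit that scales only the l-th
  -- coordinate of the first chart.
  have key : ∀ (l j : Fin n), J (Pi.single l (y l)) j
      = F.chart τ x j * (F.transitionMatrix σ τ j l : ℂ) := by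
    intro l j
    set a : Fin n → ℂ := Pi.single l 1
    have e1 : ∀ s : ℂ, F.chart σ (F.cAct (F.extend σ (s • a)) x)
        = fun k => Complex.exp (s * a k) * y k := by
      intro s
      funext k
      rw [F.chart_cAct_extend, hyx]
      rfl
    have e2 : HasDerivAt (fun s : ℂ => F.chart σ (F.cAct (F.extend σ (s • a)) x))
        (Pi.single l (y l)) 0 := by
      simp only [e1]
      refine hasDerivAt_pi.2 fun k => ?_
      have := (((hasDerivAt_id (0 : ℂ)).mul_const (a k)).cexp).mul_const (y k)
      refine this.congr_deriv ?_
      by_cases hk : k = l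
      · subst hk; simp [a]
      · simp [a, hk]
    have hd' : HasFDerivAt (F.chart τ ∘ (F.chart σ).symm) J
        (F.chart σ (F.cAct (F.extend σ ((0 : ℂ) • a)) x)) := by
      have : F.chart σ (F.cAct (F.extend σ ((0 : ℂ) • a)) x) = y := by
        rw [e1]; simp
      rw [this]
      exact hd
    have e3 := hasDerivAt_pi.1 (hd'.comp_hasDerivAt (0 : ℂ) e2) j
    have e4 : HasDerivAt (fun s : ℂ => Complex.exp (s * F.transitionMatrix σ τ j l)
        * F.chart τ x j) (F.chart τ x j * (F.transitionMatrix σ τ j l : ℂ)) 0 := by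
      refine ((((hasDerivAt_id (0 : ℂ)).mul_const _).cexp).mul_const _).congr_deriv ?_
      simp [mul_comm]
    refine e3.unique (e4.congr_of_eventuallyEq (Filter.Eventually.of_forall fun s => ?_))
    have hm := (F.cAct_mem_chartSource σ (F.extend σ (s • a)) x).2 hxs
    simp only [Function.comp]
    rw [F.chart_symm_apply σ hm, F.chart_cAct, F.sum_extend, Finset.sum_eq_single l]
    · simp [a, transitionMatrix, mul_comm]
    · intro k _ hk
      simp [a, hk]
    · simp
  have hmat : LinearMap.toMatrix' (J : (Fin n → ℂ) →ₗ[ℂ] Fin n → ℂ) * Matrix.diagonal y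
      = Matrix.diagonal (F.chart τ x) * (F.transitionMatrix σ τ).map (Int.castRingHom ℂ) := by
    ext j l
    rw [Matrix.mul_diagonal, Matrix.diagonal_mul, LinearMap.toMatrix'_apply, Matrix.map_apply]
    have := key l j
    rw [show (Pi.single l (y l) : Fin n → ℂ) = y l • Pi.single l 1 by
      rw [← Pi.single_smul]; simp, map_smul, Pi.smul_apply, smul_eq_mul] at this
    rw [mul_comm]
    simpa [← Pi.single_apply] using this
  have hdet := congrArg Matrix.det hmat
  rw [Matrix.det_mul, Matrix.det_mul, Matrix.det_diagonal, Matrix.det_diagonal,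
    LinearMap.det_toMatrix', ← F.character_nu_eq_prod hν τ hxt,
    ← F.character_nu_chart_symm hν σ y, ← hx, mul_comm] at hdet
  have h1 := mul_left_cancel₀ hw hdet
  rw [ContinuousLinearMap.det, h1, ← RingHom.mapMatrix_apply, ← RingHom.map_det, ← map_pow,
    F.det_transitionMatrix_sq, map_one]

/-- Points with all coordinates nonzero are dense, as shifting all coordinates by a small s ≠ 0
shows, and the Jacobian is continuous. -/
lemma det_fderiv_transition (σ τ : F.MaxCone) {y : Fin n → ℂ}
    (hy : (F.chart σ).symm y ∈ F.chartSource τ) :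
    (fderiv ℂ (F.chart τ ∘ (F.chart σ).symm) y).det ^ 2 = 1 := by
  have hU := F.isOpen_overlap σ τ
  have hc : ContinuousOn (fun y => (fderiv ℂ (F.chart τ ∘ (F.chart σ).symm) y).det ^ 2)
      ((F.chart σ).symm ⁻¹' F.chartSource τ) :=
    (ContinuousLinearMap.continuous_det.comp_continuousOn
      ((F.contDiffOn_transition ℂ ∞ σ τ).continuousOn_fderiv_of_isOpen hU (by simp))).pow 2
  have hcy := hc.continuousAt (hU.mem_nhds hy)
  have ht : Filter.Tendsto (fun s : ℂ => fun l => y l + s) (nhdsWithin 0 {0}ᶜ) (nhds y) := by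
    have : Filter.Tendsto (fun s : ℂ => fun l => y l + s) (nhds 0) (nhds fun l => y l + 0) :=
      Continuous.tendsto (by fun_prop) 0
    simp only [add_zero] at this
    exact this.mono_left nhdsWithin_le_nhds
  refine tendsto_nhds_unique (hcy.tendsto.comp ht) (tendsto_const_nhds.congr' ?_)
  have hev : ∀ l, ∀ᶠ s : ℂ in nhdsWithin 0 {0}ᶜ, y l + s ≠ 0 := by
    intro l
    by_cases h0 : y l = 0
    · filter_upwards [self_mem_nhdsWithin] with s hs
      simpa [h0] using hs
    · have : ContinuousAt (fun s : ℂ => y l + s) 0 := by fun_prop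
      exact (this.eventually_ne (by simpa using h0)).filter_mono nhdsWithin_le_nhds
  filter_upwards [Filter.eventually_all.2 hev] with s hs
  exact (F.det_fderiv_transition_of_ne_zero hν σ τ hs).symm

/-- The square of the holomorphic volume form is well defined and continuous along a frame. -/
lemma continuousOn_det_sq {f : ℂ → F.ToricManifold} {e : Fin n → ℂ → Fin n → ℂ}
    (he : IsFrame f e) :
    ContinuousOn (fun z => (Matrix.of fun j => e j z).det ^ 2) (Metric.closedBall 0 1) := by
  intro z₀ hz₀
  set τ := F.coneAt (f z₀) with hτ
  -- Continuity of `f` is read off from a frame vector, so the case without frame vectors is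
  -- separate.
  rcases Nat.eq_zero_or_pos n with hn | hn
  · subst hn
    simpa using continuousWithinAt_const
  have h1 : ∀ j, ContinuousWithinAt f (Metric.closedBall 0 1) z₀ ∧
      ContinuousWithinAt (fun z => fderiv ℂ (F.chart τ ∘ (F.chart (F.coneAt (f z))).symm)
        (F.chart (F.coneAt (f z)) (f z)) (e j z)) (Metric.closedBall 0 1) z₀ := by
    intro j
    have h2 := (FiberBundle.continuousWithinAt_totalSpace (Fin n → ℂ) _).1 (he.continuousOn j z₀ hz₀)
    refine ⟨h2.1, ?_⟩
    -- Continuity in the tangent bundle refers to the frame carried into the fixed chart at `f z₀`.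
    -- The carrying maps have determinant ±1, invisible after squaring.
    have h3 := h2.2
    simp only [TangentBundle.trivializationAt_apply, mfld_simps, fderivWithin_univ] at h3
    exact h3
  have hf := (h1 ⟨0, hn⟩).1
  have h4 : ContinuousWithinAt (fun z => (Matrix.of fun j =>
      fderiv ℂ (F.chart τ ∘ (F.chart (F.coneAt (f z))).symm)
        (F.chart (F.coneAt (f z)) (f z)) (e j z)).det ^ 2) (Metric.closedBall 0 1) z₀ := by
    have hcont : Continuous fun M : Fin n → Fin n → ℂ => (Matrix.of M).det ^ 2 := by
      refine Continuous.pow (Continuous.matrix_det ?_) 2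
      exact continuous_id
    exact hcont.continuousAt.comp_continuousWithinAt
      (continuousWithinAt_pi.2 fun j => (h1 j).2)
  refine h4.congr_of_eventuallyEq ?_ ?_
  · filter_upwards [hf.preimage_mem_nhdsWithin
      ((F.isOpen_chartSource τ).mem_nhds (F.mem_coneAt (f z₀)))] with z hz
    have h5 := F.det_fderiv_transition hν (F.coneAt (f z)) τ
      (y := F.chart (F.coneAt (f z)) (f z)) (by
        rw [F.chart_symm_apply _ (F.mem_coneAt _)]; exact hz)
    have h6 := det_of_map (fderiv ℂ (F.chart τ ∘ (F.chart (F.coneAt (f z))).symm)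
      (F.chart (F.coneAt (f z)) (f z)) : (Fin n → ℂ) →ₗ[ℂ] Fin n → ℂ) (fun j => e j z)
    simp only [ContinuousLinearMap.coe_coe] at h6
    rw [h6, mul_pow]
    rw [ContinuousLinearMap.det] at h5
    rw [h5, one_mul]
  · have h5 := F.det_fderiv_transition hν (F.coneAt (f z₀)) τ
      (y := F.chart (F.coneAt (f z₀)) (f z₀)) (by
        rw [F.chart_symm_apply _ (F.mem_coneAt _)]; exact F.mem_coneAt _)
    have h6 := det_of_map (fderiv ℂ (F.chart τ ∘ (F.chart (F.coneAt (f z₀))).symm)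
      (F.chart (F.coneAt (f z₀)) (f z₀)) : (Fin n → ℂ) →ₗ[ℂ] Fin n → ℂ) (fun j => e j z₀)
    simp only [ContinuousLinearMap.coe_coe] at h6
    rw [h6, mul_pow]
    rw [ContinuousLinearMap.det] at h5
    rw [h5, one_mul]

lemma hasWinding_det_sq {f : ℂ → F.ToricManifold} {e : Fin n → ℂ → Fin n → ℂ}
    (he : IsFrame f e) :
    HasWinding (fun θ => (Matrix.of fun j => e j (Complex.exp (θ * Complex.I))).det ^ 2) 0 :=
  HasWinding.of_continuousOn_closedBall (F.continuousOn_det_sq hν he) fun z hz =>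
    pow_ne_zero 2 (ne_zero_of_linearIndependent (he.linearIndependent z hz))

end Nu

/-- The frame given by the coordinate vector fields of a chart. -/
lemma isFrame_chart (F : SmoothFan n m) (σ : F.MaxCone) {Y : ℂ → Fin n → ℂ}
    (hY : ContinuousOn Y (Metric.closedBall 0 1)) :
    IsFrame (fun z => (F.chart σ).symm (Y z)) fun j z =>
      mfderiv 𝓘(ℂ, Fin n → ℂ) 𝓘(ℂ, Fin n → ℂ) (F.chart σ).symm (Y z) (Pi.single j 1 : Fin n → ℂ) := by
  have hs : ContMDiff 𝓘(ℂ, Fin n → ℂ) 𝓘(ℂ, Fin n → ℂ) 1 (F.chart σ).symm :=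
    contMDiffOn_univ.1 (contMDiffOn_symm_of_mem_maximalAtlas
      (IsManifold.subset_maximalAtlas ⟨σ, rfl⟩))
  refine ⟨fun j => ?_, fun z _ => ?_⟩
  · have h1 := hs.continuous_tangentMap le_rfl
    have h2 : ContinuousOn (fun z => (⟨Y z, (Pi.single j 1 : Fin n → ℂ)⟩ :
        TangentBundle 𝓘(ℂ, Fin n → ℂ) (Fin n → ℂ))) (Metric.closedBall 0 1) := by
      have h3 := (tangentBundleModelSpaceHomeomorph 𝓘(ℂ, Fin n → ℂ)).symm.continuous
      exact h3.comp_continuousOn (hY.prodMk continuousOn_const)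
    exact h1.comp_continuousOn h2
  · have h1 : (F.chart σ).MDifferentiable 𝓘(ℂ, Fin n → ℂ) 𝓘(ℂ, Fin n → ℂ) :=
      mdifferentiable_of_mem_atlas ⟨σ, rfl⟩
    have h2 := h1.symm.mfderiv_injective (F.mem_chart_target σ (Y z))
    have h3 : ∀ L : (Fin n → ℂ) →L[ℂ] Fin n → ℂ, Function.Injective L →
        LinearIndependent ℂ fun j : Fin n => L (Pi.single j 1) := fun L hL =>
      (Pi.linearIndependent_single_one (Fin n) ℂ).map' (L : (Fin n → ℂ) →ₗ[ℂ] Fin n → ℂ)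
        (LinearMap.ker_eq_bot.2 hL)
    exact h3 _ h2

end SmoothFan

/-! ### Pairings with rays, two-forms and the moment map -/

namespace SmoothFan

variable {n m : ℕ}

/-- The pairing of `ξ ∈ M_ℝ` with the generator of a ray. -/
noncomputable def rayForm (F : SmoothFan n m) (i : Fin m) : (Fin n → ℝ) →L[ℝ] ℝ :=
  ∑ k, (F.ray i k : ℝ) • ContinuousLinearMap.proj k

lemma rayForm_apply (F : SmoothFan n m) (i : Fin m) (ξ : Fin n → ℝ) :
    F.rayForm i ξ = ∑ k, (F.ray i k : ℝ) * ξ k := by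
  simp [rayForm]

lemma rayForm_intCast (F : SmoothFan n m) (i : Fin m) (u : Fin n → ℤ) :
    F.rayForm i (fun k => (u k : ℝ)) = F.pairing u i := by
  rw [rayForm_apply, pairing]
  push_cast
  exact Finset.sum_congr rfl fun k _ => mul_comm _ _

lemma eq_zero_of_rayForm (F : SmoothFan n m) (σ : F.MaxCone) {ξ : Fin n → ℝ}
    (h : ∀ j, F.rayForm (F.idx σ j) ξ = 0) : ξ = 0 := by
  have hR := Matrix.nonsing_inv_mul _ (F.unimodular σ.1 σ.2.1 σ.2.2)
  funext a
  have e : ξ a = ∑ j, (F.dualBasis σ j a : ℝ) * F.rayForm (F.idx σ j) ξ := by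
    simp only [rayForm_apply, Finset.mul_sum]
    rw [Finset.sum_comm]
    have : ∀ b, ∑ j, (F.dualBasis σ j a : ℝ) * ((F.ray (F.idx σ j) b : ℝ) * ξ b)
        = (if a = b then 1 else 0) * ξ b := by
      intro b
      have h2 := congrFun (congrFun hR a) b
      rw [Matrix.mul_apply, Matrix.one_apply] at h2
      have h3 : ∑ j, F.dualBasis σ j a * F.ray (F.idx σ j) b = if a = b then 1 else 0 := h2
      simp only [← mul_assoc, ← Finset.sum_mul]
      congr 1
      exact_mod_cast congrArg (Int.cast : ℤ → ℝ) h3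
    simp [this]
  rw [e]
  simp [h]

/-- In the coordinates given by the generators of a maximal cone, ν is the vector (1, …, 1). -/
lemma mkQ_eq_iff (F : SmoothFan n m) {ν : Fin n → ℤ} (hν : ∀ i, F.pairing ν i = 1)
    (σ : F.MaxCone) (ξ ξ₀ : Fin n → ℝ) :
    (realLine ν).mkQ ξ = (realLine ν).mkQ ξ₀
      ↔ ∃ c, ∀ j, F.rayForm (F.idx σ j) ξ = F.rayForm (F.idx σ j) ξ₀ + c := by
  rw [Submodule.mkQ_apply, Submodule.mkQ_apply, Submodule.Quotient.eq, Submodule.mem_span_singleton]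
  refine exists_congr fun c => ⟨fun h j => ?_, fun h => ?_⟩
  · have := congrArg (F.rayForm (F.idx σ j)) h
    rw [map_smul, rayForm_intCast, hν, map_sub] at this
    simp at this
    linarith
  · have := F.eq_zero_of_rayForm σ (ξ := c • (fun k => (ν k : ℝ)) - (ξ - ξ₀)) fun j => by
      rw [map_sub, map_smul, rayForm_intCast, hν, map_sub, h j]
      simp
    exact sub_eq_zero.1 this

instance (F : SmoothFan n m) : Finite F.MaxCone :=
  Finite.of_injective (fun σ : F.MaxCone => σ.1) fun _ _ h => Subtype.ext h

lemma nonempty_maxCone (F : SmoothFan n m) : Nonempty F.MaxCone := by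
  obtain ⟨τ, hτ, -, hc⟩ := F.pure ∅ F.empty_mem
  exact ⟨⟨τ, hτ, hc⟩⟩

/-- The torus acts infinitesimally freely on the open orbit, since no chart coordinate vanishes
there. -/
lemma field_eq_zero_imp (F : SmoothFan n m) {x : F.ToricManifold} {ν : Fin n → ℤ}
    (hν : ∀ i, F.pairing ν i = 1) (hx : F.character ν x ≠ 0) {c : Fin m → ℂ}
    (hc : F.field x c = 0) (u : Fin n → ℤ) : ∑ i, (F.pairing u i : ℂ) * c i = 0 := by
  rw [F.character_nu_eq_prod hν _ (F.mem_coneAt x)] at hx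
  have h1 : ∀ j, ∑ i, (F.pairing (F.dualBasis (F.coneAt x) j) i : ℂ) * c i = 0 := fun j =>
    (mul_eq_zero.1 (congrFun hc j)).resolve_left (Finset.prod_ne_zero_iff.1 hx j (Finset.mem_univ j))
  have h2 : ∀ i, (F.pairing u i : ℂ) * c i = ∑ j, (F.pairing u (F.idx (F.coneAt x) j) : ℂ) *
      ((F.pairing (F.dualBasis (F.coneAt x) j) i : ℂ) * c i) := by
    intro i
    rw [F.dualBasis_expand (F.coneAt x) u i]
    push_cast
    rw [Finset.sum_mul]
    exact Finset.sum_congr rfl fun j _ => by ring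
  simp only [h2]
  rw [Finset.sum_comm]
  simp [← Finset.mul_sum, h1]

/-! ### Two-forms -/

section Form

variable (k : (Fin n → ℂ) [⋀^Fin 2]→L[ℝ] ℝ)

lemma form_self (v : Fin n → ℂ) : k ![v, v] = 0 :=
  k.map_eq_zero_of_eq ![v, v] (i := 0) (j := 1) rfl (by decide)

lemma form_add_left (v v' w : Fin n → ℂ) : k ![v + v', w] = k ![v, w] + k ![v', w] :=
  k.toAlternatingMap.map_vecCons_add ![w] v v'

lemma form_smul_left (a : ℝ) (v w : Fin n → ℂ) : k ![a • v, w] = a * k ![v, w] :=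
  k.toAlternatingMap.map_vecCons_smul ![w] a v

lemma form_swap (v w : Fin n → ℂ) : k ![v, w] = -k ![w, v] := by
  have h := k.toAlternatingMap.map_swap ![w, v] (i := 0) (j := 1) (by decide)
  have e : ![w, v] ∘ Equiv.swap (0 : Fin 2) 1 = ![v, w] := by
    funext j
    fin_cases j <;> simp
  rw [e] at h
  exact h

end Form

section Kahler

variable {F : SmoothFan n m} {κ : F.ToricManifold → (Fin n → ℂ) [⋀^Fin 2]→L[ℝ] ℝ}

lemma IsToricKahlerForm.symm (hκ : F.IsToricKahlerForm κ) (x : F.ToricManifold) (v w : Fin n → ℂ) :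
    κ x ![v, Complex.I • w] = κ x ![w, Complex.I • v] := by
  have h1 := hκ.type_one_one x v (Complex.I • w)
  rw [smul_smul, Complex.I_mul_I, neg_one_smul] at h1
  rw [← h1, form_swap, ← neg_one_smul ℝ w, form_smul_left]
  ring

variable {μ₀ : F.ToricManifold → Fin n → ℝ}

lemma IsMomentMap.deriv_eq_rayForm (hμ₀ : F.IsMomentMap κ μ₀) (c : Fin m → ℝ)
    (x : F.ToricManifold) (v : Fin n → ℂ) :
    ∑ i, c i * F.rayForm i (mfderiv 𝓘(ℝ, Fin n → ℂ) 𝓘(ℝ, Fin n → ℝ) μ₀ x v : Fin n → ℝ)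
      = κ x ![v, F.field x fun i => c i * Complex.I] := by
  rw [← torusField_eq, ← hμ₀.deriv_eq c x v]
  exact Finset.sum_congr rfl fun i _ => congrArg _ (F.rayForm_apply i _)

variable {E : Type} [NormedAddCommGroup E] [NormedSpace ℝ E]

lemma IsMomentMap.exists_hasFDerivAt (hμ₀ : F.IsMomentMap κ μ₀) {g : E → F.ToricManifold} {e : E}
    {D : E →L[ℝ] Fin n → ℂ} (hg : HasMFDerivAt 𝓘(ℝ, E) 𝓘(ℝ, Fin n → ℂ) g e D) :
    ∃ D' : E →L[ℝ] Fin n → ℝ, HasFDerivAt (fun e => μ₀ (g e)) D' e ∧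
      ∀ (c : Fin m → ℝ) v, ∑ i, c i * F.rayForm i (D' v)
        = κ (g e) ![D v, F.field (g e) fun i => c i * Complex.I] := by
  have h1 := ((hμ₀.smooth.mdifferentiable (by simp)) (g e)).hasMFDerivAt
  have h2 := h1.comp e hg
  exact ⟨_, hasMFDerivAt_iff_hasFDerivAt.1 h2, fun c v => hμ₀.deriv_eq_rayForm c (g e) (D v)⟩

lemma IsMomentMap.exists_hasFDerivAt_cAct (hμ₀ : F.IsMomentMap κ μ₀) (x : F.ToricManifold)
    (L : E →L[ℝ] Fin m → ℂ) (e : E) :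
    ∃ D : E →L[ℝ] Fin n → ℝ, HasFDerivAt (fun e => μ₀ (F.cAct (L e) x)) D e ∧
      ∀ (c : Fin m → ℝ) v, ∑ i, c i * F.rayForm i (D v) = κ (F.cAct (L e) x)
        ![F.field (F.cAct (L e) x) (L v), F.field (F.cAct (L e) x) fun i => c i * Complex.I] := by
  obtain ⟨D₁, hD₁, h1⟩ := F.exists_hasMFDerivAt_cAct x L e
  obtain ⟨D, hD, h2⟩ := hμ₀.exists_hasFDerivAt hD₁
  refine ⟨D, hD, fun c v => ?_⟩
  rw [h2, h1]

/-- The orbits of the torus are isotropic. -/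
lemma IsMomentMap.isotropic (hμ₀ : F.IsMomentMap κ μ₀) (x : F.ToricManifold) (a c : Fin m → ℝ) :
    κ x ![F.field x fun i => a i * Complex.I, F.field x fun i => c i * Complex.I] = 0 := by
  let L : ℝ →L[ℝ] Fin m → ℂ := ContinuousLinearMap.toSpanSingleton ℝ fun i => (a i : ℂ) * Complex.I
  obtain ⟨D, hD, h⟩ := hμ₀.exists_hasFDerivAt_cAct x L 0
  -- The moment map is constant along orbits, and its derivative there is the pairing of two torus
  -- fields.
  have e : (fun s : ℝ => μ₀ (F.cAct (L s) x)) = fun _ => μ₀ x := by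
    funext s
    rw [← hμ₀.invariant (s • a) x, torusAct_eq_cAct]
    congr 2
    funext i
    simp [L, mul_assoc]
  rw [e] at hD
  have h2 := h c 1
  rw [hD.unique (hasFDerivAt_const _ _), map_zero, cAct_zero] at h2
  have h3 : L 1 = fun i => (a i : ℂ) * Complex.I := by simp [L]
  rw [h3] at h2
  simpa using h2.symm

end Kahler

end SmoothFan

/-! ### The moment map in logarithmic coordinates -/

namespace SmoothFan

variable {n m : ℕ}

lemma extend_ofReal_mul_I (F : SmoothFan n m) (σ : F.MaxCone) (a : Fin n → ℝ) (i : Fin m) :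
    ((F.extend σ a i : ℝ) : ℂ) * Complex.I = F.extend σ (fun j => (a j : ℂ) * Complex.I) i := by
  simp only [extend]
  push_cast
  rw [Finset.sum_mul]
  refine Finset.sum_congr rfl fun j _ => ?_
  split_ifs <;> simp

lemma extend_ofReal (F : SmoothFan n m) (σ : F.MaxCone) (a : Fin n → ℝ) (i : Fin m) :
    ((F.extend σ a i : ℝ) : ℂ) = F.extend σ (fun j => (a j : ℂ)) i := by
  simp only [extend]
  push_cast
  refine Finset.sum_congr rfl fun j _ => ?_
  split_ifs <;> simp

lemma contMDiff_chart_symm (F : SmoothFan n m) (σ : F.MaxCone) :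
    ContMDiff 𝓘(ℝ, Fin n → ℂ) 𝓘(ℝ, Fin n → ℂ) ∞ (F.chart σ).symm :=
  contMDiffOn_univ.1 (contMDiffOn_symm_of_mem_maximalAtlas
    (IsManifold.subset_maximalAtlas ⟨σ, rfl⟩))

lemma chart_ext (F : SmoothFan n m) (σ : F.MaxCone) {x x' : F.ToricManifold}
    (hx : x ∈ F.chartSource σ) (hx' : x' ∈ F.chartSource σ)
    (h : ∀ j, F.chart σ x j = F.chart σ x' j) : x = x' :=
  (F.chart σ).injOn hx hx' (funext h)

/-- The point with positive coordinates `exp (t j)` in the chart of a cone. -/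
noncomputable def realPt (F : SmoothFan n m) (σ : F.MaxCone) (t : Fin n → ℝ) : F.ToricManifold :=
  (F.chart σ).symm fun j => Complex.exp (t j)

lemma chart_realPt (F : SmoothFan n m) (σ : F.MaxCone) (t : Fin n → ℝ) (j : Fin n) :
    F.chart σ (F.realPt σ t) j = Complex.exp (t j) := by
  rw [realPt, chart_apply_symm]

lemma realPt_eq_cAct (F : SmoothFan n m) (σ : F.MaxCone) (t : Fin n → ℝ) :
    F.realPt σ t = F.cAct (F.extend σ fun j => (t j : ℂ)) (F.realPt σ 0) := by
  refine F.chart_ext σ (F.chart_symm_mem σ _)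
    ((F.cAct_mem_chartSource σ _ _).2 (F.chart_symm_mem σ _)) fun j => ?_
  rw [chart_realPt, chart_cAct_extend, chart_realPt]
  simp

lemma contMDiff_realPt (F : SmoothFan n m) (σ : F.MaxCone) :
    ContMDiff 𝓘(ℝ, Fin n → ℝ) 𝓘(ℝ, Fin n → ℂ) ∞ (F.realPt σ) := by
  refine (F.contMDiff_chart_symm σ).comp (ContDiff.contMDiff ?_)
  refine contDiff_pi.2 fun j => ?_
  exact (Complex.ofRealCLM.contDiff.comp (contDiff_apply ℝ ℝ j)).cexp

lemma character_nu_realPt (F : SmoothFan n m) {ν : Fin n → ℤ} (hν : ∀ i, F.pairing ν i = 1)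
    (σ : F.MaxCone) (t : Fin n → ℝ) :
    F.character ν (F.realPt σ t) = Complex.exp (∑ j, t j : ℝ) := by
  rw [realPt, F.character_nu_chart_symm hν]
  push_cast
  rw [Complex.exp_sum]

section Moment

variable {F : SmoothFan n m} {ν : Fin n → ℤ} (hν : ∀ i, F.pairing ν i = 1)
  {κ : F.ToricManifold → (Fin n → ℂ) [⋀^Fin 2]→L[ℝ] ℝ} (hκ : F.IsToricKahlerForm κ)
  {μ₀ : F.ToricManifold → Fin n → ℝ} (hμ₀ : F.IsMomentMap κ μ₀)

include hμ₀ in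
-- The two points differ by the rotation through the differences of the arguments of their
-- coordinates, and the moment map is torus invariant.
lemma moment_eq_of_norm_eq (σ : F.MaxCone) {x x' : F.ToricManifold} (hx : x ∈ F.chartSource σ)
    (hx' : x' ∈ F.chartSource σ) (h : ∀ j, ‖F.chart σ x j‖ = ‖F.chart σ x' j‖) :
    μ₀ x = μ₀ x' := by
  have e : x = F.torusAct (F.extend σ fun j =>
      (F.chart σ x j).arg - (F.chart σ x' j).arg) x' := by
    rw [torusAct_eq_cAct]
    simp only [extend_ofReal_mul_I]
    refine F.chart_ext σ hx ((F.cAct_mem_chartSource σ _ _).2 hx') fun j => ?_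
    rw [chart_cAct_extend]
    have h1 := Complex.norm_mul_exp_arg_mul_I (F.chart σ x j)
    have h2 := Complex.norm_mul_exp_arg_mul_I (F.chart σ x' j)
    rw [h] at h1
    generalize (F.chart σ x j).arg = α at h1 ⊢
    generalize (F.chart σ x' j).arg = β at h2 ⊢
    rw [← h1, ← h2, norm_mul, Complex.norm_exp_ofReal_mul_I, mul_one, Complex.norm_real, norm_norm,
      mul_left_comm, ← Complex.exp_add]
    congr 2
    push_cast
    ring
  rw [e, hμ₀.invariant]

include hν hμ₀ in
lemma moment_eq_realPt (σ : F.MaxCone) {x : F.ToricManifold} (hx : F.character ν x ≠ 0) :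
    μ₀ x = μ₀ (F.realPt σ fun j => Real.log ‖F.chart σ x j‖) := by
  have hxs := F.mem_chartSource_of_character_ne_zero hν hx σ
  refine moment_eq_of_norm_eq hμ₀ σ hxs (F.chart_symm_mem σ _) fun j => ?_
  rw [F.character_nu_eq_prod hν σ hxs] at hx
  have := Finset.prod_ne_zero_iff.1 hx j (Finset.mem_univ j)
  rw [chart_realPt, ← Complex.ofReal_exp, Complex.norm_real, Real.exp_log (norm_pos_iff.2 this)]
  simp

include hν hκ hμ₀ in
-- Moving the logarithms of the moduli is the flow of -i times a torus field. By the moment map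
-- equation, the differential is then the Riemannian metric of `κ` on such directions, hence
-- symmetric and positive definite; no Kähler potential is needed.
lemma isConvexGradient_moment (σ : F.MaxCone) :
    IsConvexGradient fun t j => F.rayForm (F.idx σ j) (μ₀ (F.realPt σ t)) := by
  set Φ : (Fin n → ℝ) → Fin n → ℝ := fun t j => F.rayForm (F.idx σ j) (μ₀ (F.realPt σ t)) with hΦ
  have hs : ContDiff ℝ ∞ fun t => μ₀ (F.realPt σ t) :=
    contMDiff_iff_contDiff.1 (hμ₀.smooth.comp (F.contMDiff_realPt σ))
  have hs' : ContDiff ℝ ∞ Φ := contDiff_pi.2 fun j => (F.rayForm (F.idx σ j)).contDiff.comp hs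
  let L : (Fin n → ℝ) →L[ℝ] Fin m → ℂ := ContinuousLinearMap.pi fun i =>
    ∑ j, if F.idx σ j = i then Complex.ofRealCLM.comp (ContinuousLinearMap.proj j) else 0
  have hL : ∀ t, L t = F.extend σ fun j => (t j : ℂ) := by
    intro t
    funext i
    simp only [L, ContinuousLinearMap.coe_pi', extend, sum_apply]
    refine Finset.sum_congr rfl fun j _ => ?_
    split_ifs <;> simp
  have key : ∀ t v w, ∑ j, w j * fderiv ℝ Φ t v j = κ (F.realPt σ t)
      ![F.field (F.realPt σ t) (L v), Complex.I • F.field (F.realPt σ t) (L w)] := by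
    intro t v w
    obtain ⟨D, hD, h⟩ := hμ₀.exists_hasFDerivAt_cAct (F.realPt σ 0) L t
    simp only [hL t, ← realPt_eq_cAct] at h
    have hD' : HasFDerivAt (fun t => μ₀ (F.realPt σ t)) D t := by
      have : (fun t => μ₀ (F.realPt σ t)) = fun t => μ₀ (F.cAct (L t) (F.realPt σ 0)) := by
        funext t
        rw [hL, ← realPt_eq_cAct]
      rw [this]
      exact hD
    have h1 : ∀ j, fderiv ℝ Φ t v j = F.rayForm (F.idx σ j) (D v) := by
      intro j
      have h2 : HasFDerivAt Φ (ContinuousLinearMap.pi fun j => (F.rayForm (F.idx σ j)).comp D) t :=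
        hasFDerivAt_pi.2 fun j => (F.rayForm (F.idx σ j)).hasFDerivAt.comp t hD'
      rw [h2.fderiv]
      rfl
    simp only [h1]
    have h3 := h (F.extend σ w) v
    have h4 : (fun i => ((F.extend σ w i : ℝ) : ℂ) * Complex.I) = Complex.I • L w := by
      funext i
      rw [hL, extend_ofReal]
      simp [mul_comm]
    rw [h4, field_smul] at h3
    rw [← h3]
    have h5 := F.sum_extend σ w fun i => F.rayForm i (D v)
    simpa only [mul_comm] using h5.symm
  refine ⟨hs', fun t v w => ?_, fun t v hv => ?_⟩
  · rw [key, key, hκ.symm]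
  · rw [key]
    refine hκ.positive _ _ fun h0 => hv (funext fun l => ?_)
    have hw : F.character ν (F.realPt σ t) ≠ 0 := by
      rw [F.character_nu_realPt hν]
      exact Complex.exp_ne_zero _
    have h1 := F.field_eq_zero_imp hν hw h0 (F.dualBasis σ l)
    rw [hL, sum_extend] at h1
    simpa [F.pairing_dualBasis] using h1

include hν hκ hμ₀ in
/-- The points of the open orbit with given `[μ₀ x]` have coordinates whose moduli are smooth
functions of `|w x|`. -/
lemma exists_moduli [NeZero n] (σ : F.MaxCone) {ξ : Fin n → ℝ} {x₀ : F.ToricManifold}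
    (hx₀ : F.character ν x₀ ≠ 0) (hξ : (realLine ν).mkQ (μ₀ x₀) = (realLine ν).mkQ ξ) :
    ∃ T : ℝ → Fin n → ℝ, ContDiff ℝ ∞ T ∧ (∀ ℓ, ∑ j, T ℓ j = ℓ) ∧
      ∀ x, F.character ν x ≠ 0 → ((realLine ν).mkQ (μ₀ x) = (realLine ν).mkQ ξ ↔
        ∀ j, Real.log ‖F.chart σ x j‖ = T (Real.log ‖F.character ν x‖) j) := by
  have hΦ := isConvexGradient_moment hν hκ hμ₀ σ
  rw [F.mkQ_eq_iff hν σ, moment_eq_realPt hν hμ₀ σ hx₀] at hξ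
  obtain ⟨c₀, hc₀⟩ := hξ
  obtain ⟨T, hT, hs, hc⟩ := hΦ.exists_smooth_curve hc₀
  refine ⟨T, hT, hs, fun x hx => ?_⟩
  rw [F.mkQ_eq_iff hν σ, moment_eq_realPt hν hμ₀ σ hx]
  obtain ⟨c, hc⟩ := hc (Real.log ‖F.character ν x‖)
  have hsum : ∑ j, Real.log ‖F.chart σ x j‖ = Real.log ‖F.character ν x‖ := by
    have hxs := F.mem_chartSource_of_character_ne_zero hν hx σ
    rw [F.character_nu_eq_prod hν σ hxs] at hx ⊢
    rw [norm_prod, Real.log_prod]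
    intro j hj
    exact norm_ne_zero_iff.2 (Finset.prod_ne_zero_iff.1 hx j hj)
  constructor
  · rintro ⟨c', hc'⟩ j
    -- Both points lie over the same line parallel to ν and have the same coordinate sum log |w|, so
    -- strict convexity identifies them.
    refine congrFun (hΦ.eq_of_sub_const (c := c' - c) (t := fun j => Real.log ‖F.chart σ x j‖)
      (t' := T _) (fun j => ?_) ?_) j
    · simp only [hc, hc']
      ring
    · rw [hsum, hs]
  · intro h
    refine ⟨c, fun j => ?_⟩
    simp only [h]
    exact hc j

include hμ₀ in
/-- The function `⟨v, μ₀⟩` is constant on the toric divisor of `v` in an affine chart. -/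
lemma rayForm_moment_eq_of_chart_eq_zero (σ : F.MaxCone) {x : F.ToricManifold}
    (hx : x ∈ F.chartSource σ) {j : Fin n} (hj : F.chart σ x j = 0) :
    F.rayForm (F.idx σ j) (μ₀ x) = F.rayForm (F.idx σ j) (μ₀ ((F.chart σ).symm 0)) := by
  classical
  set y := F.chart σ x with hy
  -- Contract to the origin of the chart inside the divisor. The circle of its ray fixes the path
  -- pointwise, so the generating field vanishes and the moment component does not change.
  have hd : ∀ s : ℝ, HasDerivAt
      (fun s : ℝ => F.rayForm (F.idx σ j) (μ₀ ((F.chart σ).symm (s • y)))) 0 s := by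
    intro s
    have hg : MDifferentiableAt 𝓘(ℝ, ℝ) 𝓘(ℝ, Fin n → ℂ) (fun s : ℝ => (F.chart σ).symm (s • y)) s := by
      refine (((F.contMDiff_chart_symm σ).comp (ContDiff.contMDiff ?_)).mdifferentiable
        (by simp : (∞ : ℕ∞ω) ≠ 0)) s
      fun_prop
    obtain ⟨D, hD, h⟩ := hμ₀.exists_hasFDerivAt hg.hasMFDerivAt
    have h1 := h (Pi.single (F.idx σ j) 1) 1
    have hfix : ∀ t : ℝ, F.torusAct (t • Pi.single (F.idx σ j) 1) ((F.chart σ).symm (s • y))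
        = (F.chart σ).symm (s • y) := by
      intro t
      refine congrArg F.pt (Subtype.ext (funext fun i => ?_))
      change Complex.exp (((t • (Pi.single (F.idx σ j) 1 : Fin m → ℝ)) i : ℝ) * Complex.I)
        * F.sectionFun σ (s • y) i = F.sectionFun σ (s • y) i
      by_cases hi : i = F.idx σ j
      · subst hi
        rw [F.sectionFun_idx]
        simp [hj]
      · simp [hi]
    have h2 : F.field ((F.chart σ).symm (s • y))
        (fun i => ((Pi.single (F.idx σ j) 1 : Fin m → ℝ) i : ℂ) * Complex.I) = 0 := by
      obtain ⟨D₀, hD₀, h0⟩ := F.hasMFDerivAt_torusAct (Pi.single (F.idx σ j) 1)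
        ((F.chart σ).symm (s • y))
      rw [← h0]
      rw [funext hfix] at hD₀
      rw [hasMFDerivAt_unique hD₀ (hasMFDerivAt_const _ _)]
      rfl
    rw [h2] at h1
    have h3 : ∀ v : Fin n → ℂ, κ ((F.chart σ).symm (s • y)) ![v, 0] = 0 := by
      intro v
      rw [form_swap, ← zero_smul ℝ v, form_smul_left]
      simp
    rw [h3] at h1
    have h4 := ((F.rayForm (F.idx σ j)).hasFDerivAt.comp s hD).hasDerivAt
    refine h4.congr_deriv ?_
    simpa [Pi.single_apply] using h1
  have h := is_const_of_deriv_eq_zero (fun s => (hd s).differentiableAt) (fun s => (hd s).deriv) 1 0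
  simp only [one_smul, zero_smul] at h
  rw [← h, hy, F.chart_symm_apply σ hx]

section Polyhedron

variable {c : Fin m → ℝ} (hP : Set.range μ₀ = F.polyhedron c)

include hν hμ₀ hP in
-- Far out in the direction ν the line through `ξ` lies in the polyhedron, and there its pairings
-- with the rays exceed the finitely many values taken on the divisors in the charts.
lemma exists_moment_eq_of_character_ne_zero (ξ : Fin n → ℝ) :
    ∃ x, F.character ν x ≠ 0 ∧ (realLine ν).mkQ (μ₀ x) = (realLine ν).mkQ ξ := by
  obtain ⟨b, hb⟩ := (Set.finite_range fun p : F.MaxCone × Fin n =>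
    F.rayForm (F.idx p.1 p.2) (μ₀ ((F.chart p.1).symm 0)) - F.rayForm (F.idx p.1 p.2) ξ).bddAbove
  obtain ⟨b', hb'⟩ := (Set.finite_range fun i => c i - F.rayForm i ξ).bddAbove
  set l := max (b + 1) b' with hl
  have hmem : ξ + l • (fun k => (ν k : ℝ)) ∈ Set.range μ₀ := by
    rw [hP]
    intro i
    rw [← rayForm_apply, map_add, map_smul, rayForm_intCast, hν]
    have h1 : c i - F.rayForm i ξ ≤ b' := hb' ⟨i, rfl⟩
    have h2 := le_max_right (b + 1) b'
    simp
    linarith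
  obtain ⟨x, hx⟩ := hmem
  refine ⟨x, fun hw => ?_, ?_⟩
  · rw [F.character_nu_eq_prod hν _ (F.mem_coneAt x), Finset.prod_eq_zero_iff] at hw
    obtain ⟨j, -, hj⟩ := hw
    have h1 := rayForm_moment_eq_of_chart_eq_zero hμ₀ _ (F.mem_coneAt x) hj
    rw [hx, map_add, map_smul, rayForm_intCast, hν] at h1
    have h2 := hb ⟨(F.coneAt x, j), rfl⟩
    have h3 := le_max_left (b + 1) b'
    simp at h1 h2
    linarith
  · rw [hx, Submodule.mkQ_apply, Submodule.mkQ_apply, Submodule.Quotient.eq]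
    rw [add_sub_cancel_left]
    exact Submodule.smul_mem _ _ (Submodule.mem_span_singleton_self _)

include hν hκ hμ₀ hP in
-- On the line through `ξ` take the first point of the polyhedron, where some constraint `i₀` is
-- tight. A preimage minimizes the moment component of that ray. In the open orbit this component
-- would grow strictly along the corresponding real flow, so w must vanish.
lemma exists_moment_eq_of_character_eq_zero [Nonempty (Fin m)] (ξ : Fin n → ℝ) :
    ∃ x, F.character ν x = 0 ∧ (realLine ν).mkQ (μ₀ x) = (realLine ν).mkQ ξ := by
  classical
  obtain ⟨i₀, hi₀⟩ := Finite.exists_max fun i => c i - F.rayForm i ξ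
  set l := c i₀ - F.rayForm i₀ ξ with hl
  have hmem : ξ + l • (fun k => (ν k : ℝ)) ∈ Set.range μ₀ := by
    rw [hP]
    intro i
    rw [← rayForm_apply, map_add, map_smul, rayForm_intCast, hν]
    have h1 := hi₀ i
    simp
    linarith
  obtain ⟨x, hx⟩ := hmem
  refine ⟨x, ?_, ?_⟩
  · by_contra hw
    have hmin : ∀ x', F.rayForm i₀ (μ₀ x) ≤ F.rayForm i₀ (μ₀ x') := by
      intro x'
      have h1 : μ₀ x' ∈ F.polyhedron c := hP ▸ ⟨x', rfl⟩
      have h2 := h1 i₀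
      rw [← rayForm_apply] at h2
      rw [hx, map_add, map_smul, rayForm_intCast, hν]
      simp
      linarith
    let a : Fin m → ℂ := fun i => ((Pi.single i₀ 1 : Fin m → ℝ) i : ℂ)
    obtain ⟨D, hD, h⟩ := hμ₀.exists_hasFDerivAt_cAct x
      (ContinuousLinearMap.toSpanSingleton ℝ a) 0
    have h1 := h (Pi.single i₀ 1) 1
    have h2 := ((F.rayForm i₀).hasFDerivAt.comp (0 : ℝ) hD)
    have hm : IsLocalMin ((F.rayForm i₀) ∘ fun s : ℝ =>
        μ₀ (F.cAct (ContinuousLinearMap.toSpanSingleton ℝ a s) x)) 0 := by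
      refine Filter.Eventually.of_forall fun s => ?_
      simp only [Function.comp, map_zero, cAct_zero]
      exact hmin _
    have h3 := congrArg (fun L : ℝ →L[ℝ] ℝ => L 1) (hm.hasFDerivAt_eq_zero h2)
    rw [map_zero, cAct_zero] at h1
    have e1 : (fun i => ((Pi.single i₀ 1 : Fin m → ℝ) i : ℂ) * Complex.I) = Complex.I • a := by
      funext i
      simp [a, mul_comm]
    have e2 : (ContinuousLinearMap.toSpanSingleton ℝ a) 1 = a := by simp
    rw [e1, e2, field_smul] at h1
    have h4 : κ x ![F.field x a, Complex.I • F.field x a] = 0 := by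
      rw [← h1]
      simpa [Pi.single_apply] using h3
    have h5 : F.field x a = 0 := by
      by_contra h0
      exact (hκ.positive x _ h0).ne' h4
    have h6 := F.field_eq_zero_imp hν hw h5 ν
    have h7 : ∑ i, a i = 1 := by
      rw [← Complex.ofReal_sum]
      simp
    simp [hν, h7] at h6
  · rw [hx, Submodule.mkQ_apply, Submodule.mkQ_apply, Submodule.Quotient.eq]
    rw [add_sub_cancel_left]
    exact Submodule.smul_mem _ _ (Submodule.mem_span_singleton_self _)

end Polyhedron

end Moment

end SmoothFan

/-! ### Linear algebra of the Lagrangian phase -/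

lemma det_diagonal_updateCol {n : ℕ} (d u : Fin n → ℂ) (j : Fin n) :
    ((Matrix.diagonal d).updateCol j u).det = (∏ k ∈ Finset.univ.erase j, d k) * u j := by
  rw [← Matrix.cramer_apply, Matrix.cramer_eq_adjugate_mulVec, Matrix.adjugate_diagonal,
    Matrix.mulVec_diagonal]

lemma det_one_updateRow {n : ℕ} (u : Fin n → ℂ) (j : Fin n) :
    ((1 : Matrix (Fin n) (Fin n) ℂ).updateRow j u).det = u j := by
  rw [← Matrix.det_transpose, ← Matrix.updateCol_transpose, Matrix.transpose_one,
    ← Matrix.diagonal_one, det_diagonal_updateCol]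
  simp

namespace SmoothFan

/-- A submodule of codimension one in `T`, together with one more vector, spans `T`. -/
lemma exists_span_of_finrank {E : Type} [AddCommGroup E] [Module ℝ E] [FiniteDimensional ℝ E]
    {W T : Submodule ℝ E} (hWT : W ≤ T) (h : Module.finrank ℝ T ≤ Module.finrank ℝ W + 1) :
    ∃ η ∈ T, ∀ v ∈ T, ∃ w ∈ W, ∃ r : ℝ, v = w + r • η := by
  rcases eq_or_lt_of_le hWT with rfl | hlt
  · exact ⟨0, W.zero_mem, fun v hv => ⟨v, hv, 0, by simp⟩⟩
  obtain ⟨η, hη, hηW⟩ := SetLike.exists_of_lt hlt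
  refine ⟨η, hη, fun v hv => ?_⟩
  have h1 : W ⊔ Submodule.span ℝ {η} ≤ T :=
    sup_le hWT ((Submodule.span_singleton_le_iff_mem _ _).2 hη)
  have h2 : W < W ⊔ Submodule.span ℝ {η} := by
    refine lt_of_le_of_ne le_sup_left fun h => hηW ?_
    rw [h]
    exact Submodule.mem_sup_right (Submodule.mem_span_singleton_self η)
  have h3 := Submodule.eq_of_le_of_finrank_le h1 (by
    have := Submodule.finrank_lt_finrank_of_lt h2
    omega)
  rw [← h3, Submodule.mem_sup] at hv
  obtain ⟨w, hw, z, hz, rfl⟩ := hv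
  obtain ⟨r, rfl⟩ := Submodule.mem_span_singleton.1 hz
  exact ⟨w, hw, r, rfl⟩

/-- The phase of a Lagrangian subspace that contains the tangent spaces of the orbits of a torus
of corank one. -/
lemma det_sq_of_lagrangian {n : ℕ} (y : Fin n → ℂ) (j₀ : Fin n) (hy : ∀ k, k ≠ j₀ → y k ≠ 0)
    {q : ℂ} (T : Submodule ℝ (Fin n → ℂ)) (hT : Module.finrank ℝ T = n)
    (hξ : ∀ a : Fin n → ℝ, ∑ j, a j = 0 → (fun j => Complex.I * (y j * a j)) ∈ T)
    (hdw : ∀ v ∈ T, ∃ s : ℝ, ∑ j, (∏ k ∈ Finset.univ.erase j, y k) * v j = s * (Complex.I * q))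
    (K : (Fin n → ℂ) [⋀^Fin 2]→L[ℝ] ℝ) (hpos : ∀ v, v ≠ 0 → 0 < K ![v, Complex.I • v])
    (hK : ∀ v ∈ T, ∀ a : Fin n → ℝ, ∑ j, a j = 0 →
      K ![v, fun j => Complex.I * (y j * a j)] = 0)
    (b : Module.Basis (Fin n) ℝ T) :
    ∃ c : ℝ, 0 < c ∧
      (Matrix.of fun l => (b l : Fin n → ℂ)).det ^ 2 = c * ((Complex.I ^ n) ^ 2 * q ^ 2) := by
  let Ξ : (Fin n → ℝ) →ₗ[ℝ] Fin n → ℂ :=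
    { toFun := fun a j => Complex.I * (y j * a j)
      map_add' := fun a a' => by funext j; simp; ring
      map_smul' := fun r a => by funext j; simp; ring }
  let Z : Submodule ℝ (Fin n → ℝ) := LinearMap.ker (∑ j, LinearMap.proj j : (Fin n → ℝ) →ₗ[ℝ] ℝ)
  have hZ : ∀ a, a ∈ Z ↔ ∑ j, a j = 0 := fun a => by simp [Z, LinearMap.mem_ker]
  let W := LinearMap.range (Ξ.domRestrict Z)
  have hWT : W ≤ T := by
    rintro _ ⟨a, rfl⟩
    exact hξ a ((hZ a).1 a.2)
  have hWfin : n ≤ Module.finrank ℝ W + 1 := by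
    -- Only the coordinate `j₀` can be lost where `y` vanishes, and the zero-sum condition recovers
    -- it.
    have hinj : Function.Injective (Ξ.domRestrict Z) := by
      rw [injective_iff_map_eq_zero]
      rintro ⟨a, ha⟩ h
      have h1 : ∀ k, k ≠ j₀ → a k = 0 := by
        intro k hk
        have h2 : Complex.I * (y k * a k) = 0 := congrFun h k
        simpa [hy k hk] using h2
      have h3 := (hZ a).1 ha
      rw [Finset.sum_eq_single j₀ (fun k _ hk => h1 k hk) (by simp)] at h3
      refine Subtype.ext (funext fun k => ?_)
      by_cases hk : k = j₀
      · rw [hk]; exact h3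
      · exact h1 k hk
    have h2 : Module.finrank ℝ W = Module.finrank ℝ Z := LinearMap.finrank_range_of_inj hinj
    have h3 := LinearMap.finrank_range_add_finrank_ker
      (∑ j, LinearMap.proj j : (Fin n → ℝ) →ₗ[ℝ] ℝ)
    have h4 := Submodule.finrank_le (LinearMap.range (∑ j, LinearMap.proj j : (Fin n → ℝ) →ₗ[ℝ] ℝ))
    rw [Module.finrank_self] at h4
    rw [Module.finrank_fin_fun] at h3
    have h5 : Module.finrank ℝ Z = Module.finrank ℝ
      (LinearMap.ker (∑ j, LinearMap.proj j : (Fin n → ℝ) →ₗ[ℝ] ℝ)) := rfl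
    omega
  obtain ⟨η, hη, hdec⟩ := exists_span_of_finrank hWT (by rw [hT]; exact hWfin)
  have hdec' : ∀ v ∈ T, ∃ a : Fin n → ℝ, ∑ j, a j = 0 ∧ ∃ r : ℝ, v = Ξ a + r • η := by
    intro v hv
    obtain ⟨_, ⟨a, rfl⟩, r, h⟩ := hdec v hv
    exact ⟨a, (hZ a).1 a.2, r, h⟩
  have hiso : ∀ u ∈ T, ∀ v ∈ T, K ![u, v] = 0 := by
    have h1 : ∀ u ∈ T, K ![u, η] = 0 := by
      intro u hu
      obtain ⟨a, ha, r, rfl⟩ := hdec' u hu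
      rw [form_add_left, form_smul_left, form_self, form_swap]
      have : K ![η, Ξ a] = 0 := hK η hη a ha
      rw [this]
      simp
    intro u hu v hv
    obtain ⟨a, ha, r, rfl⟩ := hdec' v hv
    have h2 : K ![u, Ξ a] = 0 := hK u hu a ha
    rw [form_swap, form_add_left, form_smul_left, form_swap K (Ξ a), h2, form_swap K η, h1 u hu]
    simp
  -- An isotropic subspace is totally real by positivity, so a real basis of it is a complex basis
  -- of ℂⁿ.
  have hreal : ∀ v ∈ T, Complex.I • v ∈ T → v = 0 := by
    intro v hv hIv
    by_contra h
    exact (hpos v h).ne' (hiso v hv _ hIv)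
  have hdet : (Matrix.of fun l => (b l : Fin n → ℂ)).det ≠ 0 := by
    refine ne_zero_of_linearIndependent (Fintype.linearIndependent_iff.2 fun g hg => ?_)
    set u : T := ∑ l, (g l).re • b l with hu
    set v : T := ∑ l, (g l).im • b l with hv
    have h1 : (u : Fin n → ℂ) + Complex.I • (v : Fin n → ℂ) = 0 := by
      rw [← hg, hu, hv]
      simp only [Submodule.coe_sum, Submodule.coe_smul, Finset.smul_sum, ← Finset.sum_add_distrib]
      refine Finset.sum_congr rfl fun l _ => ?_
      funext j
      simp only [Pi.add_apply, Pi.smul_apply, Complex.real_smul, smul_eq_mul]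
      conv_rhs => rw [← Complex.re_add_im (g l)]
      ring
    have h2 : (v : Fin n → ℂ) = 0 := by
      refine hreal _ v.2 ?_
      rw [eq_neg_of_add_eq_zero_right h1]
      exact T.neg_mem u.2
    have h3 : (u : Fin n → ℂ) = 0 := by simpa [h2] using h1
    have h4 := Fintype.linearIndependent_iff.1 b.linearIndependent _ (Subtype.ext h2 : v = 0)
    have h5 := Fintype.linearIndependent_iff.1 b.linearIndependent _ (Subtype.ext h3 : u = 0)
    exact fun l => Complex.ext (h5 l) (h4 l)
  choose a ha r hb using fun l => hdec' (b l) (b l).2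
  obtain ⟨s, hs⟩ := hdw η hη
  set δ : Fin n → ℂ := fun j => ∏ k ∈ Finset.univ.erase j, y k with hδ
  -- The covectors d log yₖ / i for k ≠ j₀, completed below by dw, replace the coordinate covectors.
  -- At `j₀` the entry may be the junk value 0⁻¹, but that column is overwritten.
  set d : Fin n → ℂ := fun k => (Complex.I * y k)⁻¹ with hd
  set R : Matrix (Fin n) (Fin n) ℝ := Matrix.of fun l => Function.update (a l) j₀ (r l) with hR
  have hdwΞ : ∀ a : Fin n → ℝ, ∑ j, a j = 0 → ∑ j, δ j * Ξ a j = 0 := by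
    intro a ha
    have : ∀ j, δ j * Ξ a j = Complex.I * (∏ k, y k) * a j := by
      intro j
      rw [← Finset.prod_erase_mul _ _ (Finset.mem_univ j)]
      change δ j * (Complex.I * (y j * a j)) = _
      ring
    simp only [this, ← Finset.mul_sum]
    rw [← Complex.ofReal_sum, ha]
    simp
  -- Evaluated on the basis, these covectors see the real coefficients `a` and `r`, apart from a
  -- matrix whose determinant is the value of dw on `η`.
  have hmat : (Matrix.of fun l => (b l : Fin n → ℂ)) * (Matrix.diagonal d).updateCol j₀ δ
      = R.map Complex.ofRealHom * (1 : Matrix (Fin n) (Fin n) ℂ).updateRow j₀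
        (Function.update (fun k => η k * d k) j₀ (∑ j, δ j * η j)) := by
    ext l k
    rw [Matrix.mul_apply, Matrix.mul_apply]
    by_cases hk : k = j₀
    · subst hk
      have e1 : ∀ j, (Matrix.of fun l => (b l : Fin n → ℂ)) l j
          * (Matrix.diagonal d).updateCol k δ j k = δ j * Ξ (a l) j + r l * (δ j * η j) := by
        intro j
        rw [Matrix.updateCol_self, Matrix.of_apply, hb]
        simp only [Pi.add_apply, Pi.smul_apply, Complex.real_smul]
        ring
      simp only [e1, Finset.sum_add_distrib, hdwΞ _ (ha l), ← Finset.mul_sum, zero_add]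
      refine Eq.symm ((Finset.sum_eq_single k ?_ ?_).trans ?_)
      · intro j _ hj
        rw [Matrix.updateRow_ne hj, Matrix.one_apply_ne hj, mul_zero]
      · simp
      · simp [hR]
    · have e1 : ∀ j, (Matrix.of fun l => (b l : Fin n → ℂ)) l j
          * (Matrix.diagonal d).updateCol j₀ δ j k = if j = k then (b l : Fin n → ℂ) k * d k else 0 := by
        intro j
        rw [Matrix.updateCol_ne hk, Matrix.of_apply, Matrix.diagonal_apply]
        by_cases hj : j = k
        · subst hj; simp
        · simp [hj]
      have e2 : ∀ j, R.map Complex.ofRealHom l j * (1 : Matrix (Fin n) (Fin n) ℂ).updateRow j₀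
          (Function.update (fun k => η k * d k) j₀ (∑ j, δ j * η j)) j k
          = (if j = j₀ then r l * (η k * d k) else 0) + if j = k then (a l k : ℂ) else 0 := by
        intro j
        by_cases hj : j = j₀
        · subst hj
          simp [hR, hk, Ne.symm hk]
        · rw [Matrix.updateRow_ne hj, Matrix.one_apply]
          by_cases hjk : j = k
          · subst hjk
            simp [hR, hj]
          · simp [hj, hjk]
      simp only [e1, e2, Finset.sum_add_distrib, Finset.sum_ite_eq', Finset.mem_univ, if_true]
      rw [hb]
      have h1 : Ξ (a l) k * d k = a l k := by
        change Complex.I * (y k * a l k) * (Complex.I * y k)⁻¹ = a l k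
        have := hy k hk
        have := Complex.I_ne_zero
        field_simp
      simp only [Pi.add_apply, Pi.smul_apply, Complex.real_smul, add_mul, h1]
      ring
  have h1 := congrArg Matrix.det hmat
  rw [Matrix.det_mul, Matrix.det_mul, det_diagonal_updateCol, det_one_updateRow,
    Function.update_self, hs, ← RingHom.mapMatrix_apply, ← RingHom.map_det] at h1
  have h2 : (∏ k ∈ Finset.univ.erase j₀, d k) * δ j₀ * Complex.I ^ (n - 1) = 1 := by
    have : Complex.I ^ (n - 1) = ∏ _k ∈ Finset.univ.erase j₀, Complex.I := by
      rw [Finset.prod_const, Finset.card_erase_of_mem (Finset.mem_univ _), Finset.card_fin]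
    rw [this, hδ, ← Finset.prod_mul_distrib, ← Finset.prod_mul_distrib]
    refine Finset.prod_eq_one fun k hk => ?_
    have := hy k (Finset.ne_of_mem_erase hk)
    have := Complex.I_ne_zero
    simp only [hd]
    field_simp
  have hn : n - 1 + 1 = n := Nat.sub_add_cancel (Nat.one_le_of_lt j₀.2)
  have h3 : (Matrix.of fun l => (b l : Fin n → ℂ)).det
      = ((R.det * s : ℝ) : ℂ) * (Complex.I ^ n * q) := by
    have e : Complex.I ^ n = Complex.I ^ (n - 1) * Complex.I := by rw [← pow_succ, hn]
    have h4 : Complex.ofRealHom R.det = (R.det : ℂ) := rfl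
    rw [h4] at h1
    rw [e]
    push_cast
    linear_combination Complex.I ^ (n - 1) * h1
      - (Matrix.of fun l => (b l : Fin n → ℂ)).det * h2
  -- Everything real is collected in one factor; it is nonzero because the basis has nonzero
  -- determinant.
  refine ⟨(R.det * s) ^ 2, ?_, ?_⟩
  · have : R.det * s ≠ 0 := by
      intro h0
      rw [h3, h0] at hdet
      simp at hdet
    positivity
  · rw [h3]
    push_cast
    ring

end SmoothFan

/-! ### Tangent spaces of the regular Gross fibres -/

namespace SmoothFan

variable {n m : ℕ} {F : SmoothFan n m} {ν : Fin n → ℤ}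
  {κ : F.ToricManifold → (Fin n → ℂ) [⋀^Fin 2]→L[ℝ] ℝ} {μ₀ : F.ToricManifold → Fin n → ℝ}
  {K₂ : ℝ}

lemma grossDeriv_apply (hμ₀ : F.IsMomentMap κ μ₀) (K₂ : ℝ) {x : F.ToricManifold}
    {D : (Fin n → ℂ) →L[ℝ] ℂ}
    (hD : HasMFDerivAt 𝓘(ℝ, Fin n → ℂ) 𝓘(ℝ, ℂ) (F.character ν) x D) (v : Fin n → ℂ) :
    F.grossDeriv ν μ₀ K₂ x v = ((realLine ν).mkQ
      (mfderiv 𝓘(ℝ, Fin n → ℂ) 𝓘(ℝ, Fin n → ℝ) μ₀ x v : Fin n → ℝ),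
      2 * inner ℝ (F.character ν x - K₂) (D v)) := by
  have h1 : HasMFDerivAt 𝓘(ℝ, Fin n → ℂ) 𝓘(ℝ, Fin n → ℝ) μ₀ x
      (mfderiv 𝓘(ℝ, Fin n → ℂ) 𝓘(ℝ, Fin n → ℝ) μ₀ x) :=
    ((hμ₀.smooth x).mdifferentiableAt (by simp)).hasMFDerivAt
  have hG : ∀ p : (Fin n → ℝ) × ℂ, HasFDerivAt
      (fun p : (Fin n → ℝ) × ℂ => ((((realLine ν).mkQL p.1 : _), ‖p.2 - K₂‖ ^ 2 - K₂ ^ 2) :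
        GrossTarget ν))
      (((realLine ν).mkQL.comp (ContinuousLinearMap.fst ℝ _ _)).prod
        ((2 • (innerSL ℝ (p.2 - K₂))).comp (ContinuousLinearMap.snd ℝ _ _))) p := by
    intro p
    refine HasFDerivAt.prodMk ?_ ?_
    · exact ((realLine ν).mkQL.comp (ContinuousLinearMap.fst ℝ (Fin n → ℝ) ℂ)).hasFDerivAt
    · have := ((hasFDerivAt_snd (𝕜 := ℝ) (p := p)).sub_const (K₂ : ℂ)).norm_sq
      exact this.sub_const _
  have h12 : HasMFDerivAt 𝓘(ℝ, Fin n → ℂ) 𝓘(ℝ, (Fin n → ℝ) × ℂ)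
      (fun x => (μ₀ x, F.character ν x)) x
      ((show (Fin n → ℂ) →L[ℝ] (Fin n → ℝ) from
        mfderiv 𝓘(ℝ, Fin n → ℂ) 𝓘(ℝ, Fin n → ℝ) μ₀ x).prod D) :=
    ⟨h1.1.prodMk hD.1, h1.2.prodMk hD.2⟩
  have h2 := HasMFDerivAt.comp (I' := 𝓘(ℝ, (Fin n → ℝ) × ℂ)) x
    (hG (μ₀ x, F.character ν x)).hasMFDerivAt h12
  have h3 : F.grossDeriv ν μ₀ K₂ x = _ := h2.mfderiv
  rw [h3]
  refine Prod.ext rfl ?_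
  change (2 • (innerSL ℝ (F.character ν x - K₂))) (D v) = _
  simp
  ring

/-- The infinitesimal generator of the torus action with coordinates `a` in the preferred chart. -/
lemma field_extend_mul_I (x : F.ToricManifold) (a : Fin n → ℝ) :
    (F.field x fun i => (F.extend (F.coneAt x) a i : ℝ) * Complex.I)
      = fun j => Complex.I * (F.chart (F.coneAt x) x j * a j) := by
  funext j
  simp only [extend_ofReal_mul_I]
  rw [field_extend]
  ring

lemma IsMomentMap.mfderiv_field (hμ₀ : F.IsMomentMap κ μ₀) (x : F.ToricManifold) (a : Fin m → ℝ) :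
    (mfderiv 𝓘(ℝ, Fin n → ℂ) 𝓘(ℝ, Fin n → ℝ) μ₀ x (F.field x fun i => a i * Complex.I) :
      Fin n → ℝ) = 0 := by
  refine F.eq_zero_of_rayForm (F.coneAt x) fun j => ?_
  have h := hμ₀.deriv_eq_rayForm (Pi.single (F.idx (F.coneAt x) j) 1) x
    (F.field x fun i => a i * Complex.I)
  rw [hμ₀.isotropic x] at h
  rw [Finset.sum_eq_single (F.idx (F.coneAt x) j) (fun i _ hi => by simp [hi]) (by simp)] at h
  simpa using h

/-- The squared determinants of bases of the tangent spaces of the Gross fibres. -/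
lemma exists_det_sq_grossTangent (hν : ∀ i, F.pairing ν i = 1) (hκ : F.IsToricKahlerForm κ)
    (hμ₀ : F.IsMomentMap κ μ₀) {x : F.ToricManifold}
    (hx : Function.Surjective (F.grossDeriv ν μ₀ K₂ x)) :
    F.character ν x ≠ K₂ ∧
    (∃ j₀, ∀ k, k ≠ j₀ → F.chart (F.coneAt x) x k ≠ 0) ∧
    Module.finrank ℝ (F.grossTangent ν μ₀ K₂ x) = n ∧
    ∀ b : Module.Basis (Fin n) ℝ (F.grossTangent ν μ₀ K₂ x), ∃ c : ℝ, 0 < c ∧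
      (Matrix.of fun l => (b l : Fin n → ℂ)).det ^ 2
        = c * ((Complex.I ^ n) ^ 2 * (F.character ν x - K₂) ^ 2) := by
  obtain ⟨D, hD, hDv⟩ := F.exists_hasMFDerivAt_character_nu hν x
  have hg := grossDeriv_apply hμ₀ K₂ hD
  set y := F.chart (F.coneAt x) x with hy
  -- A vector that moves only the second component shows both w ≠ K₂ and dw ≠ 0. As w is the product
  -- of the coordinates, dw ≠ 0 means that at most one of them vanishes.
  obtain ⟨v₁, hv₁⟩ := hx ((0, 1) : GrossTarget ν)
  have hv₂ : 2 * inner ℝ (F.character ν x - K₂) (D v₁) = 1 := by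
    rw [hg] at hv₁
    exact congrArg Prod.snd hv₁
  have hq : F.character ν x - K₂ ≠ 0 := by
    intro h
    rw [h, inner_zero_left] at hv₂
    simp at hv₂
  have hj₀ : ∃ j₀, ∀ k, k ≠ j₀ → y k ≠ 0 := by
    have h1 : D v₁ ≠ 0 := by
      intro h
      rw [h, inner_zero_right] at hv₂
      simp at hv₂
    rw [hDv] at h1
    obtain ⟨j₀, -, h2⟩ := Finset.exists_ne_zero_of_sum_ne_zero h1
    refine ⟨j₀, fun k hk => ?_⟩
    exact Finset.prod_ne_zero_iff.1 (left_ne_zero_of_mul h2) k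
      (Finset.mem_erase.2 ⟨hk, Finset.mem_univ _⟩)
  obtain ⟨j₀, hj⟩ := hj₀
  have hker : ∀ v, v ∈ F.grossTangent ν μ₀ K₂ x ↔ ((realLine ν).mkQ
      (mfderiv 𝓘(ℝ, Fin n → ℂ) 𝓘(ℝ, Fin n → ℝ) μ₀ x v : Fin n → ℝ) = 0 ∧
      inner ℝ (F.character ν x - K₂) (D v) = 0) := by
    intro v
    rw [grossTangent, LinearMap.mem_ker]
    change F.grossDeriv ν μ₀ K₂ x v = 0 ↔ _
    rw [hg, Prod.mk_eq_zero]
    simp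
  have hfin : Module.finrank ℝ (F.grossTangent ν μ₀ K₂ x) = n := by
    -- The count is 2n - (n - 1) - 1 = n, using ν ≠ 0.
    have h1 := LinearMap.finrank_range_add_finrank_ker
      (F.grossDeriv ν μ₀ K₂ x : (Fin n → ℂ) →ₗ[ℝ] GrossTarget ν)
    rw [LinearMap.range_eq_top.2 hx, finrank_top, Module.finrank_prod, Module.finrank_self,
      Module.finrank_pi_fintype] at h1
    simp only [Complex.finrank_real_complex, Finset.sum_const, Finset.card_univ, Fintype.card_fin,
      smul_eq_mul] at h1
    have h2 := Submodule.finrank_quotient_add_finrank (realLine ν)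
    have hne : (fun k => (ν k : ℝ)) ≠ 0 := by
      intro h
      have h3 := F.rayForm_intCast (F.idx (F.coneAt x) j₀) ν
      rw [h, hν] at h3
      simp at h3
    rw [finrank_span_singleton hne, Module.finrank_fin_fun] at h2
    change _ + Module.finrank ℝ (F.grossTangent ν μ₀ K₂ x) = _ at h1
    omega
  refine ⟨sub_ne_zero.1 hq, ⟨j₀, hj⟩, hfin, fun b => ?_⟩
  refine det_sq_of_lagrangian y j₀ hj _ hfin ?_ ?_ (κ x) (fun v hv => hκ.positive x v hv) ?_ b
  · intro a ha
    rw [← field_extend_mul_I]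
    refine (hker _).2 ⟨?_, ?_⟩
    · rw [hμ₀.mfderiv_field]
      exact map_zero _
    · rw [field_extend_mul_I, hDv]
      have : ∀ j, (∏ k ∈ Finset.univ.erase j, y k) * (Complex.I * (y j * a j))
          = Complex.I * (∏ k, y k) * a j := by
        intro j
        rw [← Finset.prod_erase_mul _ _ (Finset.mem_univ j)]
        ring
      simp only [← hy, this, ← Finset.mul_sum]
      rw [← Complex.ofReal_sum, ha]
      simp
  · intro v hv
    have h1 := ((hker v).1 hv).2
    rw [hDv] at h1
    set d := ∑ j, (∏ k ∈ Finset.univ.erase j, y k) * v j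
    set q := F.character ν x - K₂
    -- On the fibre dw(v) is orthogonal to q = w - K₂, hence a real multiple of iq.
    refine ⟨(d / (Complex.I * q)).re, ?_⟩
    have h2 : (d / (Complex.I * q)).im = 0 := by
      have h3 : q.re * d.re + q.im * d.im = 0 := by
        have := h1
        rw [Complex.inner] at this
        simp at this
        linarith
      rw [Complex.div_im]
      simp
      rw [← sub_div]
      apply div_eq_zero_iff.2
      left
      linarith
    have h4 : (((d / (Complex.I * q)).re : ℝ) : ℂ) = d / (Complex.I * q) :=
      Complex.ext (by simp) (by simp [h2])
    rw [h4]
    have := Complex.I_ne_zero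
    field_simp
  · intro v hv a ha
    rw [← field_extend_mul_I]
    rw [← hμ₀.deriv_eq_rayForm]
    -- Tangent vectors change all moment components by the same amount, which pairs to zero with a
    -- zero-sum vector.
    obtain ⟨c, hc⟩ := (F.mkQ_eq_iff hν (F.coneAt x) _ 0).1
      (((hker v).1 hv).1.trans (map_zero (realLine ν).mkQ).symm)
    simp only [mul_comm (F.extend (F.coneAt x) a _), sum_extend, hc]
    simp [← Finset.mul_sum, ha]

end SmoothFan

/-! ### Maslov indices and Chern numbers as winding numbers -/

lemma det_of_sum_smul {n : ℕ} (A : Matrix (Fin n) (Fin n) ℂ) (b e : Fin n → Fin n → ℂ)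
    (h : ∀ l, b l = ∑ j, A j l • e j) :
    (Matrix.of b).det = A.det * (Matrix.of e).det := by
  have : Matrix.of b = A.transpose * Matrix.of e := by
    ext l k
    rw [Matrix.of_apply, h, Matrix.mul_apply]
    simp
  rw [this, Matrix.det_mul, Matrix.det_transpose]

lemma exp_mul_I_mem_closedBall (θ : ℝ) :
    Complex.exp (θ * Complex.I) ∈ Metric.closedBall (0 : ℂ) 1 := by
  simp [Complex.norm_exp_ofReal_mul_I]

lemma exp_mul_I_mem_sphere (θ : ℝ) :
    Complex.exp (θ * Complex.I) ∈ Metric.sphere (0 : ℂ) 1 := by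
  simp [Complex.norm_exp_ofReal_mul_I]

namespace SmoothFan

variable {n m : ℕ} {F : SmoothFan n m} {ν : Fin n → ℤ}
  {κ : F.ToricManifold → (Fin n → ℂ) [⋀^Fin 2]→L[ℝ] ℝ} {μ₀ : F.ToricManifold → Fin n → ℝ}
  {K₂ : ℝ}

/-- The Maslov index of a disk is the winding number of `(w - K₂)²` along its boundary. -/
lemma hasWinding_of_hasDiskMaslovIndex (hν : ∀ i, F.pairing ν i = 1)
    (hκ : F.IsToricKahlerForm κ) (hμ₀ : F.IsMomentMap κ μ₀) {f : ℂ → F.ToricManifold}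
    (hf : ∀ z ∈ Metric.sphere (0 : ℂ) 1, Function.Surjective (F.grossDeriv ν μ₀ K₂ (f z))) {k : ℤ}
    (hk : HasDiskMaslovIndex (F.grossTangent ν μ₀ K₂) f k) :
    HasWinding (fun θ => (F.character ν (f (Complex.exp (θ * Complex.I))) - K₂) ^ 2) k := by
  obtain ⟨e, he, A, hb, hA⟩ := hk
  choose b hb using hb
  choose c hc hdet using fun θ : ℝ => (exists_det_sq_grossTangent hν hκ hμ₀
    (hf _ (exp_mul_I_mem_sphere θ))).2.2.2 (b θ)
  have hI : ((Complex.I ^ n) ^ 2 : ℂ) ≠ 0 := pow_ne_zero _ (pow_ne_zero _ Complex.I_ne_zero)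
  -- The determinant of the tangent basis is det A times that of the frame. The latter contributes
  -- no winding, since its square extends over the disk without zeros.
  have h := ((HasWinding.const (inv_ne_zero hI)).mul (hA.mul (F.hasWinding_det_sq hν he))).pos_mul
    fun θ => inv_pos.2 (hc θ)
  rw [add_zero, zero_add] at h
  convert h using 2 with θ
  have h1 := det_of_sum_smul (A θ) _ _ (hb θ)
  rw [← mul_pow, ← h1, hdet θ]
  have := Complex.ofReal_ne_zero.2 (hc θ).ne'
  push_cast
  field_simp

/-- The bases of the tangent spaces may be chosen without any continuity in θ: a change of real
basis affects the squared determinant only by a positive factor, and winding ignores the modulus. -/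
lemma hasDiskMaslovIndex_of_hasWinding (hν : ∀ i, F.pairing ν i = 1)
    (hκ : F.IsToricKahlerForm κ) (hμ₀ : F.IsMomentMap κ μ₀) {f : ℂ → F.ToricManifold}
    (hf : ∀ z ∈ Metric.sphere (0 : ℂ) 1, Function.Surjective (F.grossDeriv ν μ₀ K₂ (f z)))
    {e : Fin n → ℂ → Fin n → ℂ} (he : IsFrame f e) {k : ℤ}
    (hk : HasWinding (fun θ => F.character ν (f (Complex.exp (θ * Complex.I))) - K₂) k) :
    HasDiskMaslovIndex (F.grossTangent ν μ₀ K₂) f (2 * k) := by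
  have hT := fun θ : ℝ => exists_det_sq_grossTangent hν hκ hμ₀ (hf _ (exp_mul_I_mem_sphere θ))
  let b := fun θ : ℝ => Module.finBasisOfFinrankEq ℝ _ (hT θ).2.2.1
  choose c hc hdet using fun θ : ℝ => (hT θ).2.2.2 (b θ)
  let E := fun θ : ℝ => Matrix.of fun j => e j (Complex.exp (θ * Complex.I))
  have hE : ∀ θ, (E θ).det ≠ 0 := fun θ =>
    ne_zero_of_linearIndependent (he.linearIndependent _ (exp_mul_I_mem_closedBall θ))
  let A := fun θ : ℝ => ((Matrix.of fun l => (b θ l : Fin n → ℂ)) * (E θ)⁻¹).transpose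
  have hA : ∀ θ l, (b θ l : Fin n → ℂ) = ∑ j, A θ j l • e j (Complex.exp (θ * Complex.I)) := by
    intro θ l
    have h1 : (Matrix.of fun l => (b θ l : Fin n → ℂ)) = (A θ).transpose * E θ := by
      simp only [A]
      rw [Matrix.transpose_transpose, Matrix.mul_assoc, Matrix.nonsing_inv_mul _ (hE θ).isUnit,
        Matrix.mul_one]
    funext i
    have h2 := congrFun (congrFun h1 l) i
    rw [Matrix.mul_apply] at h2
    rw [Matrix.of_apply] at h2
    rw [h2]
    simp [E]
  refine ⟨e, he, A, fun θ => ⟨b θ, hA θ⟩, ?_⟩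
  have hI : ((Complex.I ^ n) ^ 2 : ℂ) ≠ 0 := pow_ne_zero _ (pow_ne_zero _ Complex.I_ne_zero)
  have h := (((HasWinding.const hI).mul hk.sq).mul (F.hasWinding_det_sq hν he).inv).pos_mul hc
  rw [neg_zero, add_zero, zero_add] at h
  convert h using 2 with θ
  have h1 := det_of_sum_smul (A θ) _ _ (hA θ)
  have h2 := hdet θ
  rw [h1] at h2
  have h3 := hE θ
  change _ = _ * (_ * ((E θ).det ^ 2)⁻¹)
  change ((A θ).det * (E θ).det) ^ 2 = _ at h2
  field_simp
  linear_combination h2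

/-- Holomorphic spheres in a toric Calabi-Yau manifold have Chern number zero. -/
lemma hasChernNumber_eq_zero (hν : ∀ i, F.pairing ν i = 1) {f : OnePoint ℂ → F.ToricManifold}
    {k : ℤ} (hk : HasChernNumber (n := n) f k) : k = 0 := by
  obtain ⟨e, e', he, he', A, hA, hw⟩ := hk
  have h1 : HasWinding (fun θ : ℝ =>
      (Matrix.of fun j => e' j (Complex.exp (-(θ * Complex.I)))).det ^ 2) 0 := by
    -- The second frame is traversed along e^{-iθ}; precomposing with conjugation turns this into
    -- the standard boundary of a disk.
    have hconj : Set.MapsTo (starRingEnd ℂ) (Metric.closedBall (0 : ℂ) 1)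
        (Metric.closedBall (0 : ℂ) 1) := by
      intro z hz
      simpa using hz
    have h := HasWinding.of_continuousOn_closedBall
      ((F.continuousOn_det_sq hν he').comp Complex.continuous_conj.continuousOn hconj)
      (fun z hz => pow_ne_zero 2
        (ne_zero_of_linearIndependent (he'.linearIndependent _ (hconj hz))))
    convert h using 2 with θ
    simp [← Complex.exp_conj]
  have h2 := hw.sq.mul (F.hasWinding_det_sq hν he)
  have h3 := h2.unique (k' := 0) (by
    convert h1 using 2 with θ
    rw [det_of_sum_smul (A θ) _ _ (hA θ), mul_pow])
  omega

end SmoothFan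

/-! ### Rigidity of disks, spheres and trees of components -/

lemma coe_mem_componentDomain (p : Prop) {z : ℂ} (hz : ‖z‖ ≤ 1) :
    (z : OnePoint ℂ) ∈ componentDomain p := fun _ => ⟨z, hz, rfl⟩

section

variable {n : ℕ} {X : Type} [TopologicalSpace X] [ChartedSpace (Fin n → ℂ) X]

/-- A function that is holomorphic near the image of a disk and has constant modulus on its
boundary has a nonnegative winding number, and is constant if this number is zero. -/
lemma IsHolomorphicDisk.exists_hasWinding {L : Set X} {f : ℂ → X} (hf : IsHolomorphicDisk n L f)
    {U : Set X} (hfU : Set.MapsTo f (Metric.closedBall 0 1) U) {φ : X → ℂ}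
    (hφ : ContMDiffOn 𝓘(ℝ, Fin n → ℂ) 𝓘(ℝ, ℂ) ∞ φ U)
    (hφ' : MDifferentiableOn 𝓘(ℂ, Fin n → ℂ) 𝓘(ℂ, ℂ) φ U) (c : ℂ) {ρ : ℝ} (hρ : 0 < ρ)
    (hb : ∀ z ∈ Metric.sphere (0 : ℂ) 1, ‖φ (f z) - c‖ = ρ) :
    ∃ k : ℕ, HasWinding (fun θ => φ (f (Complex.exp (θ * Complex.I))) - c) k ∧
      (k = 0 → ∀ z ∈ Metric.closedBall (0 : ℂ) 1, φ (f z) = φ (f 1)) := by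
  have h1 : ContDiffOn ℝ ∞ (fun z => φ (f z) - c) (Metric.closedBall 0 1) :=
    (contMDiffOn_iff_contDiffOn.1 (hφ.comp hf.smooth hfU)).sub contDiffOn_const
  have h2 : DifferentiableOn ℂ (fun z => φ (f z) - c) (Metric.ball 0 1) :=
    (mdifferentiableOn_iff_differentiableOn.1 (hφ'.comp hf.holomorphic
      (hfU.mono_left Metric.ball_subset_closedBall))).sub_const c
  obtain ⟨k, hk, h⟩ := exists_hasWinding_of_norm_eq hρ h1 h2 hb
  exact ⟨k, hk, fun h0 z hz => sub_left_injective (h h0 z hz)⟩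

/-- Liouville's theorem for holomorphic spheres. -/
lemma IsHolomorphicSphere.eq {f : OnePoint ℂ → X} (hf : IsHolomorphicSphere n f)
    {U : Set X} (hU : IsOpen U) (hfU : ∀ p, f p ∈ U) {φ : X → ℂ}
    (hφ : MDifferentiableOn 𝓘(ℂ, Fin n → ℂ) 𝓘(ℂ, ℂ) φ U) (p : OnePoint ℂ) :
    φ (f p) = φ (f OnePoint.infty) := by
  have h1 : Differentiable ℂ fun z : ℂ => φ (f z) := by
    rw [← mdifferentiable_iff_differentiable]
    intro z
    exact ((hφ _ (hfU z)).mdifferentiableAt (hU.mem_nhds (hfU z))).comp z (hf.finite z)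
  have h2 : ContinuousAt (fun z => φ (atInfinity f z)) 0 := by
    have h0 : atInfinity f 0 ∈ U := by simp [atInfinity, hfU]
    exact ContinuousAt.comp
      ((hφ _ h0).mdifferentiableAt (hU.mem_nhds h0)).continuousAt (hf.infinite 0).continuousAt
  have h3 : Filter.Tendsto (fun z : ℂ => φ (f z)) (Filter.cocompact ℂ)
      (nhds (φ (f OnePoint.infty))) := by
    have h4 : φ (f OnePoint.infty) = φ (atInfinity f 0) := by simp [atInfinity]
    rw [h4, ← Metric.cobounded_eq_cocompact]
    refine (h2.tendsto.comp Filter.tendsto_inv₀_cobounded).congr' ?_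
    have : ∀ᶠ z : ℂ in Bornology.cobounded ℂ, z ≠ 0 := Bornology.eventually_ne_cobounded 0
    filter_upwards [this] with z hz
    simp [atInfinity, hz]
  induction p using OnePoint.rec with
  | infty => rfl
  | coe z => exact h1.apply_eq_of_tendsto_cocompact z h3

/-- A function that is constant on each component of a stable disk is constant. -/
lemma StableDisk.exists_eq {L : Set X} {k : ℕ} (u : StableDisk n L k) {Y : Type} (g : X → Y)
    (h : ∀ a, ∃ y, ∀ p ∈ componentDomain (a ∈ u.disks), g (u.map a p) = y) :
    ∃ y, ∀ a, ∀ p ∈ componentDomain (a ∈ u.disks), g (u.map a p) = y := by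
  choose y hy using h
  have hnode : ∀ a b, u.graph.Adj a b → u.node a b ∈ componentDomain (a ∈ u.disks) := by
    intro a b hab ha
    by_cases hb : b ∈ u.disks
    · obtain ⟨z, hz, h⟩ := u.node_boundary a b hab ha hb
      exact ⟨z, hz.le, h⟩
    · obtain ⟨z, hz, h⟩ := u.node_interior a b hab ha hb
      exact ⟨z, hz.le, h⟩
  -- Adjacent components share the value at their node, which lies in both domains.
  have hadj : ∀ a b, u.graph.Adj a b → y a = y b := by
    intro a b hab
    rw [← hy a _ (hnode a b hab), ← hy b _ (hnode b a hab.symm), u.node_map a b hab]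
  obtain ⟨a₀⟩ := u.isTree.1.nonempty
  have hwalk : ∀ a b, u.graph.Walk a b → y a = y b := by
    intro a b W
    induction W with
    | nil => rfl
    | cons hab _ ih => exact (hadj _ _ hab).trans ih
  refine ⟨y a₀, fun a p hp => ?_⟩
  obtain ⟨W⟩ := u.isTree.1.preconnected a a₀
  rw [hy a p hp, hwalk a a₀ W]

end

/-! ### Indices of stable disks bounded by regular fibres -/

namespace SmoothFan

variable {n m : ℕ} {F : SmoothFan n m} {ν : Fin n → ℤ}
  {κ : F.ToricManifold → (Fin n → ℂ) [⋀^Fin 2]→L[ℝ] ℝ} {μ₀ : F.ToricManifold → Fin n → ℝ}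
  {K₂ : ℝ} {r : GrossTarget ν}

lemma surjective_grossDeriv (hr : r ∈ F.grossRegular ν μ₀ K₂) {x : F.ToricManifold}
    (hx : x ∈ F.grossFiber ν μ₀ K₂ r) : Function.Surjective (F.grossDeriv ν μ₀ K₂ x) := by
  by_contra h
  exact hr.2 ⟨x, hx, h⟩

lemma mem_grossFiber {x : F.ToricManifold} : x ∈ F.grossFiber ν μ₀ K₂ r ↔
    (realLine ν).mkQ (μ₀ x) = r.1 ∧ ‖F.character ν x - K₂‖ ^ 2 - K₂ ^ 2 = r.2 :=
  Prod.ext_iff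

/-- The Maslov index of a holomorphic disk is twice a natural number; if it is zero, the function
`w` is constant on the disk. -/
lemma exists_index_eq (hν : ∀ i, F.pairing ν i = 1) (hκ : F.IsToricKahlerForm κ)
    (hμ₀ : F.IsMomentMap κ μ₀) (hr : r ∈ F.grossRegular ν μ₀ K₂) {f : ℂ → F.ToricManifold}
    (hf : IsHolomorphicDisk n (F.grossFiber ν μ₀ K₂ r) f) {k : ℤ}
    (hk : HasDiskMaslovIndex (F.grossTangent ν μ₀ K₂) f k) :
    ∃ N : ℕ, k = 2 * N ∧
      (N = 0 → ∀ z ∈ Metric.closedBall (0 : ℂ) 1, F.character ν (f z) = F.character ν (f 1)) := by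
  have hs := fun z hz => surjective_grossDeriv hr (hf.boundary z hz)
  have h1 : (1 : ℂ) ∈ Metric.sphere (0 : ℂ) 1 := by simp
  have hρ : 0 < ‖F.character ν (f 1) - K₂‖ :=
    norm_pos_iff.2 (sub_ne_zero.2 (exists_det_sq_grossTangent hν hκ hμ₀ (hs 1 h1)).1)
  obtain ⟨N, hN, h⟩ := hf.exists_hasWinding (Set.mapsTo_univ _ _)
    (F.contMDiff_character_nu hν ℝ).contMDiffOn
    ((F.contMDiff_character_nu hν ℂ).mdifferentiable (by simp)).mdifferentiableOn K₂ hρ (by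
      intro z hz
      have e1 := (mem_grossFiber.1 (hf.boundary z hz)).2
      have e2 := (mem_grossFiber.1 (hf.boundary 1 h1)).2
      have e3 : ‖F.character ν (f z) - K₂‖ ^ 2 = ‖F.character ν (f 1) - K₂‖ ^ 2 := by linarith
      exact (pow_left_inj₀ (norm_nonneg _) (norm_nonneg _) two_ne_zero).1 e3)
  refine ⟨N, ?_, h⟩
  exact (hasWinding_of_hasDiskMaslovIndex hν hκ hμ₀ hs hk).unique hN.sq

/-- Spheres contribute zero and disks nonnegative even numbers, so a zero total forces every term to
vanish. Then w is constant on each disk by rigidity, on each sphere by Liouville, and on the tree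
through the nodes. -/
lemma exists_stable_index_eq (hν : ∀ i, F.pairing ν i = 1) (hκ : F.IsToricKahlerForm κ)
    (hμ₀ : F.IsMomentMap κ μ₀) (hr : r ∈ F.grossRegular ν μ₀ K₂) {k : ℕ}
    (u : StableDisk n (F.grossFiber ν μ₀ K₂ r) k) {d : ℤ}
    (hd : u.HasMaslovIndex (F.grossTangent ν μ₀ K₂) d) :
    ∃ N : ℕ, d = 2 * N ∧ (N = 0 → ∃ w₀, ∀ a, ∀ p ∈ componentDomain (a ∈ u.disks),
      F.character ν (u.map a p) = w₀) := by
  classical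
  obtain ⟨ind, h1, h2, h3⟩ := hd
  have h4 : ∀ a, ∃ N : ℕ, (if a ∈ u.disks then ind a else 2 * ind a) = 2 * (N : ℤ) ∧
      (N = 0 → ∃ y, ∀ p ∈ componentDomain (a ∈ u.disks), F.character ν (u.map a p) = y) := by
    intro a
    by_cases ha : a ∈ u.disks
    · obtain ⟨N, hN, h⟩ := exists_index_eq hν hκ hμ₀ hr (u.disk_holomorphic a ha) (h1 a ha)
      refine ⟨N, by rw [if_pos ha, hN], fun h0 =>
        ⟨F.character ν (u.map a (1 : ℂ)), fun p hp => ?_⟩⟩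
      obtain ⟨z, hz, rfl⟩ := hp ha
      exact h h0 z (by simpa using hz)
    · refine ⟨0, by rw [if_neg ha, hasChernNumber_eq_zero hν (h2 a ha)]; simp, fun _ => ⟨_, fun p _ =>
        (u.sphere_holomorphic a ha).eq isOpen_univ (fun _ => Set.mem_univ _)
        ((F.contMDiff_character_nu hν ℂ).mdifferentiable (by simp)).mdifferentiableOn p⟩⟩
  choose N hN hc using h4
  refine ⟨∑ a, N a, ?_, fun h0 => u.exists_eq _ fun a => hc a ?_⟩
  · rw [h3]
    push_cast
    rw [Finset.mul_sum]
    exact Finset.sum_congr rfl fun a _ => by convert hN a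
  · exact Finset.sum_eq_zero_iff.1 h0 a (Finset.mem_univ a)

lemma contMDiffOn_chart_apply (F : SmoothFan n m) (σ : F.MaxCone) (j : Fin n) (𝕜 : Type)
    [NontriviallyNormedField 𝕜] [NormedAlgebra 𝕜 ℂ]
    [IsManifold 𝓘(𝕜, Fin n → ℂ) ∞ F.ToricManifold] :
    ContMDiffOn 𝓘(𝕜, Fin n → ℂ) 𝓘(𝕜, ℂ) ∞ (fun x => F.chart σ x j) (F.chartSource σ) := by
  have h : ContMDiffOn 𝓘(𝕜, Fin n → ℂ) 𝓘(𝕜, Fin n → ℂ) ∞ (F.chart σ) (F.chartSource σ) :=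
    contMDiffOn_of_mem_maximalAtlas (IsManifold.subset_maximalAtlas ⟨σ, rfl⟩)
  exact (ContinuousLinearMap.contMDiff
    (ContinuousLinearMap.proj j : (Fin n → ℂ) →L[𝕜] ℂ)).comp_contMDiffOn h

/-- A stable disk on which `w` is a nonzero constant is constant. -/
lemma not_nonconstant_of_character_eq (hν : ∀ i, F.pairing ν i = 1) [NeZero n]
    (hκ : F.IsToricKahlerForm κ)
    (hμ₀ : F.IsMomentMap κ μ₀) {k : ℕ} (u : StableDisk n (F.grossFiber ν μ₀ K₂ r) k)
    {w₀ : ℂ} (hw₀ : w₀ ≠ 0) (hw : ∀ a, ∀ p ∈ componentDomain (a ∈ u.disks),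
      F.character ν (u.map a p) = w₀) : ¬ u.Nonconstant := by
  obtain ⟨σ⟩ := F.nonempty_maxCone
  obtain ⟨a₀, ha₀⟩ := u.disks_connected.nonempty
  have h1 : (1 : ℂ) ∈ Metric.sphere (0 : ℂ) 1 := by simp
  set x₁ := u.map a₀ (1 : ℂ) with hx₁
  have hx₁w : F.character ν x₁ = w₀ := hw a₀ _ (coe_mem_componentDomain _ (by simp))
  have hx₁r : (realLine ν).mkQ (μ₀ x₁) = r.1 :=
    (mem_grossFiber.1 ((u.disk_holomorphic a₀ ha₀).boundary 1 h1)).1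
  obtain ⟨T, -, -, hT⟩ := exists_moduli hν hκ hμ₀ σ (hx₁w ▸ hw₀) (rfl :
    (realLine ν).mkQ (μ₀ x₁) = (realLine ν).mkQ (μ₀ x₁))
  have hsrc : ∀ a, ∀ p ∈ componentDomain (a ∈ u.disks), u.map a p ∈ F.chartSource σ :=
    fun a p hp => F.mem_chartSource_of_character_ne_zero hν ((hw a p hp).symm ▸ hw₀) σ
  have hne : ∀ a, ∀ p ∈ componentDomain (a ∈ u.disks), ∀ j, F.chart σ (u.map a p) j ≠ 0 := by
    intro a p hp j
    have h := hw a p hp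
    rw [F.character_nu_eq_prod hν σ (hsrc a p hp)] at h
    exact Finset.prod_ne_zero_iff.1 (h.symm ▸ hw₀) j (Finset.mem_univ j)
  have hcomp : ∀ a j, ∃ y, ∀ p ∈ componentDomain (a ∈ u.disks), F.chart σ (u.map a p) j = y := by
    intro a j
    by_cases ha : a ∈ u.disks
    · refine ⟨F.chart σ (u.map a (1 : ℂ)) j, fun p hp => ?_⟩
      obtain ⟨z, hz, rfl⟩ := hp ha
      have hfU : Set.MapsTo (fun z : ℂ => u.map a z) (Metric.closedBall 0 1) (F.chartSource σ) :=
        fun z hz => hsrc a _ (coe_mem_componentDomain _ (by simpa using hz))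
      have hD := u.disk_holomorphic a ha
      have hsm := F.contMDiffOn_chart_apply σ j ℝ
      -- With |w| fixed, the boundary condition fixes the modulus of each coordinate on the circle.
      obtain ⟨k, hk, h⟩ := hD.exists_hasWinding hfU hsm
        ((F.contMDiffOn_chart_apply σ j ℂ).mdifferentiableOn (by simp)) 0
        (Real.exp_pos (T (Real.log ‖w₀‖) j)) (by
          intro z hz
          have hz' : (z : OnePoint ℂ) ∈ componentDomain (a ∈ u.disks) :=
            coe_mem_componentDomain _ (by simpa using (mem_sphere_zero_iff_norm.1 hz).le)
          have e1 := (mem_grossFiber.1 (hD.boundary z hz)).1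
          have e2 := (hT _ ((hw a _ hz').symm ▸ hw₀)).1 (e1.trans hx₁r.symm) j
          rw [hw a _ hz'] at e2
          rw [sub_zero, ← e2, Real.exp_log (norm_pos_iff.2 (hne a _ hz' j))])
      refine h ?_ z (by simpa using hz)
      simp only [sub_zero] at hk
      -- The coordinate has no zeros in the disk, so its winding number is zero.
      have h0 := HasWinding.of_continuousOn_closedBall
        (D := fun z : ℂ => F.chart σ (u.map a z) j)
        (hsm.continuousOn.comp hD.smooth.continuousOn hfU)
        (fun z hz => hne a _ (coe_mem_componentDomain _ (by simpa using hz)) j)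
      exact_mod_cast hk.unique h0
    · refine ⟨_, fun p _ => (u.sphere_holomorphic a ha).eq (F.isOpen_chartSource σ)
        (fun p => hsrc a p fun h => absurd h ha)
        ((F.contMDiffOn_chart_apply σ j ℂ).mdifferentiableOn (by simp)) p⟩
  obtain ⟨y, hy⟩ := u.exists_eq (F.chart σ) fun a => by
    choose y hy using hcomp a
    exact ⟨y, fun p hp => funext fun j => hy j p hp⟩
  refine not_not.2 ⟨(F.chart σ).symm y, fun a p hp => ?_⟩
  rw [← hy a p hp, F.chart_symm_apply σ (hsrc a p hp)]

end SmoothFan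

/-! ### Construction of disks of index zero and two -/

section

variable {n : ℕ} {X : Type} [TopologicalSpace X] [ChartedSpace (Fin n → ℂ) X]
  [IsManifold 𝓘(ℂ, Fin n → ℂ) 1 X]

/-- A nonconstant holomorphic disk is a stable disk. -/
lemma IsHolomorphicDisk.exists_stableDisk {L : Set X} {f : ℂ → X} (hf : IsHolomorphicDisk n L f)
    (hc : f 0 ≠ f 1) {TL : X → Submodule ℝ (Fin n → ℂ)} {d : ℤ} (hd : HasDiskMaslovIndex TL f d) :
    ∃ u : StableDisk n L 0, u.Nonconstant ∧ u.HasMaslovIndex TL d := by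
  let u : StableDisk n L 0 :=
    { size := 1
      graph := ⊥
      isTree := SimpleGraph.IsTree.of_subsingleton
      disks := Set.univ
      disks_connected := by
        have : Nonempty (Set.univ : Set (Fin 1)) := ⟨⟨0, trivial⟩⟩
        exact ⟨SimpleGraph.Preconnected.of_subsingleton⟩
      -- The value at infinity is irrelevant for a disk component.
      map := fun _ p => p.elim (f 0) f
      disk_holomorphic := fun _ _ => hf
      sphere_holomorphic := fun a ha => absurd (Set.mem_univ a) ha
      node := fun _ _ => OnePoint.infty
      node_boundary := fun _ _ h => h.elim
      node_interior := fun _ _ h => h.elim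
      node_injective := fun _ _ _ h => h.elim
      node_map := fun _ _ h => h.elim
      markComponent := Fin.elim0
      markComponent_mem := fun i => i.elim0
      mark := Fin.elim0
      mark_boundary := fun i => i.elim0
      mark_injective := fun i => i.elim0
      mark_ne_node := fun i => i.elim0
      stable := fun a ⟨x, hx⟩ => absurd ((hx _ (coe_mem_componentDomain _ (by simp))).trans
        (hx _ (coe_mem_componentDomain _ (z := 1) (by simp))).symm) hc }
  refine ⟨u, ?_, fun _ => d, fun _ _ => hd, fun a ha => absurd (Set.mem_univ a) ha, ?_⟩
  · rintro ⟨x, hx⟩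
    exact hc ((hx 0 _ (coe_mem_componentDomain _ (z := 0) (by simp))).trans
      (hx 0 _ (coe_mem_componentDomain _ (z := 1) (by simp))).symm)
  · simp [u]

end

namespace SmoothFan

variable {n m : ℕ} {F : SmoothFan n m} {ν : Fin n → ℤ}
  {κ : F.ToricManifold → (Fin n → ℂ) [⋀^Fin 2]→L[ℝ] ℝ} {μ₀ : F.ToricManifold → Fin n → ℝ}
  {K₂ : ℝ} {r : GrossTarget ν}

/-- Disks in an affine chart. -/
lemma isHolomorphicDisk_chart_symm (σ : F.MaxCone) {Y : ℂ → Fin n → ℂ}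
    (hY : ContDiffOn ℂ ∞ Y (Metric.closedBall 0 1)) {L : Set F.ToricManifold}
    (hL : ∀ z ∈ Metric.sphere (0 : ℂ) 1, (F.chart σ).symm (Y z) ∈ L) :
    IsHolomorphicDisk n L fun z => (F.chart σ).symm (Y z) where
  smooth := (F.contMDiff_chart_symm σ).comp_contMDiffOn
    (contMDiffOn_iff_contDiffOn.2 (hY.restrict_scalars ℝ))
  holomorphic := by
    have h : ContMDiffOn 𝓘(ℂ, Fin n → ℂ) 𝓘(ℂ, Fin n → ℂ) ∞ (F.chart σ).symm Set.univ :=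
      contMDiffOn_symm_of_mem_maximalAtlas (IsManifold.subset_maximalAtlas ⟨σ, rfl⟩)
    exact ((contMDiffOn_univ.1 h).mdifferentiable (by simp)).comp_mdifferentiableOn
      (mdifferentiableOn_iff_differentiableOn.2
        ((hY.differentiableOn (by simp)).mono Metric.ball_subset_closedBall))
  boundary := hL

/-- A chart has all of ℂⁿ as target, so a disk is just a tuple of functions. It carries the
coordinate frame, and w is their product. -/
lemma exists_stableDisk_of_hasWinding (hν : ∀ i, F.pairing ν i = 1) (hκ : F.IsToricKahlerForm κ)
    (hμ₀ : F.IsMomentMap κ μ₀) (hr : r ∈ F.grossRegular ν μ₀ K₂) (σ : F.MaxCone)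
    {Y : ℂ → Fin n → ℂ} (hY : ContDiffOn ℂ ∞ Y (Metric.closedBall 0 1))
    (hL : ∀ z ∈ Metric.sphere (0 : ℂ) 1, (F.chart σ).symm (Y z) ∈ F.grossFiber ν μ₀ K₂ r)
    (hc : Y 0 ≠ Y 1) {k : ℤ}
    (hk : HasWinding (fun θ => ∏ j, Y (Complex.exp (θ * Complex.I)) j - K₂) k) :
    ∃ u : StableDisk n (F.grossFiber ν μ₀ K₂ r) 0, u.Nonconstant ∧
      u.HasMaslovIndex (F.grossTangent ν μ₀ K₂) (2 * k) := by
  refine (isHolomorphicDisk_chart_symm σ hY hL).exists_stableDisk ?_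
    (hasDiskMaslovIndex_of_hasWinding hν hκ hμ₀ (fun z hz => surjective_grossDeriv hr (hL z hz))
      (F.isFrame_chart σ hY.continuousOn) ?_)
  · intro h
    have h1 := congrArg (F.chart σ) h
    rw [F.chart_apply_symm, F.chart_apply_symm] at h1
    exact hc h1
  · simpa only [F.character_nu_chart_symm hν] using hk

/-- The fibres over the wall bound disks of index zero in toric divisors. -/
lemma exists_stableDisk_index_zero (hn : 2 ≤ n) (hν : ∀ i, F.pairing ν i = 1)
    (hκ : F.IsToricKahlerForm κ) (hμ₀ : F.IsMomentMap κ μ₀) {c : Fin m → ℝ}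
    (hP : Set.range μ₀ = F.polyhedron c) (hK₂ : 0 < K₂) (hr : r ∈ F.grossRegular ν μ₀ K₂)
    (hr₂ : r.2 = 0) :
    ∃ u : StableDisk n (F.grossFiber ν μ₀ K₂ r) 0, u.Nonconstant ∧
      u.HasMaslovIndex (F.grossTangent ν μ₀ K₂) 0 := by
  obtain ⟨ξ, hξ⟩ := (realLine ν).mkQ_surjective r.1
  obtain ⟨σ₀⟩ := F.nonempty_maxCone
  have : Nonempty (Fin m) := ⟨F.idx σ₀ ⟨0, by omega⟩⟩
  obtain ⟨x, hx, hxξ⟩ := exists_moment_eq_of_character_eq_zero hν hκ hμ₀ hP ξ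
  have hxr : x ∈ F.grossFiber ν μ₀ K₂ r := mem_grossFiber.2 ⟨hxξ.trans hξ, by simp [hx, hr₂]⟩
  obtain ⟨-, ⟨j₀, hj₀⟩, -⟩ := exists_det_sq_grossTangent hν hκ hμ₀ (surjective_grossDeriv hr hxr)
  set σ := F.coneAt x with hσ
  set y := F.chart σ x with hy
  have : Nontrivial (Fin n) := Fin.nontrivial_iff_two_le.2 hn
  -- Since w = 0 at this point, the single vanishing coordinate is `j₀`. A second coordinate,
  -- available as n ≥ 2, is left to rotate.
  obtain ⟨j, hj⟩ := exists_ne j₀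
  have hprod : ∏ k, y k = 0 := by
    rw [← F.character_nu_eq_prod hν σ (F.mem_coneAt x), hx]
  have hprodY : ∀ z : ℂ, ∏ k, (if k = j then z else 1) * y k = 0 := by
    intro z
    rw [Finset.prod_mul_distrib, hprod, mul_zero]
  have h := exists_stableDisk_of_hasWinding hν hκ hμ₀ hr σ
    -- Scaling by `z` leaves the moduli unchanged on the unit circle, so the boundary stays in the
    -- fibre, while w - K₂ is the constant -K₂.
    (Y := fun z k => (if k = j then z else 1) * y k) (k := 0) ?_ ?_ ?_ ?_
  · simpa using h
  · refine contDiffOn_pi.2 fun k => ContDiffOn.mul ?_ contDiffOn_const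
    split_ifs
    · exact contDiffOn_id
    · exact contDiffOn_const
  · intro z hz
    refine mem_grossFiber.2 ⟨?_, ?_⟩
    · rw [← (mem_grossFiber.1 hxr).1]
      refine congrArg _ (moment_eq_of_norm_eq hμ₀ σ (F.chart_symm_mem σ _) (F.mem_coneAt x)
        fun k => ?_)
      rw [F.chart_apply_symm, norm_mul]
      split_ifs
      · rw [mem_sphere_zero_iff_norm.1 hz, one_mul]
      · rw [norm_one, one_mul]
    · rw [F.character_nu_chart_symm hν, hprodY, hr₂]
      simp
  · intro h
    have h1 := congrFun h j
    simp only [if_true, zero_mul, ite_self, one_mul] at h1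
    exact hj₀ j hj h1.symm
  · simp only [hprodY, zero_sub]
    exact HasWinding.const (by simpa using hK₂.ne')

/-- The fibres away from the wall bound disks of index two. -/
lemma exists_stableDisk_index_two [NeZero n] (hν : ∀ i, F.pairing ν i = 1)
    (hκ : F.IsToricKahlerForm κ) (hμ₀ : F.IsMomentMap κ μ₀) {c : Fin m → ℝ}
    (hP : Set.range μ₀ = F.polyhedron c) (hK₂ : 0 < K₂) (hr : r ∈ F.grossRegular ν μ₀ K₂)
    (hr₂ : r.2 ≠ 0) :
    ∃ u : StableDisk n (F.grossFiber ν μ₀ K₂ r) 0, u.Nonconstant ∧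
      u.HasMaslovIndex (F.grossTangent ν μ₀ K₂) 2 := by
  obtain ⟨ξ, hξ⟩ := (realLine ν).mkQ_surjective r.1
  obtain ⟨σ⟩ := F.nonempty_maxCone
  obtain ⟨x₀, hx₀, hx₀ξ⟩ := exists_moment_eq_of_character_ne_zero hν hμ₀ hP ξ
  obtain ⟨T, hTs, hTsum, hT⟩ := exists_moduli hν hκ hμ₀ σ hx₀ hx₀ξ
  have hbase : 0 ≤ r.2 + K₂ ^ 2 := by
    have : -K₂ ^ 2 ≤ r.2 := hr.1
    linarith
  have hrho : r.2 + K₂ ^ 2 ≠ 0 := by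
    -- The extreme value q₂ = -K₂² is not regular: its fibre contains a point with w = K₂, built
    -- here with positive coordinates.
    intro h0
    set x := F.realPt σ (T (Real.log K₂)) with hx
    have hwx : F.character ν x = K₂ := by
      rw [hx, F.character_nu_realPt hν, hTsum, ← Complex.ofReal_exp, Real.exp_log hK₂]
    have hxr : x ∈ F.grossFiber ν μ₀ K₂ r := by
      refine mem_grossFiber.2 ⟨?_, ?_⟩
      · rw [← hξ]
        refine (hT x (by rw [hwx]; exact_mod_cast hK₂.ne')).2 fun j => ?_
        rw [hwx, hx, F.chart_realPt, ← Complex.ofReal_exp, Complex.norm_real, Complex.norm_real,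
          Real.norm_of_nonneg (Real.exp_pos _).le, Real.log_exp, Real.norm_of_nonneg hK₂.le]
      · rw [hwx]
        simp
        linarith
    exact (exists_det_sq_grossTangent hν hκ hμ₀ (surjective_grossDeriv hr hxr)).1 hwx
  set ρ := Real.sqrt (r.2 + K₂ ^ 2) with hρ
  have hρ0 : 0 < ρ := Real.sqrt_pos.2 (lt_of_le_of_ne hbase hrho.symm)
  have hρ2 : ρ ^ 2 = r.2 + K₂ ^ 2 := Real.sq_sqrt hbase
  have hρK : ρ ≠ K₂ := by
    intro h
    rw [h] at hρ2
    exact hr₂ (by linarith)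
  -- As ρ ≠ K₂, the function w has no zero on the boundary circle, so the moduli prescribed there
  -- are smooth.
  have hne : ∀ z ∈ Metric.sphere (0 : ℂ) 1, (K₂ + ρ * z : ℂ) ≠ 0 := by
    intro z hz h
    have h1 : (ρ * z : ℂ) = -K₂ := by linear_combination h
    have h2 := congrArg norm h1
    rw [norm_mul, mem_sphere_zero_iff_norm.1 hz, norm_neg, Complex.norm_real, Complex.norm_real,
      Real.norm_of_nonneg hρ0.le, Real.norm_of_nonneg hK₂.le, mul_one] at h2
    exact hρK h2
  have hG : ∀ j, ∃ G : ℂ → ℂ, ContDiffOn ℂ ∞ G (Metric.closedBall 0 1) ∧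
      ∀ z ∈ Metric.sphere (0 : ℂ) 1, (G z).re = T (Real.log ‖(K₂ + ρ * z : ℂ)‖) j := by
    intro j
    obtain ⟨G, hG, hGre⟩ := exists_holomorphic_re_eq
      (fun θ => T (Real.log ‖(K₂ + ρ * Complex.exp (θ * Complex.I) : ℂ)‖) j) (by
        have h1 : ContDiff ℝ ∞ fun θ : ℝ => (K₂ + ρ * Complex.exp (θ * Complex.I) : ℂ) :=
          contDiff_const.add (contDiff_const.mul
            (Complex.ofRealCLM.contDiff.mul contDiff_const).cexp)
        have h2 := fun θ : ℝ => hne _ (exp_mul_I_mem_sphere θ)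
        exact (contDiff_pi.1 hTs j).comp ((h1.norm ℝ h2).log fun θ => norm_ne_zero_iff.2 (h2 θ)))
      (by
        intro θ
        have : Complex.exp ((θ + 2 * Real.pi : ℝ) * Complex.I) = Complex.exp (θ * Complex.I) := by
          push_cast
          rw [add_mul, Complex.exp_periodic]
        simp only [this])
    refine ⟨G, hG, fun z hz => ?_⟩
    have : Complex.exp (z.arg * Complex.I) = z := by
      have := Complex.norm_mul_exp_arg_mul_I z
      rwa [mem_sphere_zero_iff_norm.1 hz, Complex.ofReal_one, one_mul] at this
    rw [← this, hGre]
  choose G hG hGre using hG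
  let j₀ : Fin n := 0
  -- Coordinate `j₀` carries the possible zero of w and compensates the other factors, so that the
  -- product is exactly K₂ + ρz.
  let Y : ℂ → Fin n → ℂ := fun z j => if j = j₀ then
    (K₂ + ρ * z) * Complex.exp (-∑ k ∈ Finset.univ.erase j₀, G k z) else Complex.exp (G j z)
  have hprod : ∀ z, ∏ j, Y z j = K₂ + ρ * z := by
    intro z
    rw [← Finset.mul_prod_erase _ _ (Finset.mem_univ j₀)]
    have : ∏ j ∈ Finset.univ.erase j₀, Y z j = ∏ j ∈ Finset.univ.erase j₀, Complex.exp (G j z) :=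
      Finset.prod_congr rfl fun j hj => if_neg (Finset.ne_of_mem_erase hj)
    rw [this, ← Complex.exp_sum]
    simp only [Y, if_true]
    rw [mul_assoc, ← Complex.exp_add, neg_add_cancel, Complex.exp_zero, mul_one]
  have h := exists_stableDisk_of_hasWinding hν hκ hμ₀ hr σ (Y := Y) (k := 1) ?_ ?_ ?_ ?_
  · simpa using h
  · refine contDiffOn_pi.2 fun j => ?_
    by_cases hj : j = j₀
    · simp only [Y, hj, if_true]
      exact (contDiffOn_const.add (contDiffOn_const.mul contDiffOn_id)).mul
        (ContDiffOn.sum fun k _ => hG k).neg.cexp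
    · simp only [Y, hj, if_false]
      exact (hG j).cexp
  · intro z hz
    have hw : F.character ν ((F.chart σ).symm (Y z)) = K₂ + ρ * z := by
      rw [F.character_nu_chart_symm hν, hprod]
    refine mem_grossFiber.2 ⟨?_, ?_⟩
    · rw [← hξ]
      refine (hT _ (hw.symm ▸ hne z hz)).2 fun j => ?_
      rw [hw, F.chart_apply_symm]
      by_cases hj : j = j₀
      · simp only [Y, hj, if_true]
        rw [norm_mul, Complex.norm_exp, Real.log_mul (norm_ne_zero_iff.2 (hne z hz))
          (Real.exp_pos _).ne', Real.log_exp, Complex.neg_re, Complex.re_sum,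
          Finset.sum_congr rfl fun k _ => hGre k z hz]
        -- The modulus of the compensating coordinate is correct automatically, because the
        -- prescribed logarithms add up to log |w|.
        have h1 := hTsum (Real.log ‖(K₂ + ρ * z : ℂ)‖)
        rw [← Finset.add_sum_erase _ _ (Finset.mem_univ j₀)] at h1
        linarith
      · simp only [Y, hj, if_false]
        rw [Complex.norm_exp, Real.log_exp, hGre j z hz]
    · rw [hw, add_sub_cancel_left, norm_mul, mem_sphere_zero_iff_norm.1 hz, Complex.norm_real,
        Real.norm_of_nonneg hρ0.le, mul_one, hρ2]
      ring
  · intro h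
    have h1 : ∏ j, Y 0 j = ∏ j, Y 1 j := by rw [h]
    rw [hprod, hprod] at h1
    simp [hρ0.ne'] at h1
  · have h1 := HasWinding.of_exp (r := fun _ => ρ) (φ := fun θ => θ) (k := 1) (fun _ => hρ0)
      continuous_id (by simp)
    simpa only [hprod, add_sub_cancel_left] using h1

end SmoothFan

/-! ### The wall and the minimal Maslov index -/

theorem mainTheorem4 {n m : ℕ} (hn : 2 ≤ n) (F : SmoothFan n m)
    (ν : Fin n → ℤ) (hν : ∀ i, F.pairing ν i = 1)
    (κ : F.ToricManifold → (Fin n → ℂ) [⋀^Fin 2]→L[ℝ] ℝ) (hκ : F.IsToricKahlerForm κ)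
    (μ₀ : F.ToricManifold → Fin n → ℝ) (hμ₀ : F.IsMomentMap κ μ₀)
    (c : Fin m → ℝ) (hP : Set.range μ₀ = F.polyhedron c)
    (K₂ : ℝ) (hK₂ : 0 < K₂) :
    (∀ r ∈ F.grossRegular ν μ₀ K₂,
      (∃ (k : ℕ) (u : StableDisk n (F.grossFiber ν μ₀ K₂ r) k),
        u.Nonconstant ∧ u.HasMaslovIndex (F.grossTangent ν μ₀ K₂) 0) ↔ r.2 = 0) ∧
    F.wall ν μ₀ K₂ = {r ∈ F.grossRegular ν μ₀ K₂ | r.2 = 0} ∧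
    ∀ r ∈ F.grossRegular ν μ₀ K₂, r ∉ F.wall ν μ₀ K₂ →
      IsMinimalMaslovIndex (F.grossFiber ν μ₀ K₂ r) (F.grossTangent ν μ₀ K₂) 2 := by
  have : NeZero n := ⟨by omega⟩
  have h1 : ∀ r ∈ F.grossRegular ν μ₀ K₂,
      (∃ (k : ℕ) (u : StableDisk n (F.grossFiber ν μ₀ K₂ r) k),
        u.Nonconstant ∧ u.HasMaslovIndex (F.grossTangent ν μ₀ K₂) 0) ↔ r.2 = 0 := by
    refine fun r hr => ⟨?_, fun h => ⟨0, F.exists_stableDisk_index_zero hn hν hκ hμ₀ hP hK₂ hr h⟩⟩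
    rintro ⟨k, u, hu, hd⟩
    obtain ⟨N, hN, h⟩ := F.exists_stable_index_eq hν hκ hμ₀ hr u hd
    obtain ⟨w₀, hw⟩ := h (by omega)
    by_contra hr₂
    -- A zero value of w at a boundary point would give q₂ = |0 - K₂|² - K₂² = 0, so off the wall
    -- the constant is nonzero.
    refine F.not_nonconstant_of_character_eq hν hκ hμ₀ u (fun h0 => hr₂ ?_) hw hu
    obtain ⟨a, ha⟩ := u.disks_connected.nonempty
    have h2 := (SmoothFan.mem_grossFiber.1 ((u.disk_holomorphic a ha).boundary 1 (by simp))).2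
    rw [hw a _ (coe_mem_componentDomain _ (by simp)), h0] at h2
    simpa using h2.symm
  have h2 : F.wall ν μ₀ K₂ = {r ∈ F.grossRegular ν μ₀ K₂ | r.2 = 0} := by
    ext r
    refine and_congr_right fun hr => ⟨?_, fun h => ?_⟩
    · rintro ⟨d, hd, ⟨u, hu, hd'⟩, -⟩
      obtain ⟨N, rfl, -⟩ := F.exists_stable_index_eq hν hκ hμ₀ hr u hd'
      obtain rfl : N = 0 := by omega
      exact (h1 r hr).1 ⟨0, u, hu, by simpa using hd'⟩
    · refine ⟨0, by norm_num, F.exists_stableDisk_index_zero hn hν hκ hμ₀ hP hK₂ hr h, ?_⟩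
      rintro d ⟨u, -, hd⟩
      obtain ⟨N, rfl, -⟩ := F.exists_stable_index_eq hν hκ hμ₀ hr u hd
      positivity
  refine ⟨h1, h2, fun r hr hrw => ?_⟩
  have hr₂ : r.2 ≠ 0 := fun h => hrw (h2 ▸ ⟨hr, h⟩)
  refine ⟨F.exists_stableDisk_index_two hν hκ hμ₀ hP hK₂ hr hr₂, ?_⟩
  rintro d ⟨u, hu, hd⟩
  obtain ⟨N, rfl, -⟩ := F.exists_stable_index_eq hν hκ hμ₀ hr u hd
  -- Indices are even and nonnegative, so excluding zero leaves at least two.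
  have : N ≠ 0 := by
    rintro rfl
    exact hr₂ ((h1 r hr).1 ⟨0, u, hu, by simpa using hd⟩)
  omega
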